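/- **Setting.** Let $D\subset\mathbb R^2$ be open and let $X:D\times S\to D$ be a two-parameter Lie group of transformations of the $(x,y)$-plane: $S\subset\mathbb R^2$ is open and connected, $0\in S$; $(S,\phi)$ is a group with identity $0$ and analytic law of composition $\phi$; each $X(\cdot,\varepsilon)$ is a bijection of $D$; $X(z,0)=z$ and $X(X(z,\varepsilon),\delta)=X(z,\phi(\varepsilon,\delta))$; $X$ is $C^\infty$ on $D\times S$ and analytic in $\varepsilon$ for each $z$. Its infinitesimal generators are the vector fields $\mathrm X_i=\partial X(z,\varepsilon)/\partial\varepsilon_i|_{\varepsilon=0}$ $(i=1,2)$. For a vector field $V=\xi\partial_x+\eta\partial_y$ write $V^{(1)}=\xi\partial_x+\eta\partial_y+\eta^{(1)}\partial_{y_1}$, $\eta^{(1)}=\frac{d\eta}{dx}-y_1\frac{d\xi}{dx}$, $\frac{d}{dx}=\partial_x+y_1\partial_y$, for its first extension. Let $J\subset D\times\mathbb R$ be open and let $f:J\to\mathbb R$ be of class $C^n$, $1\le n\le\infty$. Suppose that the equation $$y''=f(x,y,y')\tag{1}$$ admits the group: whenever $y_2=f(x,y,y_1)$, also $y_2^*=f(x^*,y^*,y_1^*)$,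 for every $\varepsilon\in S$ and every $(x,y,y_1)\in J$ for which the transformed derivatives $y_1^*$, $y_2^*$ are defined and $(x^*,y^*,y_1^*)\in J$. For a function of $(x,y,y_1)$ write $\mathcal D_{y_2}=\partial_x+y_1\partial_y+y_2\partial_{y_1}$, and let $A=\partial_x+y_1\partial_y+f\partial_{y_1}$. **Theorem (reduction of a second-order ODE to two integrals).** (a) There are $Y_1=c_1\mathrm X_1+c_2\mathrm X_2$ and $Y_2=d_1\mathrm X_1+d_2\mathrm X_2$, with $c,d\in\mathbb R^2$ linearly independent, and $\lambda\in\mathbb R$ such that $[Y_1,Y_2]=\lambda Y_1$ on $D$. Now let $Y_1,Y_2,\lambda$ be any such choice and let $P_0=(x_0,y_0,p_0)\in J$ be a point at which $Y_1(x_0,y_0)$ is not a multiple of $(1,p_0)$. (b) On a neighbourhood $U\subset J$ of $P_0$ there are $C^\infty$ functions $v(x,y)$, $w(x,y,y_1)$ with $Y_1v=0$, $Y_1^{(1)}w=0$, $\partial w/\partial y_1\ne0$ and $dv/dx\ne0$, and a $C^n$ function $Z$ on the open set $(v,w)(U)$, such that on $U$ $$y_2=f(x,y,y_1)\iff\frac{dw}{dv}:=\frac{\mathcal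 D_{y_2}w}{v_x+y_1v_y}=Z(v,w).$$ There are $C^\infty$ functions $h,g$ with $Y_2v=h(v)$, $Y_2^{(1)}w=g(v,w)$, and the first-order equation $dw/dv=Z(v,w)$ admits $\tilde Y_2=h(v)\partial_v+g(v,w)\partial_w$: the extension of $\tilde Y_2$ annihilates $w_1-Z(v,w)$ whenever $w_1=Z(v,w)$. (c) Suppose that $A,Y_1^{(1)},Y_2^{(1)}$ are linearly independent at $P_0$. Then, on a neighbourhood $U'\subset U$ of $P_0$, there are canonical coordinates $\tilde r(v,w),\tilde s(v,w)$ of $\tilde Y_2$ (so $\tilde Y_2\tilde r=0$, $\tilde Y_2\tilde s=1$) with $A\tilde r\ne0$, canonical coordinates $r(x,y),s(x,y)$ of $Y_1$ (so $Y_1r=0$, $Y_1s=1$) with $r_x+y_1r_y\ne0$, and a $C^n$ function $H$, given explicitly by $H(\tilde r)=A\tilde s/A\tilde r$, such that: 1. (first integral) for $(x,y,y_1)\in U'$, $y_2=f(x,y,y_1)$ if and only if $\mathcal D_{y_2}\tilde s=H(\tilde r)\,\mathcal D_{y_2}\tilde r$, i.e. (1) becomes $d\tilde s/d\tilde r=H(\tilde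 r)$; a twice differentiable $y$ on an open interval with $(x,y,y')\in U'$ solves (1) if and only if $\tilde s=\sigma(\tilde r)$ along $y$ for some $\sigma$ with $\sigma'=H$ on $\tilde r(U')$; 2. (second integral) for every $\sigma$ with $\sigma'=H$ on $\tilde r(U')$ such that $\tilde s=\sigma(\tilde r)$ somewhere on $U'$, there is a $C^n$ function $G$ on $r(U')$, implicitly determined by $\sigma$ in the sense that on $U'$ $$\tilde s(v,w)=\sigma(\tilde r(v,w))\iff\frac{s_x+y_1s_y}{r_x+y_1r_y}=G(r),$$ where every value of $r$ on $U'$ is attained at a point of $U'$ at which these equations hold; and for $y$ as in 1, $\tilde s=\sigma(\tilde r)$ along $y$ if and only if the curve $(r(x,y(x)),s(x,y(x)))$ lies on the graph of a solution of $$\frac{ds}{dr}=G(r).$$ (d) Suppose instead that $A,Y_1^{(1)},Y_2^{(1)}$ are linearly dependent at all points near $P_0$, while $Y_1^{(1)},Y_2^{(1)}$ are linearly independent at $P_0$. Then the conclusions of (c) hold with $H=0$ and with the roles of the two canonical coordinates of $\tilde Y_2$ exchanged ($\tilde Y_2\tilde r=1$, $\tilde Y_2\tilde s=0$). -/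

import Mathlib

open Set Topology
open scoped ContDiff

/-- A two-parameter Lie group of transformations of the open set `D` of the `(x,y)`-plane:
`S` is the parameter set, `φ` the law of composition on `S` (with identity `0`), and
`X z ε` is the image of the point `z` under the transformation with parameter `ε`. -/
structure IsTwoParameterLieGroup (D S : Set (ℝ × ℝ)) (φ X : ℝ × ℝ → ℝ × ℝ → ℝ × ℝ) : Prop where
  isOpen_domain : IsOpen D
  isOpen_param : IsOpen S
  isConnected_param : IsConnected S
  comp_mem : ∀ ε ∈ S, ∀ δ ∈ S, φ ε δ ∈ S
  comp_assoc : ∀ ε ∈ S, ∀ δ ∈ S, ∀ κ ∈ S, φ (φ ε δ) κ = φ ε (φ δ κ)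
  zero_mem : (0 : ℝ × ℝ) ∈ S
  zero_comp : ∀ ε ∈ S, φ 0 ε = ε
  comp_zero : ∀ ε ∈ S, φ ε 0 = ε
  exists_inv : ∀ ε ∈ S, ∃ δ ∈ S, φ ε δ = 0 ∧ φ δ ε = 0
  bijOn : ∀ ε ∈ S, BijOn (fun z => X z ε) D D
  act_zero : ∀ z ∈ D, X z 0 = z
  act_comp : ∀ z ∈ D, ∀ ε ∈ S, ∀ δ ∈ S, X (X z ε) δ = X z (φ ε δ)
  smooth : ContDiffOn ℝ ∞ (fun q : (ℝ × ℝ) × (ℝ × ℝ) => X q.1 q.2) (D ×ˢ S)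
  analytic_act : ∀ z ∈ D, AnalyticOnNhd ℝ (X z) S
  analytic_comp : AnalyticOnNhd ℝ (fun q : (ℝ × ℝ) × (ℝ × ℝ) => φ q.1 q.2) (S ×ˢ S)

/-- The coefficient vector field of the element `c₁ X₁ + c₂ X₂` of the span of the two infinitesimal
generators, where `Xᵢ` has coefficients `∂X(z,ε)/∂εᵢ` at `ε = 0`.
A vector field `V` acts on a function `F` by `(V F)(z) = fderiv ℝ F z (V z)`. -/
noncomputable def generator (X : ℝ × ℝ → ℝ × ℝ → ℝ × ℝ) (c z : ℝ × ℝ) : ℝ × ℝ :=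
  c.1 • fderiv ℝ (X z) 0 (1, 0) + c.2 • fderiv ℝ (X z) 0 (0, 1)

/-- The point `(x,y)` below the first-order jet `P = (x,y,y₁)`. -/
def base (P : ℝ × ℝ × ℝ) : ℝ × ℝ := (P.1, P.2.1)

/-- The total derivative `F_x + y₁ F_y` at `P = (x,y,y₁)` of a function `F(x,y)`. -/
noncomputable def totalDeriv₀ (F : ℝ × ℝ → ℝ) (P : ℝ × ℝ × ℝ) : ℝ :=
  fderiv ℝ F (base P) (1, P.2.2)

/-- The total derivative `F_x + y₁ F_y + y₂ F_{y₁}` at `P = (x,y,y₁)` of a function `F(x,y,y₁)`. -/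
noncomputable def totalDeriv₁ (F : ℝ × ℝ × ℝ → ℝ) (P : ℝ × ℝ × ℝ) (y₂ : ℝ) : ℝ :=
  fderiv ℝ F P (1, P.2.2, y₂)

/-- For a transformation `T = (T₁,T₂)` of the plane, the transformed slope
`y₁* = (∂ₓT₂ + y₁ ∂_yT₂) / (∂ₓT₁ + y₁ ∂_yT₁)`. -/
noncomputable def slopeMap (T : ℝ × ℝ → ℝ × ℝ) (P : ℝ × ℝ × ℝ) : ℝ :=
  totalDeriv₀ (fun z => (T z).2) P / totalDeriv₀ (fun z => (T z).1) P

/-- The transformed second derivative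
`y₂* = (∂ₓy₁* + y₁ ∂_yy₁* + y₂ ∂_{y₁}y₁*) / (∂ₓT₁ + y₁ ∂_yT₁)`. -/
noncomputable def secondMap (T : ℝ × ℝ → ℝ × ℝ) (P : ℝ × ℝ × ℝ) (y₂ : ℝ) : ℝ :=
  totalDeriv₁ (slopeMap T) P y₂ / totalDeriv₀ (fun z => (T z).1) P

/-- The transformed first-order jet `(x*, y*, y₁*)`. -/
noncomputable def jetMap (T : ℝ × ℝ → ℝ × ℝ) (P : ℝ × ℝ × ℝ) : ℝ × ℝ × ℝ :=
  ((T (base P)).1, (T (base P)).2, slopeMap T P)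

/-- The equation `y'' = f(x,y,y')`, with `f` given on `J`, admits the transformations `X(·,ε)`:
`y₂ = f(x,y,y₁)` implies `y₂* = f(x*,y*,y₁*)`, wherever the two sides are defined. -/
def AdmitsGroup (S : Set (ℝ × ℝ)) (X : ℝ × ℝ → ℝ × ℝ → ℝ × ℝ)
    (J : Set (ℝ × ℝ × ℝ)) (f : ℝ × ℝ × ℝ → ℝ) : Prop :=
  ∀ ε ∈ S, ∀ P ∈ J, totalDeriv₀ (fun z => (X z ε).1) P ≠ 0 → jetMap (fun z => X z ε) P ∈ J →
    ∀ y₂ : ℝ, y₂ = f P → secondMap (fun z => X z ε) P y₂ = f (jetMap (fun z => X z ε) P)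

/-- The first extended infinitesimal generator of `V = ξ ∂ₓ + η ∂_y`, that is
`ξ ∂ₓ + η ∂_y + η⁽¹⁾ ∂_{y₁}` with `η⁽¹⁾ = dη/dx - y₁ dξ/dx`. -/
noncomputable def prolong (V : ℝ × ℝ → ℝ × ℝ) (P : ℝ × ℝ × ℝ) : ℝ × ℝ × ℝ :=
  ((V (base P)).1, (V (base P)).2,
    totalDeriv₀ (fun z => (V z).2) P - P.2.2 * totalDeriv₀ (fun z => (V z).1) P)

/-- `generator X c`, `generator X d` are given by a basis of the parameters of the Lie algebra,
and `[generator X c, generator X d] = k • generator X c`, so that the first one spans a normal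
subalgebra. -/
def IsSolvableBasis (D : Set (ℝ × ℝ)) (X : ℝ × ℝ → ℝ × ℝ → ℝ × ℝ) (c d : ℝ × ℝ) (k : ℝ) : Prop :=
  LinearIndependent ℝ ![c, d] ∧
    ∀ z ∈ D, VectorField.lieBracket ℝ (generator X c) (generator X d) z = k • generator X c z

/-- `(a,b)` is a smooth coordinate system on the subset `B` of the plane. -/
structure IsCoordinateSystem (a b : ℝ × ℝ → ℝ) (B : Set (ℝ × ℝ)) : Prop where
  smooth_fst : ContDiffOn ℝ ∞ a B
  smooth_snd : ContDiffOn ℝ ∞ b B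
  injOn : InjOn (fun z => (a z, b z)) B
  jacobian : ∀ z ∈ B, LinearIndependent ℝ ![fderiv ℝ a z, fderiv ℝ b z]

/-- `(a,b)` are canonical coordinates on `B` for the generator `V`: `V a = 0` and `V b = 1`. -/
structure IsCanonical (V : ℝ × ℝ → ℝ × ℝ) (a b : ℝ × ℝ → ℝ) (B : Set (ℝ × ℝ)) : Prop where
  coord : IsCoordinateSystem a b B
  invariant : ∀ z ∈ B, fderiv ℝ a z (V z) = 0
  translated : ∀ z ∈ B, fderiv ℝ b z (V z) = 1

/-- The pair `(v(x,y), w(x,y,y₁))` of reduced variables. -/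
def reduced (v : ℝ × ℝ → ℝ) (w : ℝ × ℝ × ℝ → ℝ) (P : ℝ × ℝ × ℝ) : ℝ × ℝ := (v (base P), w P)

/-- The field `h(v) ∂_v + g(v,w) ∂_w` on the plane of the reduced variables. -/
def reducedField (h : ℝ → ℝ) (g : ℝ × ℝ → ℝ) (q : ℝ × ℝ) : ℝ × ℝ := (h q.1, g q)

/-- On `U`, the equation `y'' = f(x,y,y')` is the first-order equation `dw/dv = Z(v,w)` for
invariants `v(x,y)` of `V₁` and `w(x,y,y₁)` of its first extension, and this first-order equation
admits the second generator `V₂`, whose first extension is `h(v) ∂_v + g(v,w) ∂_w`. -/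
structure ReducesToFirstOrder (n : ℕ∞) (f : ℝ × ℝ × ℝ → ℝ) (V₁ V₂ : ℝ × ℝ → ℝ × ℝ)
    (U : Set (ℝ × ℝ × ℝ)) (v : ℝ × ℝ → ℝ) (w : ℝ × ℝ × ℝ → ℝ)
    (Z : ℝ × ℝ → ℝ) (h : ℝ → ℝ) (g : ℝ × ℝ → ℝ) : Prop where
  smooth_v : ContDiffOn ℝ ∞ v (base '' U)
  smooth_w : ContDiffOn ℝ ∞ w U
  invariant_v : ∀ P ∈ U, fderiv ℝ v (base P) (V₁ (base P)) = 0
  invariant_w : ∀ P ∈ U, fderiv ℝ w P (prolong V₁ P) = 0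
  depends_w : ∀ P ∈ U, fderiv ℝ w P (0, 0, 1) ≠ 0
  deriv_v_ne_zero : ∀ P ∈ U, totalDeriv₀ v P ≠ 0
  isOpen_image : IsOpen (reduced v w '' U)
  smooth_Z : ContDiffOn ℝ n Z (reduced v w '' U)
  smooth_h : ContDiffOn ℝ ∞ h (Prod.fst '' (reduced v w '' U))
  smooth_g : ContDiffOn ℝ ∞ g (reduced v w '' U)
  /-- the second-order equation is equivalent to `dw/dv = Z(v,w)` -/
  equation_iff : ∀ P ∈ U, ∀ y₂ : ℝ,
    y₂ = f P ↔ totalDeriv₁ w P y₂ / totalDeriv₀ v P = Z (reduced v w P)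
  second_v : ∀ P ∈ U, fderiv ℝ v (base P) (V₂ (base P)) = h (v (base P))
  second_w : ∀ P ∈ U, fderiv ℝ w P (prolong V₂ P) = g (reduced v w P)
  /-- the extension of `h ∂_v + g ∂_w` annihilates `w₁ - Z(v,w)` whenever `w₁ = Z(v,w)` -/
  admits_second : ∀ q ∈ reduced v w '' U,
    (prolong (reducedField h g) (q.1, q.2, Z q)).2.2 = fderiv ℝ Z q (reducedField h g q)

/-- `y` is twice differentiable on the open interval `I`, with derivatives `y₁`, `y₂`, and its
first-order jet stays in `U`. -/
structure IsCurveIn (U : Set (ℝ × ℝ × ℝ)) (I : Set ℝ) (y y₁ y₂ : ℝ → ℝ) : Prop where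
  isOpen : IsOpen I
  isPreconnected : IsPreconnected I
  deriv_fst : ∀ x ∈ I, HasDerivAt y (y₁ x) x
  deriv_snd : ∀ x ∈ I, HasDerivAt y₁ (y₂ x) x
  mem : ∀ x ∈ I, (x, y x, y₁ x) ∈ U

/-- The parametrized curve `x ↦ (ρ x, τ x)`, `x ∈ I`, lies on the graph of a function `s` that solves
`ds/dr = K(r)` at the points `r = ρ x`. -/
def SolvesIntegral (K ρ τ : ℝ → ℝ) (I : Set ℝ) : Prop :=
  ∃ s : ℝ → ℝ, ∀ x ∈ I, τ x = s (ρ x) ∧ HasDerivAt s (K (ρ x)) (ρ x)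

/-- `G` is the function that is implicitly determined on `r(U)` by a solution `σ` of
`ds̃/dr̃ = H(r̃)`: the first-order equation `s̃ = σ(r̃)` (an equation in `x, y, y₁`, where `rt`, `st`
are functions of `v(x,y)` and `w(x,y,y₁)`) is `ds/dr = G(r)` in the coordinates `r(x,y)`,
`s(x,y)`. -/
structure IsSecondIntegral (n : ℕ∞) (U : Set (ℝ × ℝ × ℝ)) (v : ℝ × ℝ → ℝ) (w : ℝ × ℝ × ℝ → ℝ)
    (rt st r s : ℝ × ℝ → ℝ) (σ G : ℝ → ℝ) : Prop where
  smooth_G : ContDiffOn ℝ n G (r '' (base '' U))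
  determined : ∀ ρ ∈ r '' (base '' U), ∃ P ∈ U,
    r (base P) = ρ ∧ st (reduced v w P) = σ (rt (reduced v w P))
  equation_iff : ∀ P ∈ U, st (reduced v w P) = σ (rt (reduced v w P)) ↔
    totalDeriv₀ s P / totalDeriv₀ r P = G (r (base P))
  curve_iff : ∀ (I : Set ℝ) (y y₁ y₂ : ℝ → ℝ), IsCurveIn U I y y₁ y₂ →
    ((∀ x ∈ I, st (reduced v w (x, y x, y₁ x)) = σ (rt (reduced v w (x, y x, y₁ x)))) ↔
      SolvesIntegral G (fun x => r (x, y x)) (fun x => s (x, y x)) I)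

/-- On `U`, with coordinates `rt`, `st` of the plane of the reduced variables `v`, `w`, the equation
`y'' = f(x,y,y')` is `ds̃/dr̃ = H(r̃)`; and in canonical coordinates `r`, `s` of `V₁` every solution
`σ` of this first integral leaves a second integral `ds/dr = G(r)`. -/
structure ReducesToTwoIntegrals (n : ℕ∞) (f : ℝ × ℝ × ℝ → ℝ) (V₁ : ℝ × ℝ → ℝ × ℝ)
    (U : Set (ℝ × ℝ × ℝ)) (v : ℝ × ℝ → ℝ) (w : ℝ × ℝ × ℝ → ℝ)
    (rt st : ℝ × ℝ → ℝ) (H : ℝ → ℝ) (r s : ℝ × ℝ → ℝ) : Prop where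
  coord_tilde : IsCoordinateSystem rt st (reduced v w '' U)
  smooth_H : ContDiffOn ℝ n H (rt '' (reduced v w '' U))
  deriv_rt_ne_zero : ∀ P ∈ U, totalDeriv₁ (fun Q => rt (reduced v w Q)) P (f P) ≠ 0
  /-- the explicit formula for `H` -/
  formula_H : ∀ P ∈ U, H (rt (reduced v w P)) =
    totalDeriv₁ (fun Q => st (reduced v w Q)) P (f P) /
      totalDeriv₁ (fun Q => rt (reduced v w Q)) P (f P)
  equation_iff : ∀ P ∈ U, ∀ y₂ : ℝ, y₂ = f P ↔
    totalDeriv₁ (fun Q => st (reduced v w Q)) P y₂ =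
      H (rt (reduced v w P)) * totalDeriv₁ (fun Q => rt (reduced v w Q)) P y₂
  /-- `y` solves the second-order equation iff `s̃ = σ(r̃)` along `y`, with `σ` a primitive of `H` -/
  curve_iff : ∀ (I : Set ℝ) (y y₁ y₂ : ℝ → ℝ), IsCurveIn U I y y₁ y₂ →
    ((∀ x ∈ I, y₂ x = f (x, y x, y₁ x)) ↔
      ∃ σ : ℝ → ℝ, (∀ t ∈ rt '' (reduced v w '' U), HasDerivAt σ (H t) t) ∧
        ∀ x ∈ I, st (reduced v w (x, y x, y₁ x)) = σ (rt (reduced v w (x, y x, y₁ x))))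
  canonical : IsCanonical V₁ r s (base '' U)
  deriv_r_ne_zero : ∀ P ∈ U, totalDeriv₀ r P ≠ 0
  second_integral : ∀ σ : ℝ → ℝ, (∀ t ∈ rt '' (reduced v w '' U), HasDerivAt σ (H t) t) →
    (∃ P ∈ U, st (reduced v w P) = σ (rt (reduced v w P))) →
    ∃ G : ℝ → ℝ, IsSecondIntegral n U v w rt st r s σ G

/-!
The one-parameter subgroups of the group are smooth local flows of the generators, and the flow of
the first extension of a generator `V` permutes the solution jets: `[V⁽¹⁾, A]` is a multiple of
`A = ∂ₓ + y₁ ∂_y + f ∂_{y₁}`. A two-dimensional Lie algebra has a basis with `[Y₁, Y₂] = λ Y₁`.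
Straightening `Y₁` to `∂_s` by coordinates `(v, s)` of the plane straightens `Y₁⁽¹⁾` to `∂_s` in the
coordinates `(v, w = ds/dv, s)` of the jet space. Functions annihilated by `Y₁⁽¹⁾` are functions of
`(v, w)`: among them the slope `Z` of the image of `A`, and, by the bracket relation, the components
of the image of `Y₂⁽¹⁾`. The reduced field so obtained has a local flow, whence canonical
coordinates. If it is transverse to `(1, Z)`, the slope of the image of `(1, Z)` in these
coordinates does not depend on the translated one, and the equation is separated; if it is parallel
to `(1, Z)`, its orbits are the solutions. A first integral `s̃ = σ(r̃)` is solved for `w` by the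
implicit function theorem, and since `w = ds/dv` it then reads `ds/dv = G(v)`.
-/

section Calculus

variable {E F : Type*} [NormedAddCommGroup E] [NormedSpace ℝ E]
  [NormedAddCommGroup F] [NormedSpace ℝ F]

theorem fderiv_comp_prodMk_left_apply {Ψ : E × ℝ → F} {x : E} {t : ℝ}
    (hΨ : DifferentiableAt ℝ Ψ (x, t)) (u : E) :
    fderiv ℝ (fun y => Ψ (y, t)) x u = fderiv ℝ Ψ (x, t) (u, 0) := by
  have h : HasFDerivAt (fun y => Ψ (y, t)) _ x :=
    hΨ.hasFDerivAt.comp x (f := fun y => (y, t)) (hasFDerivAt_prodMk_left x t)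
  simp [h.fderiv]

theorem hasDerivAt_comp_prodMk_right {Ψ : E × ℝ → F} {x : E} {t : ℝ}
    (hΨ : DifferentiableAt ℝ Ψ (x, t)) :
    HasDerivAt (fun τ => Ψ (x, τ)) (fderiv ℝ Ψ (x, t) (0, 1)) t :=
  HasFDerivAt.comp_hasDerivAt t (f := fun τ => (x, τ)) hΨ.hasFDerivAt
    ((hasDerivAt_const t x).prodMk (hasDerivAt_id t))

theorem hasDerivAt_fderiv_comm {Ψ : E × ℝ → F} {x : E} {t : ℝ} (hΨ : ContDiffAt ℝ 2 Ψ (x, t))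
    (u : E) :
    HasDerivAt (fun τ => fderiv ℝ (fun y => Ψ (y, τ)) x u)
      (fderiv ℝ (fun y => deriv (fun τ => Ψ (y, τ)) t) x u) t := by
  have hev : ∀ᶠ p in 𝓝 (x, t), DifferentiableAt ℝ Ψ p :=
    (hΨ.eventually (by simp)).mono fun p hp => hp.differentiableAt (by simp)
  have hd : DifferentiableAt ℝ (fderiv ℝ Ψ) (x, t) :=
    (hΨ.fderiv_right (m := 1) (by norm_num)).differentiableAt (by simp)
  have hspace : (fun τ => fderiv ℝ (fun y => Ψ (y, τ)) x u) =ᶠ[𝓝 t]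
      fun τ => fderiv ℝ Ψ (x, τ) (u, 0) := by
    filter_upwards [(Continuous.prodMk_right x).continuousAt.eventually hev] with τ hτ
    exact fderiv_comp_prodMk_left_apply hτ u
  have htime :
      (fun y => deriv (fun τ => Ψ (y, τ)) t) =ᶠ[𝓝 x] fun y => fderiv ℝ Ψ (y, t) (0, 1) := by
    filter_upwards [(Continuous.prodMk_left t).continuousAt.eventually hev] with y hy
    exact (hasDerivAt_comp_prodMk_right hy).deriv
  have hτ : HasDerivAt (fun τ => fderiv ℝ Ψ (x, τ) (u, 0))
      (fderiv ℝ (fderiv ℝ Ψ) (x, t) (0, 1) (u, 0)) t := by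
    simpa using (hasDerivAt_comp_prodMk_right hd).clm_apply (hasDerivAt_const t ((u, 0) : E × ℝ))
  have hy : fderiv ℝ (fun y => fderiv ℝ Ψ (y, t) (0, 1)) x u =
      fderiv ℝ (fderiv ℝ Ψ) (x, t) (u, 0) (0, 1) := by
    rw [fderiv_comp_prodMk_left_apply (Ψ := fun p => fderiv ℝ Ψ p (0, 1)) (by fun_prop),
      fderiv_clm_apply hd (by fun_prop)]
    simp
  rw [htime.fderiv_eq, hy, (hΨ.isSymmSndFDerivAt (by simp)).eq (u, 0) (0, 1)]
  exact hτ.congr_of_eventuallyEq hspace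

theorem fderiv_div_apply {a b : E → ℝ} {x : E} (ha : DifferentiableAt ℝ a x)
    (hb : DifferentiableAt ℝ b x) (hx : b x ≠ 0) (u : E) :
    fderiv ℝ (fun y => a y / b y) x u =
      (fderiv ℝ a x u - a x / b x * fderiv ℝ b x u) / b x := by
  have hinv : HasFDerivAt (fun y => (b y)⁻¹) ((-(b x ^ 2)⁻¹) • fderiv ℝ b x) x :=
    (hasDerivAt_inv hx).comp_hasFDerivAt x hb.hasFDerivAt
  simp only [div_eq_mul_inv, (ha.hasFDerivAt.fun_mul hinv).fderiv, add_apply, smul_apply,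
    smul_eq_mul]
  field_simp
  ring

/-- The slope at `y` of the image in the plane, under `R`, of the integral curve of `A` through `y`.
Its value is `0` where the image is tangent to the vertical direction. -/
noncomputable def slopeAlong (R : E → ℝ × ℝ) (A : E → E) (y : E) : ℝ :=
  (fderiv ℝ R y (A y)).2 / (fderiv ℝ R y (A y)).1

theorem fderiv_apply_eq_smul_slopeAlong {R : E → ℝ × ℝ} {A : E → E} {y : E}
    (hy : (fderiv ℝ R y (A y)).1 ≠ 0) :
    fderiv ℝ R y (A y) = (fderiv ℝ R y (A y)).1 • (1, slopeAlong R A y) := by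
  rw [Prod.smul_mk, smul_eq_mul, smul_eq_mul, mul_one, slopeAlong, mul_div_cancel₀ _ hy]

theorem contDiffAt_slopeAlong {n : WithTop ℕ∞} {R : E → ℝ × ℝ} {A : E → E} {y : E}
    (hR : ContDiffAt ℝ ∞ R y) (hn : n ≤ ∞) (hA : ContDiffAt ℝ n A y)
    (hy : (fderiv ℝ R y (A y)).1 ≠ 0) : ContDiffAt ℝ n (slopeAlong R A) y :=
  have h : ContDiffAt ℝ n (fun z => fderiv ℝ R z (A z)) y :=
    ((hR.fderiv_right (m := ∞) (by simp)).of_le hn).clm_apply hA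
  h.snd.div h.fst hy

/-- The flow of `W` permutes the integral curves of `A`, so it acts on their slopes by the first
extension of the motion `c` that it induces in the plane. -/
theorem fderiv_slopeAlong_of_lieBracket_eq_smul {A W : E → E} {R c : E → ℝ × ℝ} {x : E} {μ : ℝ}
    (hR : ContDiffAt ℝ 2 R x) (hA : DifferentiableAt ℝ A x) (hW : DifferentiableAt ℝ W x)
    (hx : (fderiv ℝ R x (A x)).1 ≠ 0) (hbr : VectorField.lieBracket ℝ W A x = μ • A x)
    (hc : ∀ᶠ y in 𝓝 x, fderiv ℝ R y (W y) = c y) :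
    fderiv ℝ (slopeAlong R A) x (W x) =
      ((fderiv ℝ c x (A x)).2 - slopeAlong R A x * (fderiv ℝ c x (A x)).1) /
        (fderiv ℝ R x (A x)).1 := by
  have hRA : DifferentiableAt ℝ (fun y => fderiv ℝ R y (A y)) x :=
    ((hR.fderiv_right (m := 1) (by norm_num)).differentiableAt (by simp)).clm_apply hA
  have hcomm : fderiv ℝ (fun y => fderiv ℝ R y (A y)) x (W x) =
      fderiv ℝ c x (A x) + μ • fderiv ℝ R x (A x) := by
    have h := VectorField.fderiv_apply_lieBracket hR (by simp) hA hW
    rw [hbr, map_smul, Filter.EventuallyEq.fderiv_eq hc] at h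
    rw [h, add_sub_cancel]
  have hquot := fderiv_div_apply hRA.snd hRA.fst hx (W x)
  rw [hRA.hasFDerivAt.snd.fderiv, hRA.hasFDerivAt.fst.fderiv] at hquot
  refine hquot.trans ?_
  simp only [ContinuousLinearMap.comp_apply, ContinuousLinearMap.coe_fst',
    ContinuousLinearMap.coe_snd', hcomm, Prod.fst_add, Prod.snd_add, Prod.smul_fst,
    Prod.smul_snd, smul_eq_mul, slopeAlong]
  field_simp
  ring

/-- `e` is a `C^n` chart around `x`, with `C^n` inverse, whose image is a ball centred at `e x`. -/
structure IsBallChart (n : WithTop ℕ∞) (e : OpenPartialHomeomorph E F) (x : E) : Prop where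
  mem_source : x ∈ e.source
  contDiffAt : ∀ y ∈ e.source, ContDiffAt ℝ n e y
  contDiffAt_symm : ∀ p ∈ e.target, ContDiffAt ℝ n e.symm p
  exists_target_eq : ∃ ρ, e.target = Metric.ball (e x) ρ

namespace IsBallChart

variable {n : WithTop ℕ∞} {e : OpenPartialHomeomorph E F} {x : E}

theorem fderiv_symm_fderiv (he : IsBallChart n e x) (hn : n ≠ 0) {y : E} (hy : y ∈ e.source)
    (u : E) : fderiv ℝ e.symm (e y) (fderiv ℝ e y u) = u := by
  have h := ((he.contDiffAt_symm _ (e.map_source hy)).differentiableAt hn).hasFDerivAt.comp y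
    ((he.contDiffAt y hy).differentiableAt hn).hasFDerivAt
  have hid : e.symm ∘ e =ᶠ[𝓝 y] id := e.eventually_left_inverse hy
  exact congrArg (fun L : E →L[ℝ] E => L u)
    ((h.congr_of_eventuallyEq hid.symm).unique (hasFDerivAt_id y))

theorem injective_fderiv (he : IsBallChart n e x) (hn : n ≠ 0) {y : E} (hy : y ∈ e.source) :
    Function.Injective (fderiv ℝ e y) :=
  Function.LeftInverse.injective (he.fderiv_symm_fderiv hn hy)

theorem isPreconnected_source (he : IsBallChart n e x) : IsPreconnected e.source := by
  obtain ⟨ρ, hρ⟩ := he.exists_target_eq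
  rw [← e.symm_image_target_eq_source, hρ]
  exact (convex_ball _ _).isPreconnected.image _ (hρ ▸ e.continuousOn_symm)

end IsBallChart

theorem exists_isBallChart_restrict {n : WithTop ℕ∞} {e : OpenPartialHomeomorph E F} {x : E}
    (hx : x ∈ e.source) (he : ∀ y ∈ e.source, ContDiffAt ℝ n e y)
    (he' : ∀ p ∈ e.target, ContDiffAt ℝ n e.symm p) {O : Set E} (hO : O ∈ 𝓝 x) :
    ∃ e' : OpenPartialHomeomorph E F, (e' : E → F) = e ∧ (e'.symm : F → E) = e.symm ∧
      e'.source ⊆ e.source ∩ O ∧ IsBallChart n e' x := by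
  have hnhds : e.target ∩ e.symm ⁻¹' O ∈ 𝓝 (e x) :=
    Filter.inter_mem (e.open_target.mem_nhds (e.map_source hx)) <|
      (e.symm.continuousAt (e.map_source hx)).preimage_mem_nhds (by rwa [e.left_inv hx])
  obtain ⟨ρ, hρ, hball⟩ := Metric.mem_nhds_iff.1 hnhds
  have hsource : ∀ y ∈ e.source, e y ∈ Metric.ball (e x) ρ → y ∈ O := fun y hy hyb => by
    simpa only [mem_preimage, e.left_inv hy] using (hball hyb).2
  have hmem : ∀ y, y ∈ (e.symm.restrOpen _ Metric.isOpen_ball).symm.source ↔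
      y ∈ e.source ∧ e y ∈ Metric.ball (e x) ρ := fun y => by
    rw [OpenPartialHomeomorph.symm_source]
    rfl
  refine ⟨(e.symm.restrOpen (Metric.ball (e x) ρ) Metric.isOpen_ball).symm, rfl, rfl,
    fun y hy => ?_, (hmem x).2 ⟨hx, Metric.mem_ball_self hρ⟩, fun y hy => ?_, fun p hp => ?_, ρ, ?_⟩
  · exact ⟨((hmem y).1 hy).1, hsource y ((hmem y).1 hy).1 ((hmem y).1 hy).2⟩
  · exact he y ((hmem y).1 hy).1
  · exact he' p hp.1
  · exact inter_eq_right.2 fun p hp => (hball hp).1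

theorem exists_isBallChart [FiniteDimensional ℝ E] [FiniteDimensional ℝ F]
    (hdim : Module.finrank ℝ E = Module.finrank ℝ F) {n : WithTop ℕ∞} (hn : n ≠ 0) {φ : E → F}
    {x : E} (hφ : ∀ᶠ y in 𝓝 x, ContDiffAt ℝ n φ y) (hinj : Function.Injective (fderiv ℝ φ x))
    {O : Set E} (hO : O ∈ 𝓝 x) :
    ∃ e : OpenPartialHomeomorph E F, (e : E → F) = φ ∧ e.source ⊆ O ∧ IsBallChart n e x := by
  have : CompleteSpace E := FiniteDimensional.complete ℝ E
  have hx : ContDiffAt ℝ n φ x := hφ.self_of_nhds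
  let A : E ≃L[ℝ] F :=
    (LinearEquiv.ofInjectiveOfFinrankEq
      (fderiv ℝ φ x : E →ₗ[ℝ] F) hinj hdim).toContinuousLinearEquiv
  have hA : (A : E →L[ℝ] F) = fderiv ℝ φ x := by ext y; rfl
  have hd : HasFDerivAt φ (A : E →L[ℝ] F) x := by
    rw [hA]; exact (hx.differentiableAt hn).hasFDerivAt
  have hinv : ∀ᶠ y in 𝓝 x, ∃ B : E ≃L[ℝ] F, (B : E →L[ℝ] F) = fderiv ℝ φ y := by
    have hcont : ContinuousAt (fderiv ℝ φ) x :=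
      ((hx.of_le (ENat.one_le_iff_ne_zero_withTop.2 hn)).fderiv_right (m := 0)
        (by simp)).continuousAt
    exact hcont.eventually (hA ▸ A.nhds)
  obtain ⟨W, hW, hWo, hxW⟩ := eventually_nhds_iff.1 ((hφ.and hinv).and hO)
  set e := (hx.toOpenPartialHomeomorph φ hd hn).restrOpen W hWo
  have hxe : x ∈ e.source := ⟨hx.mem_toOpenPartialHomeomorph_source hd hn, hxW⟩
  obtain ⟨e', he', -, hsub, hchart⟩ := exists_isBallChart_restrict (e := e) hxe
    (fun y hy => (hW y hy.2).1.1) (fun p hp => by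
      obtain ⟨⟨hsmooth, B, hB⟩, -⟩ := hW _ (e.map_target hp).2
      refine OpenPartialHomeomorph.contDiffAt_symm _ (f₀' := B) hp ?_ hsmooth
      rw [hB]
      exact (hsmooth.differentiableAt hn).hasFDerivAt) hO
  exact ⟨e', he', fun y hy => (hsub hy).2, hchart⟩

end Calculus

section Flow

variable {E F : Type*} [NormedAddCommGroup E] [NormedSpace ℝ E]
  [NormedAddCommGroup F] [NormedSpace ℝ F]

/-- `Φ (p, t)` is the smooth local flow of the vector field `W`, for starting points `p` near `q`
and small times `t`. -/
structure IsLocalFlowAt (Φ : E × ℝ → E) (W : E → E) (q : E) : Prop where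
  contDiffAt : ∀ᶠ p in 𝓝 (q, (0 : ℝ)), ContDiffAt ℝ ∞ Φ p
  initial : ∀ᶠ p in 𝓝 q, Φ (p, 0) = p
  hasDerivAt : ∀ᶠ p in 𝓝 (q, (0 : ℝ)), HasDerivAt (fun t => Φ (p.1, t)) (W (Φ p)) p.2

namespace IsLocalFlowAt

variable {Φ : E × ℝ → E} {W : E → E} {q : E}

theorem apply_zero (hΦ : IsLocalFlowAt Φ W q) : Φ (q, 0) = q := hΦ.initial.self_of_nhds

theorem tendsto (hΦ : IsLocalFlowAt Φ W q) : Filter.Tendsto Φ (𝓝 (q, 0)) (𝓝 q) := by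
  simpa only [ContinuousAt, hΦ.apply_zero] using hΦ.contDiffAt.self_of_nhds.continuousAt

theorem semiconj (hΦ : IsLocalFlowAt Φ W q) {π : E → F} {σ : F → E} {Y : F → F} {x : F}
    (hπ : ∀ᶠ p in 𝓝 q, ContDiffAt ℝ ∞ π p) (hσ : ∀ᶠ y in 𝓝 x, ContDiffAt ℝ ∞ σ y)
    (hσx : σ x = q) (hright : ∀ᶠ y in 𝓝 x, π (σ y) = y)
    (hY : ∀ᶠ p in 𝓝 q, fderiv ℝ π p (W p) = Y (π p)) :
    IsLocalFlowAt (fun p => π (Φ (σ p.1, p.2))) Y x := by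
  have hlift : Filter.Tendsto (fun p : F × ℝ => (σ p.1, p.2)) (𝓝 (x, 0)) (𝓝 (q, 0)) := by
    have h : ContinuousAt (fun p : F × ℝ => (σ p.1, p.2)) (x, 0) :=
      (hσ.self_of_nhds.continuousAt.comp continuousAt_fst).prodMk continuousAt_snd
    simpa only [ContinuousAt, hσx] using h
  have hσ' : ∀ᶠ p : F × ℝ in 𝓝 (x, 0), ContDiffAt ℝ ∞ σ p.1 := continuousAt_fst.eventually hσ
  refine ⟨?_, ?_, ?_⟩
  · filter_upwards [hσ', hlift.eventually hΦ.contDiffAt,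
      hlift.eventually (hΦ.tendsto.eventually hπ)] with p hσp hΦp hπp
    exact hπp.comp p (hΦp.comp p ((hσp.comp p contDiffAt_fst).prodMk contDiffAt_snd))
  · have hσ0 : Filter.Tendsto σ (𝓝 x) (𝓝 q) := hσx ▸ hσ.self_of_nhds.continuousAt
    filter_upwards [hσ0.eventually hΦ.initial, hright] with y hΦy hy
    rw [hΦy, hy]
  · filter_upwards [hlift.eventually hΦ.hasDerivAt, hlift.eventually (hΦ.tendsto.eventually hπ),
      hlift.eventually (hΦ.tendsto.eventually hY)] with p hΦp hπp hYp
    rw [← hYp]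
    exact (hπp.differentiableAt (by simp)).hasFDerivAt.comp_hasDerivAt p.2 hΦp

end IsLocalFlowAt

/-- `e` is a smooth ball chart around `q` that straightens the vector field `W` into the unit field
of the last coordinate. -/
structure IsFlowBox (e : OpenPartialHomeomorph E (F × ℝ)) (W : E → E) (q : E) : Prop
    extends IsBallChart ∞ e q where
  fderiv_apply : ∀ z ∈ e.source, fderiv ℝ e z (W z) = (0, 1)

theorem IsBallChart.mk_mem_target {n : WithTop ℕ∞} {e : OpenPartialHomeomorph E (F × ℝ)} {q : E}
    (he : IsBallChart n e q) {p p' : F × ℝ} (hp : p ∈ e.target) (hp' : p' ∈ e.target) :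
    (p.1, p'.2) ∈ e.target := by
  obtain ⟨ρ, hρ⟩ := he.exists_target_eq
  rw [hρ, ← ball_prod_same] at hp hp' ⊢
  exact ⟨hp.1, hp'.2⟩

namespace IsFlowBox

variable {G : Type*} [NormedAddCommGroup G] [NormedSpace ℝ G]
  {e : OpenPartialHomeomorph E (F × ℝ)} {W : E → E} {q : E}

theorem section_mem_target (he : IsFlowBox e W q) {z : E} (hz : z ∈ e.source) :
    ((e z).1, (e q).2) ∈ e.target :=
  he.mk_mem_target (e.map_source hz) (e.map_source he.mem_source)

theorem fderiv_symm_apply (he : IsFlowBox e W q) {p : F × ℝ} (hp : p ∈ e.target) :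
    fderiv ℝ e.symm p (0, 1) = W (e.symm p) := by
  simpa only [he.fderiv_apply _ (e.map_target hp), e.right_inv hp] using
    he.fderiv_symm_fderiv (by simp) (e.map_target hp) (W (e.symm p))

theorem eq_smul_of_fst_fderiv_eq_zero (he : IsFlowBox e W q) {z : E} (hz : z ∈ e.source) {u : E}
    (hu : (fderiv ℝ e z u).1 = 0) : u = (fderiv ℝ e z u).2 • W z := by
  refine he.injective_fderiv (by simp) hz ?_
  rw [map_smul, he.fderiv_apply z hz]
  exact Prod.ext (by simpa using hu) (by simp)

theorem fst_fderiv_ne_zero (he : IsFlowBox e W q) {z : E} (hz : z ∈ e.source) {u : E}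
    (hli : LinearIndependent ℝ ![u, W z]) : (fderiv ℝ e z u).1 ≠ 0 := by
  intro h
  have hu := he.eq_smul_of_fst_fderiv_eq_zero hz h
  exact one_ne_zero (LinearIndependent.pair_iff.1 hli 1 (-(fderiv ℝ e z u).2) (by
    rw [one_smul, neg_smul, ← hu, add_neg_cancel])).1

theorem eq_of_fst_eq (he : IsFlowBox e W q) {u : E → G}
    (hu : ∀ y ∈ e.source, DifferentiableAt ℝ u y) (hWu : ∀ y ∈ e.source, fderiv ℝ u y (W y) = 0)
    {z z' : E} (hz : z ∈ e.source) (hz' : z' ∈ e.source) (h : (e z).1 = (e z').1) : u z = u z' := by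
  obtain ⟨ρ, hρ⟩ := he.exists_target_eq
  have hmem {y : E} (hy : y ∈ e.source) : (e y).2 ∈ Metric.ball (e q).2 ρ :=
    ((ball_prod_same (e q).1 (e q).2 ρ).symm ▸ hρ ▸ e.map_source hy :
      e y ∈ Metric.ball (e q).1 ρ ×ˢ Metric.ball (e q).2 ρ).2
  have hline : ∀ t ∈ Metric.ball (e q).2 ρ, ((e z).1, t) ∈ e.target := fun t ht => by
    have hfst := hρ ▸ he.section_mem_target hz
    rw [← ball_prod_same] at hfst
    rw [hρ, ← ball_prod_same]
    exact ⟨hfst.1, ht⟩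
  have hderiv : ∀ t ∈ Metric.ball (e q).2 ρ,
      HasDerivAt (fun t => u (e.symm ((e z).1, t))) 0 t := fun t ht => by
    have hy := e.map_target (hline t ht)
    rw [← hWu _ hy, ← he.fderiv_symm_apply (hline t ht)]
    exact (hu _ hy).hasFDerivAt.comp_hasDerivAt t <| hasDerivAt_comp_prodMk_right
      ((he.contDiffAt_symm _ (hline t ht)).differentiableAt (by simp))
  have hconst : u (e.symm ((e z).1, (e z).2)) = u (e.symm ((e z).1, (e z').2)) :=
    Metric.isOpen_ball.is_const_of_deriv_eq_zero (convex_ball (e q).2 ρ).isPreconnected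
      (fun t ht => (hderiv t ht).differentiableAt.differentiableWithinAt)
      (fun t ht => (hderiv t ht).deriv) (hmem hz) (hmem hz')
  rwa [Prod.mk.eta, e.left_inv hz, h, Prod.mk.eta, e.left_inv hz'] at hconst

theorem exists_eq_comp_fst (he : IsFlowBox e W q) {n : ℕ∞} (hn : 1 ≤ n) {u : E → G}
    (hu : ∀ y ∈ e.source, ContDiffAt ℝ n u y) (hWu : ∀ y ∈ e.source, fderiv ℝ u y (W y) = 0) :
    ∃ K : F → G, (∀ y ∈ e.source, ContDiffAt ℝ n K (e y).1) ∧ ∀ y ∈ e.source, u y = K (e y).1 := by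
  refine ⟨fun x => u (e.symm (x, (e q).2)), fun y hy => ?_, fun y hy => ?_⟩
  · have hy' := he.section_mem_target hy
    have hsymm : ContDiffAt ℝ n e.symm ((e y).1, (e q).2) :=
      (he.contDiffAt_symm _ hy').of_le (WithTop.coe_le_coe.2 le_top)
    exact (hu _ (e.map_target hy')).comp (e y).1
      (hsymm.comp (e y).1 (f := fun x => (x, (e q).2)) (by fun_prop))
  · have hy' := he.section_mem_target hy
    have hn0 : (n : WithTop ℕ∞) ≠ 0 := by
      exact_mod_cast (zero_lt_one.trans_le hn).ne'
    refine he.eq_of_fst_eq (fun y hy => (hu y hy).differentiableAt hn0) hWu hy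
      (e.map_target hy') ?_
    rw [e.right_inv hy']

end IsFlowBox

theorem IsLocalFlowAt.exists_parametrization {Φ : (F × ℝ) × ℝ → F × ℝ} {W : F × ℝ → F × ℝ}
    {q : F × ℝ} (hΦ : IsLocalFlowAt Φ W q) (hq : W q ≠ 0) :
    ∃ Ψ : F × ℝ → F × ℝ, Ψ 0 = q ∧ (∀ᶠ p in 𝓝 0, ContDiffAt ℝ ∞ Ψ p) ∧
      (∀ᶠ p in 𝓝 0, fderiv ℝ Ψ p (0, 1) = W (Ψ p)) ∧ Function.Injective (fderiv ℝ Ψ 0) := by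
  obtain ⟨A, hA⟩ := SeparatingDual.exists_continuousLinearEquiv_apply_eq (R := ℝ)
    (show ((0, 1) : F × ℝ) ≠ 0 by simp) hq
  -- flow for time `t` from the hyperplane `q + A (F × 0)`, which is transverse to `W q = A (0, 1)`
  set ι : F × ℝ → (F × ℝ) × ℝ := fun p => (q + A (p.1, 0), p.2) with hι
  have hι_smooth : ContDiff ℝ ∞ ι := by fun_prop
  have hι_zero : ι 0 = (q, 0) := by simp [hι]
  have hι_tendsto : Filter.Tendsto ι (𝓝 0) (𝓝 (q, 0)) := hι_zero ▸ hι_smooth.continuous.tendsto 0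
  have hsmooth : ∀ᶠ p in 𝓝 0, ContDiffAt ℝ ∞ (fun p => Φ (ι p)) p :=
    (hι_tendsto.eventually hΦ.contDiffAt).mono fun p hp => hp.comp p hι_smooth.contDiffAt
  have hzero : Φ (ι 0) = q := by rw [hι_zero, hΦ.apply_zero]
  have htime : ∀ᶠ p in 𝓝 0, fderiv ℝ (fun p => Φ (ι p)) p (0, 1) = W (Φ (ι p)) := by
    filter_upwards [hι_tendsto.eventually hΦ.hasDerivAt, hsmooth] with p hd hs
    exact (hasDerivAt_comp_prodMk_right (hs.differentiableAt (by simp))).unique hd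
  have hspace (u : F) : fderiv ℝ (fun p => Φ (ι p)) 0 (u, 0) = A (u, 0) := by
    have hslice : (fun y : F => Φ (ι (y, 0))) =ᶠ[𝓝 0] fun y => q + A (y, 0) := by
      have h : Filter.Tendsto (fun y : F => q + A (y, 0)) (𝓝 0) (𝓝 q) :=
        Continuous.tendsto' (by fun_prop) _ _ (by simp)
      exact h.eventually hΦ.initial
    have hd : HasFDerivAt (fun y : F => q + A (y, 0))
        ((A : F × ℝ →L[ℝ] F × ℝ).comp (.inl ℝ F ℝ)) 0 :=
      ((A : F × ℝ →L[ℝ] F × ℝ).comp (.inl ℝ F ℝ)).hasFDerivAt.const_add q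
    rw [← Prod.mk_zero_zero, ← fderiv_comp_prodMk_left_apply
      (hsmooth.self_of_nhds.differentiableAt (by simp)), hslice.fderiv_eq, hd.fderiv]
    simp
  have hfderiv : fderiv ℝ (fun p => Φ (ι p)) 0 = A := by
    ext1
    · ext1 u
      simpa using hspace u
    · ext1
      simpa [hzero, hA] using htime.self_of_nhds
  exact ⟨_, hzero, hsmooth, htime, hfderiv ▸ A.injective⟩

theorem IsLocalFlowAt.exists_isFlowBox [FiniteDimensional ℝ F] {Φ : (F × ℝ) × ℝ → F × ℝ}
    {W : F × ℝ → F × ℝ} {q : F × ℝ} (hΦ : IsLocalFlowAt Φ W q) (hq : W q ≠ 0) {O : Set (F × ℝ)}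
    (hO : O ∈ 𝓝 q) :
    ∃ e : OpenPartialHomeomorph (F × ℝ) (F × ℝ), IsFlowBox e W q ∧ e.source ⊆ O := by
  obtain ⟨Ψ, hΨq, hsmooth, htime, hinj⟩ := hΦ.exists_parametrization hq
  obtain ⟨e₀, rfl, hsub, hchart⟩ := exists_isBallChart rfl (by simp) hsmooth hinj htime
  obtain ⟨e, he, -, hsub', hechart⟩ := exists_isBallChart_restrict (e := e₀.symm)
    (hΨq ▸ e₀.map_source hchart.mem_source) hchart.contDiffAt_symm hchart.contDiffAt hO
  refine ⟨e, ⟨hechart, fun z hz => ?_⟩, fun z hz => (hsub' hz).2⟩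
  have hz₀ := e₀.map_target (hsub' hz).1
  have h := hchart.fderiv_symm_fderiv (by simp) hz₀ (0, 1)
  rwa [show fderiv ℝ e₀ _ _ = _ from hsub hz₀, e₀.right_inv (hsub' hz).1, ← he] at h

end Flow

section TransformationGroup

variable {E G : Type*} [NormedAddCommGroup E] [NormedSpace ℝ E]
  [NormedAddCommGroup G] [NormedSpace ℝ G]

theorem lieBracket_of_related {π : G → E} {V W : G → G} {V' W' : E → E} {x : G}
    (hπ : ContDiffAt ℝ 2 π x) (hV : DifferentiableAt ℝ V x) (hW : DifferentiableAt ℝ W x)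
    (hV' : DifferentiableAt ℝ V' (π x)) (hW' : DifferentiableAt ℝ W' (π x))
    (hVV' : ∀ᶠ y in 𝓝 x, V' (π y) = fderiv ℝ π y (V y))
    (hWW' : ∀ᶠ y in 𝓝 x, W' (π y) = fderiv ℝ π y (W y)) :
    VectorField.lieBracket ℝ V' W' (π x) = fderiv ℝ π x (VectorField.lieBracket ℝ V W x) := by
  have hd : DifferentiableAt ℝ π x := hπ.differentiableAt (by simp)
  rw [VectorField.fderiv_apply_lieBracket hπ (by simp) hW hV,
    ← Filter.EventuallyEq.fderiv_eq hWW', ← Filter.EventuallyEq.fderiv_eq hVV',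
    fderiv_fun_comp x hW' hd, fderiv_fun_comp x hV' hd]
  simp only [VectorField.lieBracket, hVV'.self_of_nhds, hWW'.self_of_nhds]
  rfl

theorem exists_contDiffAt_integralCurve [CompleteSpace G] {θ : G → G} {x : G}
    (hθ : ∀ᶠ y in 𝓝 x, ContDiffAt ℝ ∞ θ y) :
    ∃ γ : ℝ → G, γ 0 = x ∧ ∀ᶠ t in 𝓝 0, ContDiffAt ℝ ∞ γ t ∧ HasDerivAt γ (θ (γ t)) t := by
  have hθ₁ : ContDiffAt ℝ 1 θ x := hθ.self_of_nhds.of_le (by simp)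
  obtain ⟨γ, hγx, r, hr, hγ⟩ :=
    hθ₁.exists_forall_mem_closedBall_exists_eq_forall_mem_Ioo_hasDerivAt₀ (0 : ℝ)
  have hγc : ContinuousAt γ 0 := (hγ 0 (by simp [hr])).continuousAt
  have hev : ∀ᶠ t in 𝓝 (0 : ℝ), ContDiffAt ℝ ∞ θ (γ t) ∧ HasDerivAt γ (θ (γ t)) t :=
    (hγc.eventually (hγx.symm ▸ hθ)).and
      (Filter.mem_of_superset (Ioo_mem_nhds (by linarith) (by linarith)) hγ)
  obtain ⟨ρ, hρ, hball⟩ := (nhds_basis_Icc_pos (0 : ℝ)).eventually_iff.1 hev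
  have hsmooth : ContDiffOn ℝ ∞ γ (Icc (0 - ρ) (0 + ρ)) :=
    ODE.contDiffOn_enat_Icc_of_hasDerivWithinAt (n := ⊤) (f := fun _ => θ)
      (u := {y | ContDiffAt ℝ ∞ θ y})
      (fun p hp => (ContDiffAt.comp p (f := Prod.snd) (show ContDiffAt ℝ ∞ θ p.2 from hp.2)
        contDiffAt_snd).contDiffWithinAt)
      (fun t ht => (hball ht).2.hasDerivWithinAt) fun t ht => (hball ht).1
  refine ⟨γ, hγx, ?_⟩
  filter_upwards [Ioo_mem_nhds (by linarith : 0 - ρ < 0) (by linarith : 0 < 0 + ρ)] with t ht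
  exact ⟨hsmooth.contDiffAt (Icc_mem_nhds ht.1 ht.2), (hball (Ioo_subset_Icc_self ht)).2⟩

/-- A smooth local group of transformations of the open set `D`: the composition `φ` of parameters
in the open set `S`, and the action `X z ε`, are only required to obey the group laws where all the
terms involved stay in `S` and `D`. Inverses and associativity of `φ` are not part of the
definition. -/
structure IsLocalTransformationGroup (D : Set E) (S : Set G) (φ : G → G → G) (X : E → G → E) :
    Prop where
  isOpen_domain : IsOpen D
  isOpen_param : IsOpen S
  zero_mem : (0 : G) ∈ S
  zero_comp : ∀ ε ∈ S, φ 0 ε = ε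
  comp_zero : ∀ ε ∈ S, φ ε 0 = ε
  act_zero : ∀ z ∈ D, X z 0 = z
  act_comp : ∀ z ∈ D, ∀ ε ∈ S, ∀ δ ∈ S, X z ε ∈ D → φ ε δ ∈ S → X (X z ε) δ = X z (φ ε δ)
  contDiffOn_act : ContDiffOn ℝ ∞ (fun q : E × G => X q.1 q.2) (D ×ˢ S)
  contDiffOn_comp : ContDiffOn ℝ ∞ (fun q : G × G => φ q.1 q.2) (S ×ˢ S)

/-- The infinitesimal transformation `∂X(z,ε)/∂ε` at `ε = 0` in the direction `c`. -/
noncomputable def infinitesimal (X : E → G → E) (c : G) (z : E) : E := fderiv ℝ (X z) 0 c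

namespace IsLocalTransformationGroup

variable {D : Set E} {S : Set G} {φ : G → G → G} {X : E → G → E}

theorem contDiffAt_act (hX : IsLocalTransformationGroup D S φ X) {z : E} {ε : G} (hz : z ∈ D)
    (hε : ε ∈ S) : ContDiffAt ℝ ∞ (fun q : E × G => X q.1 q.2) (z, ε) :=
  hX.contDiffOn_act.contDiffAt
    ((hX.isOpen_domain.prod hX.isOpen_param).mem_nhds (mk_mem_prod hz hε))

theorem contDiffAt_comp (hX : IsLocalTransformationGroup D S φ X) {ε δ : G} (hε : ε ∈ S)
    (hδ : δ ∈ S) : ContDiffAt ℝ ∞ (fun q : G × G => φ q.1 q.2) (ε, δ) :=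
  hX.contDiffOn_comp.contDiffAt
    ((hX.isOpen_param.prod hX.isOpen_param).mem_nhds (mk_mem_prod hε hδ))

theorem contDiffAt_orbit (hX : IsLocalTransformationGroup D S φ X) {z : E} {ε : G} (hz : z ∈ D)
    (hε : ε ∈ S) : ContDiffAt ℝ ∞ (X z) ε :=
  (hX.contDiffAt_act hz hε).comp ε (f := fun ε => (z, ε)) (by fun_prop)

theorem contDiffAt_infinitesimal (hX : IsLocalTransformationGroup D S φ X) (c : G) {z : E}
    (hz : z ∈ D) : ContDiffAt ℝ ∞ (infinitesimal X c) z :=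
  (ContDiffAt.fderiv (f := X) (g := fun _ => 0) (n := ∞) (hX.contDiffAt_act hz hX.zero_mem)
    contDiffAt_const (by simp)).clm_apply contDiffAt_const

theorem contDiffAt_fderiv_comp (hX : IsLocalTransformationGroup D S φ X) {ε : G} (hε : ε ∈ S) :
    ContDiffAt ℝ ∞ (fun ε => fderiv ℝ (φ ε) 0) ε :=
  ContDiffAt.fderiv (f := φ) (g := fun _ => 0) (n := ∞) (hX.contDiffAt_comp hε hX.zero_mem)
    contDiffAt_const (by simp)

theorem contDiffAt_infinitesimal_comp (hX : IsLocalTransformationGroup D S φ X) (c : G) {ε : G}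
    (hε : ε ∈ S) : ContDiffAt ℝ ∞ (infinitesimal φ c) ε :=
  (hX.contDiffAt_fderiv_comp hε).clm_apply contDiffAt_const

theorem eventually_act_mem (hX : IsLocalTransformationGroup D S φ X) {z : E} (hz : z ∈ D) :
    ∀ᶠ q : E × G in 𝓝 (z, 0), X q.1 q.2 ∈ D :=
  (hX.contDiffAt_act hz hX.zero_mem).continuousAt.eventually_mem <|
    hX.isOpen_domain.mem_nhds ((hX.act_zero z hz).symm ▸ hz)

theorem infinitesimal_act (hX : IsLocalTransformationGroup D S φ X) (c : G) {z : E} {ε : G}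
    (hz : z ∈ D) (hε : ε ∈ S) (hzε : X z ε ∈ D) :
    infinitesimal X c (X z ε) = fderiv ℝ (X z) ε (infinitesimal φ c ε) := by
  have hφ : ContDiffAt ℝ ∞ (φ ε) 0 :=
    (hX.contDiffAt_comp hε hX.zero_mem).comp (0 : G) (f := fun δ => (ε, δ)) (by fun_prop)
  have hcomp : X (X z ε) =ᶠ[𝓝 0] X z ∘ φ ε := by
    have hmem : ∀ᶠ δ in 𝓝 (0 : G), φ ε δ ∈ S := hφ.continuousAt.eventually_mem <|
      hX.isOpen_param.mem_nhds ((hX.comp_zero ε hε).symm ▸ hε)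
    filter_upwards [hX.isOpen_param.mem_nhds hX.zero_mem, hmem] with δ hδ hεδ
    exact hX.act_comp z hz ε hε δ hδ hzε hεδ
  have hd : DifferentiableAt ℝ (X z) (φ ε 0) := by
    rw [hX.comp_zero ε hε]
    exact (hX.contDiffAt_orbit hz hε).differentiableAt (by simp)
  rw [infinitesimal, hcomp.fderiv_eq, fderiv_comp 0 hd (hφ.differentiableAt (by simp)),
    hX.comp_zero ε hε]
  rfl

theorem exists_lieBracket_infinitesimal_eq (hX : IsLocalTransformationGroup D S φ X) :
    ∃ β : G →L[ℝ] G →L[ℝ] G, ∀ a b : G, ∀ z ∈ D,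
      VectorField.lieBracket ℝ (infinitesimal X a) (infinitesimal X b) z =
        infinitesimal X (β a b - β b a) z := by
  have h0 := hX.zero_mem
  refine ⟨fderiv ℝ (fun ε => fderiv ℝ (φ ε) 0) 0, fun a b z hz => ?_⟩
  have hrel (c : G) : ∀ᶠ ε in 𝓝 0,
      infinitesimal X c (X z ε) = fderiv ℝ (X z) ε (infinitesimal φ c ε) := by
    filter_upwards [hX.isOpen_param.mem_nhds h0,
      (Continuous.prodMk_right z).continuousAt.eventually (hX.eventually_act_mem hz)] with ε hε hzε
    exact hX.infinitesimal_act c hz hε hzε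
  have hdφ (c : G) : DifferentiableAt ℝ (infinitesimal φ c) 0 :=
    (hX.contDiffAt_infinitesimal_comp c h0).differentiableAt (by simp)
  have hdX (c : G) : DifferentiableAt ℝ (infinitesimal X c) (X z 0) :=
    (hX.contDiffAt_infinitesimal c ((hX.act_zero z hz).symm ▸ hz)).differentiableAt (by simp)
  have hunit (c : G) : infinitesimal φ c 0 = c := by
    have hid : φ 0 =ᶠ[𝓝 0] id :=
      Filter.mem_of_superset (hX.isOpen_param.mem_nhds h0) hX.zero_comp
    rw [infinitesimal, hid.fderiv_eq, fderiv_id]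
    rfl
  have hfderiv (a b : G) : fderiv ℝ (infinitesimal φ a) 0 b =
      fderiv ℝ (fun ε => fderiv ℝ (φ ε) 0) 0 b a := by
    have h := ((hX.contDiffAt_fderiv_comp h0).differentiableAt
      (by simp)).hasFDerivAt.clm_apply (hasFDerivAt_const a 0)
    rw [show infinitesimal φ a = fun ε => fderiv ℝ (φ ε) 0 a from rfl, h.fderiv]
    simp
  have hbracket := lieBracket_of_related (contDiffAt_infty.1 (hX.contDiffAt_orbit hz h0) 2)
    (hdφ a) (hdφ b) (hdX a) (hdX b) (hrel a) (hrel b)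
  have hφ : VectorField.lieBracket ℝ (infinitesimal φ a) (infinitesimal φ b) 0 =
      fderiv ℝ (fun ε => fderiv ℝ (φ ε) 0) 0 a b - fderiv ℝ (fun ε => fderiv ℝ (φ ε) 0) 0 b a := by
    simp only [VectorField.lieBracket, hunit, hfderiv]
  rwa [hX.act_zero z hz, hφ] at hbracket

theorem exists_isLocalFlowAt [CompleteSpace G] (hX : IsLocalTransformationGroup D S φ X) (c : G) :
    ∃ γ : ℝ → G, (∀ᶠ t in 𝓝 0, γ t ∈ S) ∧
      ∀ z ∈ D, IsLocalFlowAt (fun p : E × ℝ => X p.1 (γ p.2)) (infinitesimal X c) z := by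
  obtain ⟨γ, hγ0, hγ⟩ := exists_contDiffAt_integralCurve <| Filter.mem_of_superset
    (hX.isOpen_param.mem_nhds hX.zero_mem) fun ε hε => hX.contDiffAt_infinitesimal_comp c hε
  have hγS : ∀ᶠ t in 𝓝 (0 : ℝ), γ t ∈ S := hγ.self_of_nhds.1.continuousAt.eventually_mem <|
    hX.isOpen_param.mem_nhds (hγ0.symm ▸ hX.zero_mem)
  refine ⟨γ, hγS, fun z hz => ?_⟩
  have hsnd : Filter.Tendsto (Prod.snd : E × ℝ → ℝ) (𝓝 (z, 0)) (𝓝 0) := continuousAt_snd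
  have hD : ∀ᶠ p : E × ℝ in 𝓝 (z, 0), p.1 ∈ D :=
    continuousAt_fst.eventually (hX.isOpen_domain.mem_nhds hz)
  have hmem : ∀ᶠ p : E × ℝ in 𝓝 (z, 0), X p.1 (γ p.2) ∈ D := by
    have hlift : ContinuousAt (fun p : E × ℝ => (p.1, γ p.2)) (z, 0) :=
      continuousAt_fst.prodMk (hγ.self_of_nhds.1.continuousAt.tendsto.comp hsnd)
    exact hlift.eventually (by simpa only [hγ0] using hX.eventually_act_mem hz)
  refine ⟨?_, ?_, ?_⟩
  · filter_upwards [hD, hsnd.eventually hγ, hsnd.eventually hγS] with p hp hpγ hpS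
    exact (hX.contDiffAt_act hp hpS).comp p (f := fun p : E × ℝ => (p.1, γ p.2))
      (contDiffAt_fst.prodMk (hpγ.1.comp p contDiffAt_snd))
  · filter_upwards [hX.isOpen_domain.mem_nhds hz] with p hp
    rw [hγ0, hX.act_zero p hp]
  · filter_upwards [hD, hsnd.eventually hγ, hsnd.eventually hγS, hmem] with p hp hpγ hpS hpD
    rw [hX.infinitesimal_act c hp hpS hpD]
    exact ((hX.contDiffAt_orbit hp hpS).differentiableAt
      (by simp)).hasFDerivAt.comp_hasDerivAt p.2 hpγ.2

end IsLocalTransformationGroup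

end TransformationGroup

section PlaneLinearAlgebra

theorem linearIndependent_pair_iff_det_ne_zero {x y : ℝ × ℝ} :
    LinearIndependent ℝ ![x, y] ↔ x.1 * y.2 - x.2 * y.1 ≠ 0 := by
  have hrow := Matrix.linearIndependent_rows_iff_isUnit (A := !![x.1, x.2; y.1, y.2])
  rw [Matrix.isUnit_iff_isUnit_det, Matrix.det_fin_two_of, isUnit_iff_ne_zero] at hrow
  have hpair : (LinearEquiv.finTwoArrow ℝ ℝ).symm.toLinearMap ∘ ![x, y] =
      Matrix.row !![x.1, x.2; y.1, y.2] := by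
    ext i j
    fin_cases i <;> fin_cases j <;> rfl
  rw [← LinearMap.linearIndependent_iff (LinearEquiv.finTwoArrow ℝ ℝ).symm.toLinearMap
    (LinearEquiv.ker _), hpair]
  exact hrow

theorem exists_linearIndependent_sub_eq_smul (β : ℝ × ℝ →L[ℝ] ℝ × ℝ →L[ℝ] ℝ × ℝ) :
    ∃ (c d : ℝ × ℝ) (k : ℝ), LinearIndependent ℝ ![c, d] ∧ β c d - β d c = k • c := by
  set m := β (1, 0) (0, 1) - β (0, 1) (1, 0) with hm
  have hdet (c d : ℝ × ℝ) : β c d - β d c = (c.1 * d.2 - c.2 * d.1) • m := by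
    have hbasis (u : ℝ × ℝ) : u = u.1 • ((1 : ℝ), (0 : ℝ)) + u.2 • ((0 : ℝ), (1 : ℝ)) := by
      ext <;> simp
    rw [hm, hbasis c, hbasis d]
    simp only [map_add, map_smul, add_apply, smul_apply, Prod.fst_add, Prod.snd_add, Prod.smul_fst,
      Prod.smul_snd, smul_eq_mul]
    module
  obtain hm0 | hm0 := eq_or_ne m 0
  · exact ⟨(1, 0), (0, 1), 0, linearIndependent_pair_iff_det_ne_zero.2 (by simp),
      by rw [hdet, hm0]; simp⟩
  · refine ⟨m, (-m.2, m.1), _, linearIndependent_pair_iff_det_ne_zero.2 fun h => hm0 ?_, hdet _ _⟩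
    have hsq : m.1 * m.1 + m.2 * m.2 = 0 := by linear_combination h
    exact Prod.ext_iff.2 (mul_self_add_mul_self_eq_zero.1 hsq)

end PlaneLinearAlgebra

theorem generator_eq_infinitesimal (X : ℝ × ℝ → ℝ × ℝ → ℝ × ℝ) :
    generator X = infinitesimal X := by
  funext c z
  have hc : c = c.1 • ((1 : ℝ), (0 : ℝ)) + c.2 • ((0 : ℝ), (1 : ℝ)) := by ext <;> simp
  rw [infinitesimal, hc, map_add, map_smul, map_smul]
  simp [generator]

theorem IsLocalTransformationGroup.exists_isSolvableBasis {D S : Set (ℝ × ℝ)}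
    {φ X : ℝ × ℝ → ℝ × ℝ → ℝ × ℝ} (hX : IsLocalTransformationGroup D S φ X) :
    ∃ (c d : ℝ × ℝ) (k : ℝ), IsSolvableBasis D X c d k := by
  obtain ⟨β, hβ⟩ := hX.exists_lieBracket_infinitesimal_eq
  obtain ⟨c, d, k, hcd, hk⟩ := exists_linearIndependent_sub_eq_smul β
  refine ⟨c, d, k, hcd, fun z hz => ?_⟩
  rw [generator_eq_infinitesimal, hβ c d z hz, hk, infinitesimal, map_smul, infinitesimal]

theorem IsTwoParameterLieGroup.isLocalTransformationGroup {D S : Set (ℝ × ℝ)}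
    {φ X : ℝ × ℝ → ℝ × ℝ → ℝ × ℝ} (hX : IsTwoParameterLieGroup D S φ X) :
    IsLocalTransformationGroup D S φ X where
  isOpen_domain := hX.isOpen_domain
  isOpen_param := hX.isOpen_param
  zero_mem := hX.zero_mem
  zero_comp := hX.zero_comp
  comp_zero := hX.comp_zero
  act_zero := hX.act_zero
  act_comp z hz ε hε δ hδ _ _ := hX.act_comp z hz ε hε δ hδ
  contDiffOn_act := hX.smooth
  contDiffOn_comp q hq := (hX.analytic_comp q hq).contDiffAt.contDiffWithinAt

section Jets

theorem contDiff_base {n : WithTop ℕ∞} : ContDiff ℝ n base :=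
  contDiff_fst.prodMk (contDiff_fst.comp contDiff_snd)

theorem fderiv_comp_base {F : Type*} [NormedAddCommGroup F] [NormedSpace ℝ F] {a : ℝ × ℝ → F}
    {P : ℝ × ℝ × ℝ} (ha : DifferentiableAt ℝ a (base P)) (u : ℝ × ℝ × ℝ) :
    fderiv ℝ (fun Q => a (base Q)) P u = fderiv ℝ a (base P) (base u) := by
  have hbase : HasFDerivAt base ((ContinuousLinearMap.fst ℝ ℝ (ℝ × ℝ)).prod
      ((ContinuousLinearMap.fst ℝ ℝ ℝ).comp (ContinuousLinearMap.snd ℝ ℝ (ℝ × ℝ)))) P :=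
    hasFDerivAt_fst.prodMk (hasFDerivAt_fst.comp P hasFDerivAt_snd)
  exact congrArg (fun L : ℝ × ℝ × ℝ →L[ℝ] F => L u) (ha.hasFDerivAt.comp P hbase).fderiv

theorem contDiffAt_totalDeriv₀ {a : ℝ × ℝ → ℝ} {P : ℝ × ℝ × ℝ}
    (ha : ContDiffAt ℝ ∞ a (base P)) : ContDiffAt ℝ ∞ (totalDeriv₀ a) P :=
  ((ha.fderiv_right (m := ∞) (by simp)).comp P contDiff_base.contDiffAt).clm_apply
    (by fun_prop : ContDiff ℝ ∞ fun Q : ℝ × ℝ × ℝ => ((1 : ℝ), Q.2.2)).contDiffAt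

theorem contDiffAt_prolong {V : ℝ × ℝ → ℝ × ℝ} {P : ℝ × ℝ × ℝ}
    (hV : ContDiffAt ℝ ∞ V (base P)) : ContDiffAt ℝ ∞ (prolong V) P := by
  have hb : ContDiffAt ℝ ∞ (fun Q => V (base Q)) P := hV.comp P contDiff_base.contDiffAt
  have hslope : ContDiff ℝ ∞ fun Q : ℝ × ℝ × ℝ => Q.2.2 := by fun_prop
  exact (contDiffAt_fst.comp _ hb).prodMk ((contDiffAt_snd.comp _ hb).prodMk
    ((contDiffAt_totalDeriv₀ (contDiffAt_snd.comp _ hV)).sub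
      (hslope.contDiffAt.mul (contDiffAt_totalDeriv₀ (contDiffAt_fst.comp _ hV)))))

/-- The vector field `∂ₓ + y₁ ∂_y + f ∂_{y₁}` on the jet space, whose integral curves are the jets
of the solutions of `y'' = f(x,y,y')`. -/
def equationField (f : ℝ × ℝ × ℝ → ℝ) (P : ℝ × ℝ × ℝ) : ℝ × ℝ × ℝ := (1, P.2.2, f P)

theorem contDiffAt_equationField {n : WithTop ℕ∞} {f : ℝ × ℝ × ℝ → ℝ} {P : ℝ × ℝ × ℝ}
    (hf : ContDiffAt ℝ n f P) : ContDiffAt ℝ n (equationField f) P :=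
  contDiffAt_const.prodMk ((contDiff_snd.comp contDiff_snd).contDiffAt.prodMk hf)

theorem differentiableAt_equationField {f : ℝ × ℝ × ℝ → ℝ} {P : ℝ × ℝ × ℝ}
    (hf : DifferentiableAt ℝ f P) : DifferentiableAt ℝ (equationField f) P :=
  (differentiableAt_const _).prodMk
    (((contDiff_snd.comp contDiff_snd).differentiable one_ne_zero P).prodMk hf)

namespace IsLocalFlowAt

variable {E : Type*} [NormedAddCommGroup E] [NormedSpace ℝ E] {Φ : E × ℝ → E} {W : E → E} {q : E}

theorem eventually_hasDerivAt_fderiv (hΦ : IsLocalFlowAt Φ W q)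
    (hW : ∀ᶠ p in 𝓝 q, DifferentiableAt ℝ W p) :
    ∀ᶠ p in 𝓝 (q, (0 : ℝ)), ∀ u, HasDerivAt (fun t => fderiv ℝ (fun y => Φ (y, t)) p.1 u)
      (fderiv ℝ W (Φ p) (fderiv ℝ (fun y => Φ (y, p.2)) p.1 u)) p.2 := by
  filter_upwards [hΦ.contDiffAt, hΦ.hasDerivAt.eventually_nhds, hΦ.tendsto.eventually hW]
    with p hp hderiv hWp u
  have hfield : (fun y => deriv (fun t => Φ (y, t)) p.2) =ᶠ[𝓝 p.1] fun y => W (Φ (y, p.2)) := by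
    filter_upwards [(Continuous.prodMk_left p.2).continuousAt.eventually hderiv] with y hy
    exact hy.deriv
  have hspace : DifferentiableAt ℝ (fun y => Φ (y, p.2)) p.1 :=
    (hp.comp p.1 (f := fun y => (y, p.2)) (by fun_prop)).differentiableAt (by simp)
  have h := hasDerivAt_fderiv_comm (contDiffAt_infty.1 hp 2) u
  rwa [hfield.fderiv_eq, fderiv_fun_comp p.1 hWp hspace] at h

theorem fderiv_zero (hΦ : IsLocalFlowAt Φ W q) :
    fderiv ℝ (fun p => Φ (p, 0)) q = ContinuousLinearMap.id ℝ E := by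
  have hid : (fun p => Φ (p, 0)) =ᶠ[𝓝 q] id := hΦ.initial
  rw [hid.fderiv_eq, fderiv_id]

theorem lieBracket_eq_smul {A : E → E} (hΦ : IsLocalFlowAt Φ W q)
    (hW : ∀ᶠ p in 𝓝 q, DifferentiableAt ℝ W p) (hA : DifferentiableAt ℝ A q) {α : ℝ → ℝ} {α' : ℝ}
    (hα : HasDerivAt α α' 0) (hα0 : α 0 = 1)
    (hrel : ∀ᶠ t in 𝓝 0, fderiv ℝ (fun p => Φ (p, t)) q (A q) = α t • A (Φ (q, t))) :
    VectorField.lieBracket ℝ W A q = -α' • A q := by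
  have hleft := (hΦ.eventually_hasDerivAt_fderiv hW).self_of_nhds (A q)
  have hΦ' : HasDerivAt (fun t => Φ (q, t)) (W q) 0 := by
    simpa only [hΦ.apply_zero] using hΦ.hasDerivAt.self_of_nhds
  have hright : HasDerivAt (fun t => A (Φ (q, t))) (fderiv ℝ A q (W q)) 0 := by
    have hA' : HasFDerivAt A (fderiv ℝ A q) (Φ (q, 0)) := by
      rw [hΦ.apply_zero]
      exact hA.hasFDerivAt
    exact hA'.comp_hasDerivAt 0 hΦ'
  have h := hleft.unique ((hα.smul hright).congr_of_eventuallyEq hrel)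
  rw [hα0, hΦ.fderiv_zero, hΦ.apply_zero, one_smul, ContinuousLinearMap.id_apply] at h
  rw [VectorField.lieBracket, h, neg_smul]
  abel

end IsLocalFlowAt

theorem totalDeriv₀_fst {T : ℝ × ℝ → ℝ × ℝ} {P : ℝ × ℝ × ℝ}
    (hT : DifferentiableAt ℝ T (base P)) :
    totalDeriv₀ (fun z => (T z).1) P = (fderiv ℝ T (base P) (1, P.2.2)).1 := by
  rw [totalDeriv₀, hT.hasFDerivAt.fst.fderiv]
  rfl

theorem totalDeriv₀_snd {T : ℝ × ℝ → ℝ × ℝ} {P : ℝ × ℝ × ℝ}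
    (hT : DifferentiableAt ℝ T (base P)) :
    totalDeriv₀ (fun z => (T z).2) P = (fderiv ℝ T (base P) (1, P.2.2)).2 := by
  rw [totalDeriv₀, hT.hasFDerivAt.snd.fderiv]
  rfl

theorem slopeMap_eq_div {T : ℝ × ℝ → ℝ × ℝ} {P : ℝ × ℝ × ℝ} (hT : DifferentiableAt ℝ T (base P)) :
    slopeMap T P =
      (fderiv ℝ T (base P) (1, P.2.2)).2 / (fderiv ℝ T (base P) (1, P.2.2)).1 := by
  rw [slopeMap, totalDeriv₀_fst hT, totalDeriv₀_snd hT]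

theorem prolong_slope {V : ℝ × ℝ → ℝ × ℝ} {P : ℝ × ℝ × ℝ} (hV : DifferentiableAt ℝ V (base P)) :
    (prolong V P).2.2 =
      (fderiv ℝ V (base P) (1, P.2.2)).2 - P.2.2 * (fderiv ℝ V (base P) (1, P.2.2)).1 := by
  rw [prolong, totalDeriv₀_fst hV, totalDeriv₀_snd hV]

theorem fderiv_jetMap_apply {T : ℝ × ℝ → ℝ × ℝ} {P : ℝ × ℝ × ℝ}
    (hT : DifferentiableAt ℝ T (base P)) (hslope : DifferentiableAt ℝ (slopeMap T) P)
    (hne : totalDeriv₀ (fun z => (T z).1) P ≠ 0) (y₂ : ℝ) :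
    fderiv ℝ (jetMap T) P (1, P.2.2, y₂) =
      totalDeriv₀ (fun z => (T z).1) P • (1, slopeMap T P, secondMap T P y₂) := by
  have hbase : HasFDerivAt (fun Q => T (base Q)) (fderiv ℝ (fun Q => T (base Q)) P) P :=
    (DifferentiableAt.comp P hT (contDiff_base.differentiable one_ne_zero P)).hasFDerivAt
  have h : HasFDerivAt (jetMap T) _ P := hbase.fst.prodMk (hbase.snd.prodMk hslope.hasFDerivAt)
  have hvalue : fderiv ℝ (fun Q => T (base Q)) P (1, P.2.2, y₂) =
      fderiv ℝ T (base P) (1, P.2.2) := fderiv_comp_base hT _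
  rw [totalDeriv₀_fst hT] at hne
  rw [h.fderiv, secondMap, slopeMap, totalDeriv₁, totalDeriv₀_fst hT, totalDeriv₀_snd hT]
  simp only [ContinuousLinearMap.prod_apply, ContinuousLinearMap.comp_apply, hvalue,
    ContinuousLinearMap.coe_fst', ContinuousLinearMap.coe_snd', Prod.smul_mk, smul_eq_mul, mul_one,
    mul_div_cancel₀ _ hne]

section FlowProlongation

variable {Φ : (ℝ × ℝ) × ℝ → ℝ × ℝ} {V : ℝ × ℝ → ℝ × ℝ} {P : ℝ × ℝ × ℝ}

theorem contDiffAt_totalDeriv₀_param {a : (ℝ × ℝ) × ℝ → ℝ} {p : (ℝ × ℝ × ℝ) × ℝ}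
    (ha : ContDiffAt ℝ ∞ a (base p.1, p.2)) :
    ContDiffAt ℝ ∞ (fun p : (ℝ × ℝ × ℝ) × ℝ => totalDeriv₀ (fun z => a (z, p.2)) p.1) p := by
  have hbase : ContDiff ℝ ∞ fun p : (ℝ × ℝ × ℝ) × ℝ => base p.1 := contDiff_base.comp contDiff_fst
  have hslope : ContDiff ℝ ∞ fun p : (ℝ × ℝ × ℝ) × ℝ => ((1 : ℝ), p.1.2.2) := by fun_prop
  have hlift : ContDiffAt ℝ ∞
      (fun r : ((ℝ × ℝ × ℝ) × ℝ) × ℝ × ℝ => a (r.2, r.1.2)) (p, base p.1) :=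
    ContDiffAt.comp (p, base p.1) (f := fun r : ((ℝ × ℝ × ℝ) × ℝ) × ℝ × ℝ => (r.2, r.1.2)) ha
      (by fun_prop)
  exact (ContDiffAt.fderiv (f := fun (p : (ℝ × ℝ × ℝ) × ℝ) z => a (z, p.2)) (n := ∞) hlift
    hbase.contDiffAt (by simp)).clm_apply hslope.contDiffAt

theorem jetMap_of_eventually_eq {T : ℝ × ℝ → ℝ × ℝ} (hT : ∀ᶠ z in 𝓝 (base P), T z = z) :
    totalDeriv₀ (fun z => (T z).1) P = 1 ∧ jetMap T P = P := by
  have hid : T =ᶠ[𝓝 (base P)] id := hT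
  have hd : DifferentiableAt ℝ T (base P) := hid.differentiableAt_iff.2 differentiableAt_id
  have hfderiv : fderiv ℝ T (base P) (1, P.2.2) = (1, P.2.2) := by
    rw [hid.fderiv_eq, fderiv_id, ContinuousLinearMap.id_apply]
  refine ⟨by rw [totalDeriv₀_fst hd, hfderiv], ?_⟩
  rw [jetMap, slopeMap, totalDeriv₀_fst hd, totalDeriv₀_snd hd, hfderiv, hT.self_of_nhds, div_one]
  rfl

theorem tendsto_base_prodMk (P : ℝ × ℝ × ℝ) : Filter.Tendsto
    (fun p : (ℝ × ℝ × ℝ) × ℝ => (base p.1, p.2)) (𝓝 (P, 0)) (𝓝 (base P, 0)) :=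
  ((contDiff_base (n := 0)).continuous.comp continuous_fst |>.prodMk continuous_snd).tendsto (P, 0)

theorem IsLocalFlowAt.eventually_totalDeriv₀_ne_zero (hΦ : IsLocalFlowAt Φ V (base P)) :
    ∀ᶠ p : (ℝ × ℝ × ℝ) × ℝ in 𝓝 (P, 0), totalDeriv₀ (fun z => (Φ (z, p.2)).1) p.1 ≠ 0 :=
  (contDiffAt_totalDeriv₀_param (p := (P, 0)) (a := fun p => (Φ p).1)
    hΦ.contDiffAt.self_of_nhds.fst).continuousAt.eventually_ne <| by
      simp only [(jetMap_of_eventually_eq hΦ.initial).1, ne_eq, one_ne_zero, not_false_iff]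

/-- The derivative of the slope is the last component of the first extension of a vector field with
derivative `L`. -/
theorem hasDerivAt_slope {c : ℝ → ℝ × ℝ} {L : ℝ × ℝ →L[ℝ] ℝ × ℝ} {t : ℝ}
    (hc : HasDerivAt c (L (c t)) t) (hne : (c t).1 ≠ 0) :
    HasDerivAt (fun τ => (c τ).2 / (c τ).1)
      ((L (1, (c t).2 / (c t).1)).2 - (c t).2 / (c t).1 * (L (1, (c t).2 / (c t).1)).1) t := by
  have hdir : L (c t) = (c t).1 • L (1, (c t).2 / (c t).1) := by
    rw [← map_smul, Prod.smul_mk, smul_eq_mul, smul_eq_mul, mul_one, mul_div_cancel₀ _ hne]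
  rw [hdir] at hc
  have hfst := hasFDerivAt_fst.comp_hasDerivAt t hc
  have hsnd := hasFDerivAt_snd.comp_hasDerivAt t hc
  refine (hsnd.div hfst hne).congr_deriv ?_
  simp only [ContinuousLinearMap.coe_fst', ContinuousLinearMap.coe_snd', Prod.smul_fst,
    Prod.smul_snd, smul_eq_mul, Function.comp_apply]
  field_simp

theorem IsLocalFlowAt.prolong (hΦ : IsLocalFlowAt Φ V (base P))
    (hV : ∀ᶠ z in 𝓝 (base P), DifferentiableAt ℝ V z) :
    IsLocalFlowAt (fun p => jetMap (fun z => Φ (z, p.2)) p.1) (prolong V) P := by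
  have hlift := tendsto_base_prodMk P
  refine ⟨?_, ?_, ?_⟩
  · filter_upwards [hlift.eventually hΦ.contDiffAt, hΦ.eventually_totalDeriv₀_ne_zero] with p hp hne
    have hbase : ContDiffAt ℝ ∞ (fun p : (ℝ × ℝ × ℝ) × ℝ => Φ (base p.1, p.2)) p :=
      hp.comp p (f := fun p : (ℝ × ℝ × ℝ) × ℝ => (base p.1, p.2))
        ((contDiff_base.comp contDiff_fst).prodMk contDiff_snd).contDiffAt
    exact hbase.fst.prodMk (hbase.snd.prodMk ((contDiffAt_totalDeriv₀_param hp.snd).div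
      (contDiffAt_totalDeriv₀_param hp.fst) hne))
  · filter_upwards [(contDiff_base (n := 0)).continuous.tendsto P |>.eventually
      hΦ.initial.eventually_nhds] with Q hQ
    exact (jetMap_of_eventually_eq hQ).2
  · filter_upwards [hlift.eventually hΦ.contDiffAt.eventually_nhds, hlift.eventually hΦ.hasDerivAt,
      hlift.eventually (hΦ.eventually_hasDerivAt_fderiv hV), hΦ.eventually_totalDeriv₀_ne_zero,
      hlift.eventually (hΦ.tendsto.eventually hV)] with p hp hderiv hvar hne hVp
    have hspace : ∀ᶠ t in 𝓝 p.2, DifferentiableAt ℝ (fun z => Φ (z, t)) (base p.1) :=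
      (Continuous.prodMk_right (base p.1)).continuousAt.eventually hp |>.mono fun t ht =>
        (ht.comp (base p.1) (f := fun z => (z, t)) (by fun_prop)).differentiableAt (by simp)
    have hslope : (fun t => slopeMap (fun z => Φ (z, t)) p.1) =ᶠ[𝓝 p.2] fun t =>
        (fderiv ℝ (fun z => Φ (z, t)) (base p.1) (1, p.1.2.2)).2 /
          (fderiv ℝ (fun z => Φ (z, t)) (base p.1) (1, p.1.2.2)).1 := by
      filter_upwards [hspace] with t ht using slopeMap_eq_div ht
    rw [totalDeriv₀_fst hspace.self_of_nhds] at hne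
    have hsnd : HasDerivAt (fun t => slopeMap (fun z => Φ (z, t)) p.1)
        (_root_.prolong V (jetMap (fun z => Φ (z, p.2)) p.1)).2.2 p.2 := by
      refine ((hasDerivAt_slope (hvar (1, p.1.2.2)) hne).congr_of_eventuallyEq
        hslope).congr_deriv ?_
      rw [← slopeMap_eq_div hspace.self_of_nhds]
      exact (prolong_slope (P := jetMap (fun z => Φ (z, p.2)) p.1) hVp).symm
    exact (hasFDerivAt_fst.comp_hasDerivAt p.2 hderiv).prodMk
      ((hasFDerivAt_snd.comp_hasDerivAt p.2 hderiv).prodMk hsnd)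

end FlowProlongation

/-- Each transformation of the group rescales `equationField f`, since `x` changes to `x*`. -/
theorem IsLocalTransformationGroup.lieBracket_prolong_equationField
    {D S : Set (ℝ × ℝ)} {φ X : ℝ × ℝ → ℝ × ℝ → ℝ × ℝ} (hX : IsLocalTransformationGroup D S φ X)
    {J : Set (ℝ × ℝ × ℝ)} (hJ : IsOpen J) {f : ℝ × ℝ × ℝ → ℝ} (hadm : AdmitsGroup S X J f)
    (c : ℝ × ℝ) {P : ℝ × ℝ × ℝ} (hP : P ∈ J) (hPD : base P ∈ D) (hf : DifferentiableAt ℝ f P) :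
    VectorField.lieBracket ℝ (prolong (infinitesimal X c)) (equationField f) P =
      -totalDeriv₀ (fun z => (infinitesimal X c z).1) P • equationField f P := by
  obtain ⟨γ, hγS, hγ⟩ := hX.exists_isLocalFlowAt c
  have hΦ := hγ (base P) hPD
  have hV : ∀ᶠ z in 𝓝 (base P), ContDiffAt ℝ ∞ (infinitesimal X c) z :=
    (hX.isOpen_domain.eventually_mem hPD).mono fun z hz => hX.contDiffAt_infinitesimal c hz
  have hVd := hV.mono fun z hz => hz.differentiableAt (by simp)
  have hprolong := hΦ.prolong hVd
  have ht : Filter.Tendsto (fun t : ℝ => (P, t)) (𝓝 0) (𝓝 (P, 0)) :=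
    (Continuous.prodMk_right P).tendsto 0
  have hspace : ∀ᶠ t in 𝓝 (0 : ℝ), DifferentiableAt ℝ (fun z => X z (γ t)) (base P) := by
    filter_upwards [hγS] with t hSt
    exact ((hX.contDiffAt_act hPD hSt).comp (base P) (f := fun z => (z, γ t))
      (by fun_prop)).differentiableAt (by simp)
  refine hprolong.lieBracket_eq_smul ?_ ?_
    (α := fun t => totalDeriv₀ (fun z => (X z (γ t)).1) P) ?_ ?_ ?_
  · filter_upwards [(contDiff_base (n := 0)).continuous.continuousAt.eventually hV] with Q hQ
    exact (contDiffAt_prolong hQ).differentiableAt (by simp)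
  · exact differentiableAt_equationField hf
  · have hvar := (hΦ.eventually_hasDerivAt_fderiv hVd).self_of_nhds (1, P.2.2)
    simp only [hΦ.fderiv_zero, hΦ.apply_zero, ContinuousLinearMap.id_apply] at hvar
    rw [totalDeriv₀_fst hVd.self_of_nhds]
    refine (hasFDerivAt_fst.comp_hasDerivAt 0 hvar).congr_of_eventuallyEq ?_
    filter_upwards [hspace] with t hd using totalDeriv₀_fst hd
  · exact (jetMap_of_eventually_eq hΦ.initial).1
  · filter_upwards [hγS, hspace, ht.eventually hΦ.eventually_totalDeriv₀_ne_zero,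
      ht.eventually hprolong.contDiffAt, (hprolong.tendsto.comp ht).eventually_mem (hJ.mem_nhds hP)]
      with t hSt hd hne hjet hmem
    have hslope : DifferentiableAt ℝ (slopeMap fun z => X z (γ t)) P :=
      ((hjet.comp P (f := fun Q => (Q, t)) (by fun_prop)).snd.snd).differentiableAt (by simp)
    rw [equationField, fderiv_jetMap_apply hd hslope hne, hadm (γ t) hSt P hP hne hmem _ rfl]
    rfl

end Jets

section FirstOrder

/-- `V` is an infinitesimal point symmetry of `y'' = f(x,y,y')`: it has smooth local flows on `D`,
and the flow of its first extension on `J` permutes the integral curves of `equationField f`. -/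
structure IsPointSymmetry (D : Set (ℝ × ℝ)) (J : Set (ℝ × ℝ × ℝ)) (f : ℝ × ℝ × ℝ → ℝ)
    (V : ℝ × ℝ → ℝ × ℝ) : Prop where
  contDiffAt : ∀ z ∈ D, ContDiffAt ℝ ∞ V z
  exists_flow : ∀ z ∈ D, ∃ Φ, IsLocalFlowAt Φ V z
  lieBracket_eq : ∀ P ∈ J, ∃ μ : ℝ,
    VectorField.lieBracket ℝ (prolong V) (equationField f) P = μ • equationField f P

/-- The plane of invariants `(v, dt/dv)` of the group of translations of `t`, for the coordinates
`T = (v, t)` of the plane. -/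
noncomputable abbrev invariants (T : ℝ × ℝ → ℝ × ℝ) : ℝ × ℝ × ℝ → ℝ × ℝ :=
  reduced (fun z => (T z).1) (slopeMap T)

/-- The jet coordinates `((v, dt/dv), t)` induced by the coordinates `T = (v, t)` of the plane;
this is `jetMap T` with the translated coordinate moved to the end. -/
noncomputable def jetChart (T : ℝ × ℝ → ℝ × ℝ) (P : ℝ × ℝ × ℝ) : (ℝ × ℝ) × ℝ :=
  (invariants T P, (T (base P)).2)

section JetChart

variable {T : ℝ × ℝ → ℝ × ℝ} {P : ℝ × ℝ × ℝ}

theorem contDiffAt_slopeMap (hT : ContDiffAt ℝ ∞ T (base P))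
    (hne : totalDeriv₀ (fun z => (T z).1) P ≠ 0) : ContDiffAt ℝ ∞ (slopeMap T) P :=
  (contDiffAt_totalDeriv₀ hT.snd).div (contDiffAt_totalDeriv₀ hT.fst) hne

theorem contDiffAt_jetChart (hT : ContDiffAt ℝ ∞ T (base P))
    (hne : totalDeriv₀ (fun z => (T z).1) P ≠ 0) : ContDiffAt ℝ ∞ (jetChart T) P :=
  have hbase : ContDiffAt ℝ ∞ (fun Q => T (base Q)) P := hT.comp P contDiff_base.contDiffAt
  (hbase.fst.prodMk (contDiffAt_slopeMap hT hne)).prodMk hbase.snd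

theorem fderiv_jetChart_apply (hT : ContDiffAt ℝ ∞ T (base P))
    (hne : totalDeriv₀ (fun z => (T z).1) P ≠ 0) (u : ℝ × ℝ × ℝ) :
    fderiv ℝ (jetChart T) P u = (((fderiv ℝ T (base P) (base u)).1, fderiv ℝ (slopeMap T) P u),
      (fderiv ℝ T (base P) (base u)).2) := by
  have hT' : DifferentiableAt ℝ T (base P) := hT.differentiableAt (by simp)
  have hbase : HasFDerivAt (fun Q => T (base Q)) (fderiv ℝ (fun Q => T (base Q)) P) P :=
    (DifferentiableAt.comp P hT' (contDiff_base.differentiable one_ne_zero P)).hasFDerivAt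
  have hslope := ((contDiffAt_slopeMap hT hne).differentiableAt (by simp)).hasFDerivAt
  have h : HasFDerivAt (jetChart T) _ P := (hbase.fst.prodMk hslope).prodMk hbase.snd
  rw [h.fderiv, ← fderiv_comp_base hT' u]
  rfl

theorem fderiv_totalDeriv₀_vertical {a : ℝ × ℝ → ℝ} (ha : ContDiffAt ℝ ∞ a (base P)) :
    fderiv ℝ (totalDeriv₀ a) P (0, 0, 1) = fderiv ℝ a (base P) (0, 1) := by
  have hL : DifferentiableAt ℝ (fderiv ℝ a) (base P) :=
    (ha.fderiv_right (m := ∞) (by simp)).differentiableAt (by simp)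
  have hslope : HasFDerivAt (fun Q : ℝ × ℝ × ℝ => ((1 : ℝ), Q.2.2)) _ P :=
    (hasFDerivAt_const 1 P).prodMk
      ((ContinuousLinearMap.snd ℝ ℝ ℝ).comp (ContinuousLinearMap.snd ℝ ℝ (ℝ × ℝ))).hasFDerivAt
  have h := congrArg (fun L : ℝ × ℝ × ℝ →L[ℝ] ℝ => L (0, 0, 1)) (fderiv_clm_apply
    (DifferentiableAt.comp P hL (contDiff_base.differentiable one_ne_zero P))
    hslope.differentiableAt)
  refine h.trans ?_
  simp only [add_apply, ContinuousLinearMap.comp_apply, ContinuousLinearMap.flip_apply,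
    Function.comp_def, fderiv_comp_base hL, hslope.fderiv]
  rw [show base ((0 : ℝ), (0 : ℝ), (1 : ℝ)) = 0 from rfl, map_zero]
  simp

/-- The derivative of `T` takes the contact direction `(1, y₁)` to a multiple of
`(1, slopeMap T P)`, and so takes the transversal direction `(0, 1)` to a transversal one. -/
theorem fderiv_slopeMap_vertical_ne_zero (hT : ContDiffAt ℝ ∞ T (base P))
    (hne : totalDeriv₀ (fun z => (T z).1) P ≠ 0) (hinj : Function.Injective (fderiv ℝ T (base P))) :
    fderiv ℝ (slopeMap T) P (0, 0, 1) ≠ 0 := by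
  have hT' : DifferentiableAt ℝ T (base P) := hT.differentiableAt (by simp)
  have hd {a : ℝ × ℝ → ℝ} (ha : ContDiffAt ℝ ∞ a (base P)) :
      DifferentiableAt ℝ (totalDeriv₀ a) P := (contDiffAt_totalDeriv₀ ha).differentiableAt (by simp)
  have hquot := fderiv_div_apply (hd hT.snd) (hd hT.fst) hne (0, 0, 1)
  rw [fderiv_totalDeriv₀_vertical hT.snd, fderiv_totalDeriv₀_vertical hT.fst,
    hT'.hasFDerivAt.snd.fderiv, hT'.hasFDerivAt.fst.fderiv] at hquot
  intro h0
  have hzero : (fderiv ℝ T (base P) (0, 1)).2 -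
      slopeMap T P * (fderiv ℝ T (base P) (0, 1)).1 = 0 :=
    (div_eq_zero_iff.1 (hquot.symm.trans h0)).resolve_right hne
  rw [slopeMap_eq_div hT'] at hzero
  rw [totalDeriv₀_fst hT'] at hne
  set A := fderiv ℝ T (base P) (1, P.2.2) with hA
  set B := fderiv ℝ T (base P) (0, 1) with hB
  have hparallel : fderiv ℝ T (base P) (A.1 • (0, 1) - B.1 • (1, P.2.2)) = 0 := by
    rw [map_sub, map_smul, map_smul, ← hA, ← hB]
    field_simp at hzero
    ext
    · simp only [Prod.fst_sub, Prod.smul_fst, smul_eq_mul, Prod.fst_zero]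
      ring
    · simp only [Prod.snd_sub, Prod.smul_snd, smul_eq_mul, Prod.snd_zero]
      linarith
  have h := (injective_iff_map_eq_zero _).1 hinj _ hparallel
  simp only [Prod.smul_mk, Prod.mk_sub_mk, Prod.mk_eq_zero, smul_eq_mul, mul_zero, mul_one,
    zero_sub, neg_eq_zero] at h
  exact hne (by simpa [h.1] using h.2)

theorem injective_fderiv_jetChart (hT : ContDiffAt ℝ ∞ T (base P))
    (hne : totalDeriv₀ (fun z => (T z).1) P ≠ 0) (hinj : Function.Injective (fderiv ℝ T (base P))) :
    Function.Injective (fderiv ℝ (jetChart T) P) := by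
  refine (injective_iff_map_eq_zero _).2 fun u hu => ?_
  rw [fderiv_jetChart_apply hT hne] at hu
  simp only [Prod.mk_eq_zero] at hu
  have hbase : base u = 0 :=
    (injective_iff_map_eq_zero _).1 hinj _ (Prod.ext hu.1.1 hu.2)
  have hu' : u = u.2.2 • ((0, 0, 1) : ℝ × ℝ × ℝ) := by
    ext
    · simpa [base] using congrArg Prod.fst hbase
    · simpa [base] using congrArg Prod.snd hbase
    · simp
  have hvert := hu.1.2
  rw [hu', map_smul, smul_eq_mul] at hvert
  rw [hu', (mul_eq_zero.1 hvert).resolve_right (fderiv_slopeMap_vertical_ne_zero hT hne hinj),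
    zero_smul]

theorem slopeMap_eq_slopeAlong (hT : DifferentiableAt ℝ T (base P)) (f : ℝ × ℝ × ℝ → ℝ) :
    slopeMap T P = slopeAlong (fun Q => T (base Q)) (equationField f) P := by
  rw [slopeMap_eq_div hT, slopeAlong, fderiv_comp_base hT]
  rfl

theorem fderiv_slopeMap_prolong {V U : ℝ × ℝ → ℝ × ℝ} {f : ℝ × ℝ × ℝ → ℝ} {μ : ℝ}
    (hT : ContDiffAt ℝ ∞ T (base P)) (hV : ContDiffAt ℝ ∞ V (base P)) (hf : DifferentiableAt ℝ f P)
    (hne : totalDeriv₀ (fun z => (T z).1) P ≠ 0)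
    (hbr : VectorField.lieBracket ℝ (prolong V) (equationField f) P = μ • equationField f P)
    (hU : ∀ᶠ z in 𝓝 (base P), fderiv ℝ T z (V z) = U z) :
    fderiv ℝ (slopeMap T) P (prolong V P) =
      (totalDeriv₀ (fun z => (U z).2) P - slopeMap T P * totalDeriv₀ (fun z => (U z).1) P) /
        totalDeriv₀ (fun z => (T z).1) P := by
  have hbase : Filter.Tendsto base (𝓝 P) (𝓝 (base P)) :=
    (contDiff_base (n := 0)).continuous.tendsto P
  have hTd : ∀ᶠ z in 𝓝 (base P), DifferentiableAt ℝ T z :=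
    ((contDiffAt_infty.1 hT 1).eventually (by simp)).mono
      fun z hz => hz.differentiableAt one_ne_zero
  have hTP := hTd.self_of_nhds
  have hUd : DifferentiableAt ℝ U (base P) :=
    (((hT.fderiv_right (m := ∞) (by simp)).clm_apply hV).differentiableAt
      (by simp)).congr_of_eventuallyEq (hU.mono fun z hz => hz.symm)
  have hslope : slopeMap T =ᶠ[𝓝 P] slopeAlong (fun Q => T (base Q)) (equationField f) :=
    (hbase.eventually hTd).mono fun Q hQ => slopeMap_eq_slopeAlong hQ f
  have hTA : fderiv ℝ (fun Q => T (base Q)) P (equationField f P) =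
      fderiv ℝ T (base P) (1, P.2.2) := fderiv_comp_base hTP _
  have hUA : fderiv ℝ (fun Q => U (base Q)) P (equationField f P) =
      fderiv ℝ U (base P) (1, P.2.2) := fderiv_comp_base hUd _
  rw [totalDeriv₀_fst hTP] at hne
  rw [hslope.fderiv_eq, fderiv_slopeAlong_of_lieBracket_eq_smul (R := fun Q => T (base Q))
    ((contDiffAt_infty.1 hT 2).comp P contDiff_base.contDiffAt) (differentiableAt_equationField hf)
    ((contDiffAt_prolong hV).differentiableAt (by simp)) (by rwa [hTA]) hbr
    (c := fun Q => U (base Q)) ?_, hUA, hTA, ← hslope.self_of_nhds, totalDeriv₀_fst hUd,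
    totalDeriv₀_snd hUd, totalDeriv₀_fst hTP]
  filter_upwards [hbase.eventually hTd, hbase.eventually hU] with Q hQ hUQ
  rw [fderiv_comp_base hQ, ← hUQ]
  rfl

end JetChart

/-- `e = (v, s)` straightens `V` around the base point of `P₀`, and `ê = ((v, ds/dv), s)`
straightens its first extension around `P₀`. -/
structure IsJetFlowBox (e : OpenPartialHomeomorph (ℝ × ℝ) (ℝ × ℝ))
    (ê : OpenPartialHomeomorph (ℝ × ℝ × ℝ) ((ℝ × ℝ) × ℝ)) (V : ℝ × ℝ → ℝ × ℝ)
    (P₀ : ℝ × ℝ × ℝ) : Prop where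
  isFlowBox : IsFlowBox e V (base P₀)
  isFlowBox_jet : IsFlowBox ê (prolong V) P₀
  coe_jet : ⇑ê = jetChart e
  base_mem : ∀ P ∈ ê.source, base P ∈ e.source
  totalDeriv_ne_zero : ∀ P ∈ ê.source, totalDeriv₀ (fun z => (e z).1) P ≠ 0

section JetFlowBox

variable {D : Set (ℝ × ℝ)} {J : Set (ℝ × ℝ × ℝ)} {f : ℝ × ℝ × ℝ → ℝ} {V : ℝ × ℝ → ℝ × ℝ}
  {e : OpenPartialHomeomorph (ℝ × ℝ) (ℝ × ℝ)}
  {ê : OpenPartialHomeomorph (ℝ × ℝ × ℝ) ((ℝ × ℝ) × ℝ)} {P P₀ : ℝ × ℝ × ℝ}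

theorem IsFlowBox.totalDeriv₀_fst_ne_zero {q : ℝ × ℝ} (he : IsFlowBox e V q)
    (hP : base P ∈ e.source) (hli : LinearIndependent ℝ ![((1 : ℝ), P.2.2), V (base P)]) :
    totalDeriv₀ (fun z => (e z).1) P ≠ 0 := by
  rw [totalDeriv₀_fst ((he.contDiffAt _ hP).differentiableAt (by simp))]
  exact he.fst_fderiv_ne_zero hP hli

theorem IsPointSymmetry.exists_isJetFlowBox (hV : IsPointSymmetry D J f V) (hD : IsOpen D)
    (hJ : IsOpen J) (hJD : ∀ P ∈ J, base P ∈ D) (hf : ∀ P ∈ J, DifferentiableAt ℝ f P)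
    (hP₀ : P₀ ∈ J) (hli : LinearIndependent ℝ ![((1 : ℝ), P₀.2.2), V (base P₀)]) :
    ∃ e ê, IsJetFlowBox e ê V P₀ ∧ e.source ⊆ D ∧ ê.source ⊆ J := by
  obtain ⟨Φ, hΦ⟩ := hV.exists_flow _ (hJD _ hP₀)
  obtain ⟨e, he, heD⟩ := hΦ.exists_isFlowBox (hli.ne_zero 1) (hD.mem_nhds (hJD _ hP₀))
  have hbase : Continuous base := (contDiff_base (n := 0)).continuous
  have hne₀ := he.totalDeriv₀_fst_ne_zero he.mem_source hli
  have hgood : ∀ᶠ P in 𝓝 P₀, (P ∈ J ∧ base P ∈ e.source) ∧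
      totalDeriv₀ (fun z => (e z).1) P ≠ 0 :=
    ((hJ.eventually_mem hP₀).and
      (hbase.continuousAt.eventually (e.open_source.eventually_mem he.mem_source))).and
      ((contDiffAt_totalDeriv₀ (he.contDiffAt _ he.mem_source).fst).continuousAt.eventually_ne hne₀)
  obtain ⟨ê, hê, hsub, hchart⟩ := exists_isBallChart (φ := jetChart e) (n := ∞) (by simp) (by simp)
    (hgood.mono fun P hP => contDiffAt_jetChart (he.contDiffAt _ hP.1.2) hP.2)
    (injective_fderiv_jetChart (he.contDiffAt _ he.mem_source) hne₀
      (he.injective_fderiv (by simp) he.mem_source)) hgood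
  refine ⟨e, ê, ⟨he, ⟨hchart, fun P hP => ?_⟩, hê, fun P hP => (hsub hP).1.2,
    fun P hP => (hsub hP).2⟩, heD, fun P hP => (hsub hP).1.1⟩
  obtain ⟨⟨hPJ, hPe⟩, hne⟩ := hsub hP
  obtain ⟨μ, hμ⟩ := hV.lieBracket_eq P hPJ
  have heP := he.contDiffAt _ hPe
  have hslope : fderiv ℝ (slopeMap e) P (prolong V P) = 0 := by
    rw [fderiv_slopeMap_prolong heP (hV.contDiffAt _ (hJD _ hPJ)) (hf P hPJ) hne hμ
      ((e.open_source.eventually_mem hPe).mono fun z hz => he.fderiv_apply z hz)]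
    simp [totalDeriv₀]
  have hbaseV : base (prolong V P) = V (base P) := rfl
  rw [hê, fderiv_jetChart_apply heP hne, hslope, hbaseV, he.fderiv_apply _ hPe]
  rfl

end JetFlowBox

end FirstOrder

section Reduction

theorem IsFlowBox.exists_fderiv_apply_eq {E F : Type*} [NormedAddCommGroup E] [NormedSpace ℝ E]
    [NormedAddCommGroup F] [NormedSpace ℝ F] {e : OpenPartialHomeomorph E (F × ℝ)}
    {V₁ V₂ : E → E} {q : E} {k : ℝ} (he : IsFlowBox e V₁ q)
    (hV₁ : ∀ z ∈ e.source, DifferentiableAt ℝ V₁ z) (hV₂ : ∀ z ∈ e.source, ContDiffAt ℝ ∞ V₂ z)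
    (hbr : ∀ z ∈ e.source, VectorField.lieBracket ℝ V₁ V₂ z = k • V₁ z) :
    ∃ B : F → F × ℝ, (∀ z ∈ e.source, ContDiffAt ℝ ∞ B (e z).1) ∧
      ∀ z ∈ e.source, fderiv ℝ e z (V₂ z) = B (e z).1 + (e z).2 • (0, k) := by
  have hpush (z) (hz : z ∈ e.source) : ContDiffAt ℝ ∞ (fun y => fderiv ℝ e y (V₂ y)) z :=
    ((he.contDiffAt z hz).fderiv_right (by simp)).clm_apply (hV₂ z hz)
  have hlast (z) (hz : z ∈ e.source) : ContDiffAt ℝ ∞ (fun y => (e y).2 • ((0, k) : F × ℝ)) z :=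
    (he.contDiffAt z hz).snd.smul contDiffAt_const
  have hinv (z) (hz : z ∈ e.source) :
      fderiv ℝ (fun y => fderiv ℝ e y (V₂ y) - (e y).2 • ((0, k) : F × ℝ)) z (V₁ z) = 0 := by
    have hed := (he.contDiffAt z hz).differentiableAt (by simp)
    have hconst : (fun y => fderiv ℝ e y (V₁ y)) =ᶠ[𝓝 z] fun _ => (0, 1) :=
      (e.open_source.eventually_mem hz).mono fun y hy => he.fderiv_apply y hy
    have hpushV : fderiv ℝ (fun y => fderiv ℝ e y (V₂ y)) z (V₁ z) = (0, k) := by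
      have h := VectorField.fderiv_apply_lieBracket (contDiffAt_infty.1 (he.contDiffAt z hz) 2)
        (by simp) ((hV₂ z hz).differentiableAt (by simp)) (hV₁ z hz)
      rw [hbr z hz, map_smul, he.fderiv_apply z hz, hconst.fderiv_eq] at h
      simpa using h.symm
    have hlastV : fderiv ℝ (fun y => (e y).2 • ((0, k) : F × ℝ)) z (V₁ z) = (0, k) := by
      rw [(hed.hasFDerivAt.snd.smul_const _).fderiv]
      simp [he.fderiv_apply z hz]
    rw [fderiv_fun_sub ((hpush z hz).differentiableAt (by simp))
      ((hlast z hz).differentiableAt (by simp)), sub_apply, hpushV, hlastV, sub_self]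
  obtain ⟨B, hB, heq⟩ := he.exists_eq_comp_fst (n := ⊤) le_top
    (fun z hz => (hpush z hz).sub (hlast z hz)) hinv
  exact ⟨B, hB, fun z hz => sub_eq_iff_eq_add.1 (heq z hz)⟩

theorem fderiv_slopeAlong_of_related {E : Type*} [NormedAddCommGroup E] [NormedSpace ℝ E]
    {A W : E → E} {R : E → ℝ × ℝ} {Y : ℝ × ℝ → ℝ × ℝ} {x : E} {μ : ℝ}
    (hR : ContDiffAt ℝ 2 R x) (hA : DifferentiableAt ℝ A x) (hW : DifferentiableAt ℝ W x)
    (hx : (fderiv ℝ R x (A x)).1 ≠ 0) (hbr : VectorField.lieBracket ℝ W A x = μ • A x)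
    (hY : DifferentiableAt ℝ Y (R x)) (hWY : ∀ᶠ y in 𝓝 x, fderiv ℝ R y (W y) = Y (R y)) :
    fderiv ℝ (slopeAlong R A) x (W x) =
      (prolong Y ((R x).1, (R x).2, slopeAlong R A x)).2.2 := by
  have hYR : fderiv ℝ (fun y => Y (R y)) x (A x) =
      (fderiv ℝ R x (A x)).1 • fderiv ℝ Y (R x) (1, slopeAlong R A x) := by
    rw [← map_smul, ← fderiv_apply_eq_smul_slopeAlong hx]
    exact congrArg (fun L : E →L[ℝ] ℝ × ℝ => L (A x))
      (fderiv_comp x hY (hR.differentiableAt (by simp)))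
  rw [fderiv_slopeAlong_of_lieBracket_eq_smul hR hA hW hx hbr hWY, hYR, prolong,
    totalDeriv₀_fst hY, totalDeriv₀_snd hY]
  simp only [Prod.smul_fst, Prod.smul_snd, smul_eq_mul, base]
  field_simp

theorem fderiv_slope_of_related {E : Type*} [NormedAddCommGroup E] [NormedSpace ℝ E]
    {A W : E → E} {R : E → ℝ × ℝ} {Y : ℝ × ℝ → ℝ × ℝ} {Z : ℝ × ℝ → ℝ} {x : E} {μ : ℝ}
    (hR : ContDiffAt ℝ 2 R x) (hA : DifferentiableAt ℝ A x) (hW : DifferentiableAt ℝ W x)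
    (hx : (fderiv ℝ R x (A x)).1 ≠ 0) (hbr : VectorField.lieBracket ℝ W A x = μ • A x)
    (hY : DifferentiableAt ℝ Y (R x)) (hWY : ∀ᶠ y in 𝓝 x, fderiv ℝ R y (W y) = Y (R y))
    (hZ : DifferentiableAt ℝ Z (R x)) (hslope : ∀ᶠ y in 𝓝 x, slopeAlong R A y = Z (R y)) :
    (prolong Y ((R x).1, (R x).2, Z (R x))).2.2 = fderiv ℝ Z (R x) (Y (R x)) := by
  rw [← hslope.self_of_nhds, ← fderiv_slopeAlong_of_related hR hA hW hx hbr hY hWY,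
    Filter.EventuallyEq.fderiv_eq hslope, ← hWY.self_of_nhds]
  exact congrArg (fun L : E →L[ℝ] ℝ => L (W x))
    (fderiv_comp x hZ (hR.differentiableAt (by simp)))

theorem contDiffAt_invariants {T : ℝ × ℝ → ℝ × ℝ} {P : ℝ × ℝ × ℝ}
    (hT : ContDiffAt ℝ ∞ T (base P)) (hne : totalDeriv₀ (fun z => (T z).1) P ≠ 0) :
    ContDiffAt ℝ ∞ (invariants T) P :=
  (contDiffAt_jetChart hT hne).fst

theorem fderiv_invariants_apply {T : ℝ × ℝ → ℝ × ℝ} {P : ℝ × ℝ × ℝ}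
    (hT : ContDiffAt ℝ ∞ T (base P)) (hne : totalDeriv₀ (fun z => (T z).1) P ≠ 0)
    (u : ℝ × ℝ × ℝ) :
    fderiv ℝ (invariants T) P u =
      ((fderiv ℝ T (base P) (base u)).1, fderiv ℝ (slopeMap T) P u) := by
  have h := ((contDiffAt_jetChart hT hne).differentiableAt (by simp)).hasFDerivAt.fst.fderiv
  rw [show invariants T = fun Q => (jetChart T Q).1 from rfl, h, ContinuousLinearMap.comp_apply,
    fderiv_jetChart_apply hT hne]
  rfl

theorem totalDeriv₀_comp_fst_add_snd_mul {T : ℝ × ℝ → ℝ × ℝ} {b : ℝ → ℝ} {P : ℝ × ℝ × ℝ}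
    (hT : DifferentiableAt ℝ T (base P)) (hb : DifferentiableAt ℝ b (T (base P)).1) (c : ℝ) :
    totalDeriv₀ (fun z => b (T z).1 + (T z).2 * c) P =
      deriv b (T (base P)).1 * totalDeriv₀ (fun z => (T z).1) P +
        totalDeriv₀ (fun z => (T z).2) P * c := by
  have h := (hb.hasDerivAt.comp_hasFDerivAt (base P) hT.hasFDerivAt.fst).add
    (hT.hasFDerivAt.snd.mul_const c)
  rw [totalDeriv₀_fst hT, totalDeriv₀_snd hT, totalDeriv₀]
  refine (congrArg (fun L : ℝ × ℝ →L[ℝ] ℝ => L (1, P.2.2)) h.fderiv).trans ?_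
  simp [mul_comm]

namespace IsJetFlowBox

variable {D : Set (ℝ × ℝ)} {J : Set (ℝ × ℝ × ℝ)} {f : ℝ × ℝ × ℝ → ℝ} {V₁ V₂ : ℝ × ℝ → ℝ × ℝ}
  {e : OpenPartialHomeomorph (ℝ × ℝ) (ℝ × ℝ)}
  {ê : OpenPartialHomeomorph (ℝ × ℝ × ℝ) ((ℝ × ℝ) × ℝ)} {P P₀ : ℝ × ℝ × ℝ} {k : ℝ} {n : ℕ∞}

theorem contDiffAt (hbox : IsJetFlowBox e ê V₁ P₀) (hP : P ∈ ê.source) :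
    ContDiffAt ℝ ∞ e (base P) :=
  hbox.isFlowBox.contDiffAt _ (hbox.base_mem P hP)

theorem contDiffAt_invariants (hbox : IsJetFlowBox e ê V₁ P₀) (hP : P ∈ ê.source) :
    ContDiffAt ℝ ∞ (invariants e) P :=
  _root_.contDiffAt_invariants (hbox.contDiffAt hP) (hbox.totalDeriv_ne_zero P hP)

theorem fst_apply (hbox : IsJetFlowBox e ê V₁ P₀) (P : ℝ × ℝ × ℝ) : (ê P).1 = invariants e P := by
  rw [hbox.coe_jet, jetChart]

theorem fst_fderiv_jet_apply (hbox : IsJetFlowBox e ê V₁ P₀) (hP : P ∈ ê.source) (u : ℝ × ℝ × ℝ) :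
    (fderiv ℝ ê P u).1 = fderiv ℝ (invariants e) P u := by
  have h := ((hbox.isFlowBox_jet.contDiffAt P hP).differentiableAt (by simp)).hasFDerivAt.fst.fderiv
  simp only [hbox.fst_apply] at h
  rw [show invariants e = fun Q => invariants e Q from rfl, h]
  rfl

theorem ker_fderiv_invariants (hbox : IsJetFlowBox e ê V₁ P₀) (hP : P ∈ ê.source) :
    LinearMap.ker (fderiv ℝ (invariants e) P).toLinearMap = ℝ ∙ prolong V₁ P := by
  ext u
  rw [LinearMap.mem_ker, ContinuousLinearMap.coe_coe, ← hbox.fst_fderiv_jet_apply hP,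
    Submodule.mem_span_singleton]
  constructor
  · exact fun hu => ⟨_, (hbox.isFlowBox_jet.eq_smul_of_fst_fderiv_eq_zero hP hu).symm⟩
  · rintro ⟨c, rfl⟩
    rw [map_smul, hbox.isFlowBox_jet.fderiv_apply P hP, Prod.smul_fst, smul_zero]

theorem fderiv_invariants_prolong (hbox : IsJetFlowBox e ê V₁ P₀) (hP : P ∈ ê.source) :
    fderiv ℝ (invariants e) P (prolong V₁ P) = 0 := by
  rw [← hbox.fst_fderiv_jet_apply hP, hbox.isFlowBox_jet.fderiv_apply P hP]

theorem fst_fderiv_invariants_equationField (hbox : IsJetFlowBox e ê V₁ P₀) (hP : P ∈ ê.source) :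
    (fderiv ℝ (invariants e) P (equationField f P)).1 = totalDeriv₀ (fun z => (e z).1) P := by
  rw [fderiv_invariants_apply (hbox.contDiffAt hP) (hbox.totalDeriv_ne_zero P hP),
    totalDeriv₀_fst ((hbox.contDiffAt hP).differentiableAt (by simp))]
  rfl

/-- The reduced generator is `h ∂_v + g ∂_w`, where `h ∂_v + (k s + b) ∂_s` is `V₂` in the
coordinates `(v, s)` and `g = k w + b' - w h'` is the last component of its first extension. -/
theorem exists_reducedField (hbox : IsJetFlowBox e ê V₁ P₀) (hV₁ : IsPointSymmetry D J f V₁)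
    (hV₂ : IsPointSymmetry D J f V₂) (heD : e.source ⊆ D) (hêJ : ê.source ⊆ J)
    (hf : ∀ P ∈ J, DifferentiableAt ℝ f P)
    (hbr : ∀ z ∈ D, VectorField.lieBracket ℝ V₁ V₂ z = k • V₁ z) :
    ∃ (h : ℝ → ℝ) (g : ℝ × ℝ → ℝ), (∀ P ∈ ê.source, ContDiffAt ℝ ∞ h (e (base P)).1) ∧
      (∀ P ∈ ê.source, ContDiffAt ℝ ∞ g (invariants e P)) ∧
      ∀ P ∈ ê.source,
        fderiv ℝ (invariants e) P (prolong V₂ P) = reducedField h g (invariants e P) := by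
  obtain ⟨B, hB, hpush⟩ := hbox.isFlowBox.exists_fderiv_apply_eq
    (fun z hz => (hV₁.contDiffAt z (heD hz)).differentiableAt (by simp))
    (fun z hz => hV₂.contDiffAt z (heD hz)) fun z hz => hbr z (heD hz)
  have hB' {P} (hP : P ∈ ê.source) := hB _ (hbox.base_mem P hP)
  refine ⟨fun v => (B v).1, fun q => k * q.2 + deriv (fun v => (B v).2) q.1 -
    q.2 * deriv (fun v => (B v).1) q.1, fun P hP => (hB' hP).fst, fun P hP => ?_, fun P hP => ?_⟩
  · have hderiv {b : ℝ → ℝ} (hb : ContDiffAt ℝ ∞ b (e (base P)).1) :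
        ContDiffAt ℝ ∞ (fun q : ℝ × ℝ => deriv b q.1) (invariants e P) :=
      ContDiffAt.comp (invariants e P) (g := deriv b) (f := Prod.fst)
        ((hb.fderiv_right (m := ∞) (by simp)).clm_apply contDiffAt_const) contDiffAt_fst
    exact ((contDiffAt_const.mul contDiffAt_snd).add (hderiv (hB' hP).snd)).sub
      (contDiffAt_snd.mul (hderiv (hB' hP).fst))
  have heP := hbox.contDiffAt hP
  have hne := hbox.totalDeriv_ne_zero P hP
  have hPe := hbox.base_mem P hP
  obtain ⟨μ, hμ⟩ := hV₂.lieBracket_eq P (hêJ hP)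
  rw [fderiv_invariants_apply heP hne, fderiv_slopeMap_prolong heP (hV₂.contDiffAt _ (heD hPe))
    (hf P (hêJ hP)) hne hμ ((e.open_source.eventually_mem hPe).mono fun z hz => hpush z hz)]
  have heP' := heP.differentiableAt (by simp)
  have hpush₁ := totalDeriv₀_comp_fst_add_snd_mul heP' ((hB' hP).fst.differentiableAt (by simp)) 0
  have hpush₂ := totalDeriv₀_comp_fst_add_snd_mul heP' ((hB' hP).snd.differentiableAt (by simp)) k
  simp only [Prod.fst_add, Prod.snd_add, Prod.smul_fst, Prod.smul_snd, smul_eq_mul, hpush₁, hpush₂,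
    reducedField, reduced]
  refine Prod.ext ?_ ?_
  · exact (congrArg Prod.fst (hpush _ hPe)).trans (by simp)
  · simp only [slopeMap]
    field_simp
    ring

theorem exists_slopeAlong_eq (hbox : IsJetFlowBox e ê V₁ P₀) (hV₁ : IsPointSymmetry D J f V₁)
    (heD : e.source ⊆ D) (hêJ : ê.source ⊆ J) (hn : 1 ≤ n) (hf : ∀ P ∈ J, ContDiffAt ℝ n f P) :
    ∃ Z : ℝ × ℝ → ℝ, (∀ P ∈ ê.source, ContDiffAt ℝ n Z (invariants e P)) ∧
      ∀ P ∈ ê.source, slopeAlong (invariants e) (equationField f) P = Z (invariants e P) := by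
  have hn₀ : (n : WithTop ℕ∞) ≠ 0 := by exact_mod_cast (zero_lt_one.trans_le hn).ne'
  have hne {P} (hP : P ∈ ê.source) :
      (fderiv ℝ (invariants e) P (equationField f P)).1 ≠ 0 :=
    hbox.fst_fderiv_invariants_equationField hP ▸ hbox.totalDeriv_ne_zero P hP
  obtain ⟨Z, hZ, heq⟩ := hbox.isFlowBox_jet.exists_eq_comp_fst hn
    (u := slopeAlong (invariants e) (equationField f)) (fun P hP =>
      contDiffAt_slopeAlong (hbox.contDiffAt_invariants hP) (WithTop.coe_le_coe.2 le_top)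
        (contDiffAt_equationField (hf P (hêJ hP))) (hne hP)) fun P hP => by
    obtain ⟨μ, hμ⟩ := hV₁.lieBracket_eq P (hêJ hP)
    rw [fderiv_slopeAlong_of_related (contDiffAt_infty.1 (hbox.contDiffAt_invariants hP) 2)
      (differentiableAt_equationField ((hf P (hêJ hP)).differentiableAt hn₀))
      ((contDiffAt_prolong (hV₁.contDiffAt _ (heD (hbox.base_mem P hP)))).differentiableAt
        (by simp)) (hne hP) hμ (Y := fun _ => 0) (differentiableAt_const _)
      ((ê.open_source.eventually_mem hP).mono fun Q hQ => hbox.fderiv_invariants_prolong hQ)]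
    simp [prolong, totalDeriv₀]
  simp only [hbox.fst_apply] at hZ heq
  exact ⟨Z, hZ, heq⟩

theorem image_invariants (hbox : IsJetFlowBox e ê V₁ P₀) :
    invariants e '' ê.source = Prod.fst '' ê.target := by
  rw [← ê.image_source_eq_target, image_image]
  simp only [hbox.fst_apply]

/-- The slope `dw/dv` is an affine function of `y₂`, with nonzero slope. -/
theorem equation_iff_totalDeriv_div_eq (hbox : IsJetFlowBox e ê V₁ P₀) (hP : P ∈ ê.source)
    (y₂ : ℝ) : y₂ = f P ↔ totalDeriv₁ (slopeMap e) P y₂ / totalDeriv₀ (fun z => (e z).1) P =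
      slopeAlong (invariants e) (equationField f) P := by
  have heP := hbox.contDiffAt hP
  have hne := hbox.totalDeriv_ne_zero P hP
  have hslope : slopeAlong (invariants e) (equationField f) P =
      totalDeriv₁ (slopeMap e) P (f P) / totalDeriv₀ (fun z => (e z).1) P := by
    rw [slopeAlong, hbox.fst_fderiv_invariants_equationField hP, fderiv_invariants_apply heP hne]
    rfl
  have haffine : totalDeriv₁ (slopeMap e) P y₂ = totalDeriv₁ (slopeMap e) P (f P) +
      (y₂ - f P) * fderiv ℝ (slopeMap e) P (0, 0, 1) := by
    rw [totalDeriv₁, totalDeriv₁, ← smul_eq_mul, ← map_smul, ← map_add]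
    simp
  have hvert := fderiv_slopeMap_vertical_ne_zero heP hne
    (hbox.isFlowBox.injective_fderiv (by simp) (hbox.base_mem P hP))
  rw [hslope, div_left_inj' hne, haffine, add_eq_left, mul_eq_zero, or_iff_left hvert, sub_eq_zero]

theorem fst_fderiv_apply (hbox : IsJetFlowBox e ê V₁ P₀) (hP : P ∈ ê.source) (u : ℝ × ℝ × ℝ) :
    fderiv ℝ (fun z => (e z).1) (base P) (base u) = (fderiv ℝ (invariants e) P u).1 := by
  rw [fderiv_invariants_apply (hbox.contDiffAt hP) (hbox.totalDeriv_ne_zero P hP),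
    ((hbox.contDiffAt hP).differentiableAt (by simp)).hasFDerivAt.fst.fderiv]
  rfl

theorem snd_fderiv_apply (hbox : IsJetFlowBox e ê V₁ P₀) (hP : P ∈ ê.source) (u : ℝ × ℝ × ℝ) :
    fderiv ℝ (slopeMap e) P u = (fderiv ℝ (invariants e) P u).2 := by
  rw [fderiv_invariants_apply (hbox.contDiffAt hP) (hbox.totalDeriv_ne_zero P hP)]

theorem exists_reducesToFirstOrder (hbox : IsJetFlowBox e ê V₁ P₀)
    (hV₁ : IsPointSymmetry D J f V₁) (hV₂ : IsPointSymmetry D J f V₂) (heD : e.source ⊆ D)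
    (hêJ : ê.source ⊆ J) (hn : 1 ≤ n) (hf : ∀ P ∈ J, ContDiffAt ℝ n f P)
    (hbr : ∀ z ∈ D, VectorField.lieBracket ℝ V₁ V₂ z = k • V₁ z) :
    ∃ Z h g, ReducesToFirstOrder n f V₁ V₂ ê.source (fun z => (e z).1) (slopeMap e) Z h g := by
  have hn₀ : (n : WithTop ℕ∞) ≠ 0 := by exact_mod_cast (zero_lt_one.trans_le hn).ne'
  have hfd (P) (hP : P ∈ J) : DifferentiableAt ℝ f P := (hf P hP).differentiableAt hn₀
  obtain ⟨h, g, hh, hg, hpush⟩ := hbox.exists_reducedField hV₁ hV₂ heD hêJ hfd hbr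
  obtain ⟨Z, hZ, hslope⟩ := hbox.exists_slopeAlong_eq hV₁ heD hêJ hn hf
  refine ⟨Z, h, g,
    { smooth_v := forall_mem_image.2 fun P hP => (hbox.contDiffAt hP).fst.contDiffWithinAt
      smooth_w := fun P hP => (contDiffAt_slopeMap (hbox.contDiffAt hP)
        (hbox.totalDeriv_ne_zero P hP)).contDiffWithinAt
      invariant_v := fun P hP => (hbox.fst_fderiv_apply hP _).trans
        (congrArg Prod.fst (hbox.fderiv_invariants_prolong hP))
      invariant_w := fun P hP => (hbox.snd_fderiv_apply hP _).trans
        (congrArg Prod.snd (hbox.fderiv_invariants_prolong hP))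
      depends_w := fun P hP => fderiv_slopeMap_vertical_ne_zero (hbox.contDiffAt hP)
        (hbox.totalDeriv_ne_zero P hP)
        (hbox.isFlowBox.injective_fderiv (by simp) (hbox.base_mem P hP))
      deriv_v_ne_zero := hbox.totalDeriv_ne_zero
      isOpen_image := hbox.image_invariants ▸ isOpenMap_fst _ ê.open_target
      smooth_Z := forall_mem_image.2 fun P hP => (hZ P hP).contDiffWithinAt
      smooth_h := forall_mem_image.2 <| forall_mem_image.2 fun P hP => (hh P hP).contDiffWithinAt
      smooth_g := forall_mem_image.2 fun P hP => (hg P hP).contDiffWithinAt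
      equation_iff := fun P hP y₂ => hslope P hP ▸ hbox.equation_iff_totalDeriv_div_eq hP y₂
      second_v := fun P hP => (hbox.fst_fderiv_apply hP _).trans (congrArg Prod.fst (hpush P hP))
      second_w := fun P hP => (hbox.snd_fderiv_apply hP _).trans (congrArg Prod.snd (hpush P hP))
      admits_second := forall_mem_image.2 fun P hP => ?_ }⟩
  have hPJ := hêJ hP
  obtain ⟨μ, hμ⟩ := hV₂.lieBracket_eq P hPJ
  have hY : DifferentiableAt ℝ (reducedField h g) (invariants e P) :=
    (DifferentiableAt.comp (invariants e P) ((hh P hP).differentiableAt (by simp))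
      differentiableAt_fst).prodMk ((hg P hP).differentiableAt (by simp))
  exact fderiv_slope_of_related (contDiffAt_infty.1 (hbox.contDiffAt_invariants hP) 2)
    (differentiableAt_equationField (hfd P hPJ))
    ((contDiffAt_prolong (hV₂.contDiffAt _ (heD (hbox.base_mem P hP)))).differentiableAt (by simp))
    (hbox.fst_fderiv_invariants_equationField hP ▸ hbox.totalDeriv_ne_zero P hP) hμ hY
    ((ê.open_source.eventually_mem hP).mono hpush) ((hZ P hP).differentiableAt hn₀)
    ((ê.open_source.eventually_mem hP).mono hslope)

end IsJetFlowBox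

end Reduction

section Quadrature

theorem exists_hasDerivAt_of_continuousOn_ball {K : ℝ → ℝ} {a δ : ℝ}
    (hK : ContinuousOn K (Metric.ball a δ)) :
    ∃ κ : ℝ → ℝ, ∀ t ∈ Metric.ball a δ, HasDerivAt κ (K t) t := by
  refine ⟨fun t => ∫ x in a..t, K x, fun t ht => ?_⟩
  have ha : a ∈ Metric.ball a δ := Metric.mem_ball_self (Metric.pos_of_mem_ball ht)
  have hsub : uIcc a t ⊆ Metric.ball a δ := by
    rw [← segment_eq_uIcc]
    exact (convex_ball a δ).segment_subset ha ht
  exact intervalIntegral.integral_hasDerivAt_right (hK.mono hsub).intervalIntegrable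
    (hK.stronglyMeasurableAtFilter Metric.isOpen_ball t ht)
    (hK.continuousAt (Metric.isOpen_ball.mem_nhds ht))

theorem contDiffOn_of_hasDerivAt {n : ℕ∞} {σ H : ℝ → ℝ} {N : Set ℝ} (hN : IsOpen N)
    (hσ : ∀ t ∈ N, HasDerivAt σ (H t) t) (hH : ContDiffOn ℝ n H N) : ContDiffOn ℝ n σ N := by
  have h : ContDiffOn ℝ (n + 1) σ N :=
    (contDiffOn_succ_iff_deriv_of_isOpen hN).2
      ⟨fun t ht => (hσ t ht).differentiableAt.differentiableWithinAt, fun h => absurd h (by simp),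
        hH.congr fun t ht => (hσ t ht).deriv⟩
  exact h.of_le le_self_add

section Curves

variable {I : Set ℝ} {ρ τ ρ' τ' K κ : ℝ → ℝ}

theorem forall_eq_mul_iff_exists_eq_add (hI : IsOpen I) (hI' : IsPreconnected I)
    (hρ : ∀ x ∈ I, HasDerivAt ρ (ρ' x) x) (hτ : ∀ x ∈ I, HasDerivAt τ (τ' x) x)
    (hκ : ∀ x ∈ I, HasDerivAt κ (K (ρ x)) (ρ x)) :
    (∀ x ∈ I, τ' x = K (ρ x) * ρ' x) ↔ ∃ C, ∀ x ∈ I, τ x = κ (ρ x) + C := by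
  have hd (x) (hx : x ∈ I) :
      HasDerivAt (fun x => τ x - κ (ρ x)) (τ' x - K (ρ x) * ρ' x) x :=
    (hτ x hx).sub ((hκ x hx).comp x (hρ x hx))
  constructor
  · intro h
    obtain ⟨C, hC⟩ := hI.exists_is_const_of_deriv_eq_zero hI'
      (fun x hx => (hd x hx).differentiableAt.differentiableWithinAt)
      fun x hx => by rw [(hd x hx).deriv, h x hx, sub_self, Pi.zero_apply]
    exact ⟨C, fun x hx => sub_eq_iff_eq_add'.1 (hC x hx)⟩
  · rintro ⟨C, hC⟩ x hx
    have hconst : (fun x => τ x - κ (ρ x)) =ᶠ[𝓝 x] fun _ => C :=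
      (hI.eventually_mem hx).mono fun y hy => sub_eq_iff_eq_add'.2 (hC y hy)
    exact sub_eq_zero.1 ((hd x hx).unique ((hasDerivAt_const x C).congr_of_eventuallyEq hconst))

theorem solvesIntegral_iff (hI : IsOpen I) (hI' : IsPreconnected I)
    (hρ : ∀ x ∈ I, HasDerivAt ρ (ρ' x) x) (hτ : ∀ x ∈ I, HasDerivAt τ (τ' x) x)
    (hκ : ∀ x ∈ I, HasDerivAt κ (K (ρ x)) (ρ x)) :
    SolvesIntegral K ρ τ I ↔ ∀ x ∈ I, τ' x = K (ρ x) * ρ' x := by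
  constructor
  · rintro ⟨s, hs⟩
    exact (forall_eq_mul_iff_exists_eq_add hI hI' hρ hτ fun x hx => (hs x hx).2).2
      ⟨0, fun x hx => by rw [(hs x hx).1, add_zero]⟩
  · intro h
    obtain ⟨C, hC⟩ := (forall_eq_mul_iff_exists_eq_add hI hI' hρ hτ hκ).1 h
    exact ⟨fun r => κ r + C, fun x hx => ⟨hC x hx, (hκ x hx).add_const C⟩⟩

end Curves

theorem IsCoordinateSystem.mono {a b : ℝ × ℝ → ℝ} {B B' : Set (ℝ × ℝ)}
    (h : IsCoordinateSystem a b B) (hB : B' ⊆ B) : IsCoordinateSystem a b B' where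
  smooth_fst := h.smooth_fst.mono hB
  smooth_snd := h.smooth_snd.mono hB
  injOn := h.injOn.mono hB
  jacobian z hz := h.jacobian z (hB hz)

theorem IsCanonical.mono {V : ℝ × ℝ → ℝ × ℝ} {a b : ℝ × ℝ → ℝ} {B B' : Set (ℝ × ℝ)}
    (h : IsCanonical V a b B) (hB : B' ⊆ B) : IsCanonical V a b B' where
  coord := h.coord.mono hB
  invariant z hz := h.invariant z (hB hz)
  translated z hz := h.translated z (hB hz)

/-- In the coordinates `(a, b)` of the set `B`, the equation `dw/dv = Z(v,w)` is the quadrature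
`db/da = H(a)`, with `H` of class `C^n`. -/
structure Separates (n : ℕ∞) (Z a b : ℝ × ℝ → ℝ) (H : ℝ → ℝ) (B : Set (ℝ × ℝ)) : Prop where
  coord : IsCoordinateSystem a b B
  contDiffAt : ∀ q ∈ B, ContDiffAt ℝ n H (a q)
  deriv_ne_zero : ∀ q ∈ B, fderiv ℝ a q (1, Z q) ≠ 0
  deriv_eq : ∀ q ∈ B, fderiv ℝ b q (1, Z q) = H (a q) * fderiv ℝ a q (1, Z q)

/-- `κ(v,w) = (v, b - σ(a))` is a chart around `q₀` in the plane of `(v,w)`. The solutions of the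
first-order equation are the level sets of its second coordinate when `(a, b)` separates the
equation and `σ` is a primitive of the right-hand side. -/
structure IsFirstIntegralChart (n : ℕ∞) (κ : OpenPartialHomeomorph (ℝ × ℝ) (ℝ × ℝ))
    (a b : ℝ × ℝ → ℝ) (σ : ℝ → ℝ) (q₀ : ℝ × ℝ) : Prop extends IsBallChart n κ q₀ where
  coe_eq : ⇑κ = fun q => (q.1, b q - σ (a q))

namespace Separates

variable {n : ℕ∞} {Z a b : ℝ × ℝ → ℝ} {H : ℝ → ℝ} {B : Set (ℝ × ℝ)} {q : ℝ × ℝ}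

theorem mono (hsep : Separates n Z a b H B) {B' : Set (ℝ × ℝ)} (hB : B' ⊆ B) :
    Separates n Z a b H B' where
  coord := hsep.coord.mono hB
  contDiffAt q hq := hsep.contDiffAt q (hB hq)
  deriv_ne_zero q hq := hsep.deriv_ne_zero q (hB hq)
  deriv_eq q hq := hsep.deriv_eq q (hB hq)

theorem contDiffAt_fst (hsep : Separates n Z a b H B) (hB : IsOpen B) (hq : q ∈ B) :
    ContDiffAt ℝ ∞ a q :=
  hsep.coord.smooth_fst.contDiffAt (hB.mem_nhds hq)

theorem contDiffAt_snd (hsep : Separates n Z a b H B) (hB : IsOpen B) (hq : q ∈ B) :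
    ContDiffAt ℝ ∞ b q :=
  hsep.coord.smooth_snd.contDiffAt (hB.mem_nhds hq)

/-- The form `db - H da` vanishes on `(1, Z)` and is not zero, so it does not vanish on `(0, 1)`. -/
theorem deriv_vertical_ne (hsep : Separates n Z a b H B) (hq : q ∈ B) :
    fderiv ℝ b q (0, 1) ≠ H (a q) * fderiv ℝ a q (0, 1) := by
  intro h
  have hform : (-H (a q)) • fderiv ℝ a q + (1 : ℝ) • fderiv ℝ b q = 0 := by
    refine ContinuousLinearMap.ext fun u => ?_
    have hu : u = u.1 • (1, Z q) + (u.2 - u.1 * Z q) • (0, 1) := by ext <;> simp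
    rw [hu]
    simp only [add_apply, smul_apply, map_add, map_smul, smul_eq_mul, hsep.deriv_eq q hq, h,
      zero_apply]
    ring
  exact one_ne_zero (LinearIndependent.pair_iff.1 (hsep.coord.jacobian q hq) _ _ hform).2

theorem deriv_snd_eq_mul_iff (hsep : Separates n Z a b H B) (hq : q ∈ B) (m : ℝ) :
    fderiv ℝ b q (1, m) = H (a q) * fderiv ℝ a q (1, m) ↔ m = Z q := by
  have hm : ((1, m) : ℝ × ℝ) = (1, Z q) + (m - Z q) • (0, 1) := by simp
  rw [hm, map_add, map_add, map_smul, map_smul, hsep.deriv_eq q hq, mul_add, add_right_inj,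
    smul_eq_mul, smul_eq_mul, mul_left_comm, ← sub_eq_zero, ← mul_sub, mul_eq_zero,
    or_iff_left (sub_ne_zero.2 (hsep.deriv_vertical_ne hq)), sub_eq_zero]

theorem exists_contDiffOn_ball (hsep : Separates n Z a b H B) (hB : IsOpen B) (hq : q ∈ B) :
    ∃ δ > 0, ContDiffOn ℝ n H (Metric.ball (a q) δ) := by
  have hsurj : (fderiv ℝ a q).range = ⊤ :=
    LinearMap.range_eq_top.2 <| LinearMap.surjective fun h =>
      hsep.deriv_ne_zero q hq (congrArg (fun L : ℝ × ℝ →ₗ[ℝ] ℝ => L (1, Z q)) h)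
  have hmap := ((hsep.contDiffAt_fst hB hq).hasStrictFDerivAt (by simp)).map_nhds_eq_of_surj hsurj
  obtain ⟨δ, hδ, hball⟩ := Metric.mem_nhds_iff.1 (hmap ▸ Filter.image_mem_map (hB.mem_nhds hq))
  exact ⟨δ, hδ, fun t ht => by
    obtain ⟨y, hy, rfl⟩ := hball ht
    exact (hsep.contDiffAt y hy).contDiffWithinAt⟩

theorem exists_isFirstIntegralChart (hsep : Separates n Z a b H B) (hn : 1 ≤ n) (hB : IsOpen B)
    (hq : q ∈ B) :
    ∃ (σ : ℝ → ℝ) (κ : OpenPartialHomeomorph (ℝ × ℝ) (ℝ × ℝ)), IsFirstIntegralChart n κ a b σ q ∧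
      κ.source ⊆ B ∧ ∀ y ∈ κ.source, HasDerivAt σ (H (a y)) (a y) := by
  have hn₀ : (n : WithTop ℕ∞) ≠ 0 := by exact_mod_cast (zero_lt_one.trans_le hn).ne'
  obtain ⟨δ, hδ, hH⟩ := hsep.exists_contDiffOn_ball hB hq
  obtain ⟨σ, hσ⟩ := exists_hasDerivAt_of_continuousOn_ball hH.continuousOn
  have hσn := contDiffOn_of_hasDerivAt Metric.isOpen_ball hσ hH
  have hN : B ∩ a ⁻¹' Metric.ball (a q) δ ∈ 𝓝 q :=
    Filter.inter_mem (hB.mem_nhds hq) <|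
      (hsep.contDiffAt_fst hB hq).continuousAt.preimage_mem_nhds (Metric.ball_mem_nhds _ hδ)
  have hle : (n : WithTop ℕ∞) ≤ ∞ := WithTop.coe_le_coe.2 le_top
  have hφ : ∀ᶠ y in 𝓝 q, ContDiffAt ℝ n (fun y : ℝ × ℝ => (y.1, b y - σ (a y))) y := by
    filter_upwards [hN] with y hy
    exact _root_.contDiffAt_fst.prodMk <| ((hsep.contDiffAt_snd hB hy.1).of_le hle).sub <|
      (hσn.contDiffAt (Metric.isOpen_ball.mem_nhds hy.2)).comp y
        ((hsep.contDiffAt_fst hB hy.1).of_le hle)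
  have hinj : Function.Injective (fderiv ℝ (fun y : ℝ × ℝ => (y.1, b y - σ (a y))) q) := by
    have hd := (hasFDerivAt_fst (𝕜 := ℝ) (p := q)).prodMk <|
      ((hsep.contDiffAt_snd hB hq).differentiableAt (by simp)).hasFDerivAt.sub <|
        (hσ _ (Metric.mem_ball_self hδ)).comp_hasFDerivAt q
          ((hsep.contDiffAt_fst hB hq).differentiableAt (by simp)).hasFDerivAt
    refine hd.fderiv ▸ (injective_iff_map_eq_zero _).2 fun u hu => ?_
    obtain ⟨hu₁, hu₂⟩ : u.1 = 0 ∧ fderiv ℝ b q u - H (a q) * fderiv ℝ a q u = 0 :=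
      Prod.mk_eq_zero.1 hu
    have hu' : u = u.2 • (0, 1) := Prod.ext (by simpa using hu₁) (by simp)
    rw [hu', map_smul, map_smul, smul_eq_mul, smul_eq_mul, mul_left_comm, ← mul_sub, mul_eq_zero,
      or_iff_left (sub_ne_zero.2 (hsep.deriv_vertical_ne hq))] at hu₂
    exact Prod.ext hu₁ hu₂
  obtain ⟨κ, hκ, hsource, hchart⟩ := exists_isBallChart rfl hn₀ hφ hinj hN
  exact ⟨σ, κ, ⟨hchart, hκ⟩, fun y hy => (hsource hy).1, fun y hy => hσ _ (hsource hy).2⟩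

end Separates

namespace IsFirstIntegralChart

variable {n : ℕ∞} {κ : OpenPartialHomeomorph (ℝ × ℝ) (ℝ × ℝ)} {a b : ℝ × ℝ → ℝ} {σ H : ℝ → ℝ}
  {q₀ q₁ : ℝ × ℝ}

theorem exists_image_fst_eq (hκ : IsFirstIntegralChart n κ a b σ q₀) :
    ∃ δ, Prod.fst '' κ.source = Metric.ball q₀.1 δ := by
  obtain ⟨δ, hδ⟩ := hκ.exists_target_eq
  have hδ₀ : (κ q₀).2 ∈ Metric.ball (κ q₀).2 δ :=
    Metric.mem_ball_self (Metric.pos_of_mem_ball (hδ ▸ κ.map_source hκ.mem_source))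
  have himage : Prod.fst '' κ.source = Prod.fst '' κ.target := by
    rw [← κ.image_source_eq_target, image_image, hκ.coe_eq]
  refine ⟨δ, ?_⟩
  rw [himage, hδ, ← ball_prod_same, fst_image_prod _ ⟨(κ q₀).2, hδ₀⟩, hκ.coe_eq]

theorem exists_graph (hκ : IsFirstIntegralChart n κ a b σ q₀) (hq₁ : q₁ ∈ κ.source) :
    ∃ G : ℝ → ℝ, ContDiffOn ℝ n G (Prod.fst '' κ.source) ∧
      (∀ q ∈ κ.source, (q.1, G q.1) ∈ κ.source) ∧
      ∀ q ∈ κ.source, b q - σ (a q) = b q₁ - σ (a q₁) ↔ q.2 = G q.1 := by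
  have hfst (q) : (κ q).1 = q.1 := by rw [hκ.coe_eq]
  have hmem {q} (hq : q ∈ κ.source) : (q.1, (κ q₁).2) ∈ κ.target :=
    hfst q ▸ hκ.mk_mem_target (κ.map_source hq) (κ.map_source hq₁)
  have hgraph {q} (hq : q ∈ κ.source) :
      κ.symm (q.1, (κ q₁).2) = (q.1, (κ.symm (q.1, (κ q₁).2)).2) :=
    Prod.ext (by rw [← hfst, κ.right_inv (hmem hq)]) rfl
  refine ⟨fun r => (κ.symm (r, (κ q₁).2)).2, forall_mem_image.2 fun q hq => ?_,
    fun q hq => hgraph hq ▸ κ.map_target (hmem hq), fun q hq => ?_⟩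
  · exact ((hκ.contDiffAt_symm _ (hmem hq)).comp q.1 (f := fun r => (r, (κ q₁).2))
      (by fun_prop)).snd.contDiffWithinAt
  have hlevel : b q - σ (a q) = b q₁ - σ (a q₁) ↔ (κ q).2 = (κ q₁).2 := by rw [hκ.coe_eq]
  rw [hlevel]
  refine ⟨fun h => ?_, fun h => ?_⟩
  · have hq' : (q.1, (κ q₁).2) = κ q := Prod.ext (hfst q).symm h.symm
    simp only [hq', κ.left_inv hq]
  · have hq' : κ.symm (q.1, (κ q₁).2) = q := (hgraph hq).trans (Prod.ext rfl h.symm)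
    rw [← congrArg Prod.snd (κ.right_inv (hmem hq)), hq']

theorem exists_eq_add (hκ : IsFirstIntegralChart n κ a b σ q₀)
    (ha : ∀ q ∈ κ.source, DifferentiableAt ℝ a q)
    (hσ : ∀ q ∈ κ.source, HasDerivAt σ (H (a q)) (a q)) {σ' : ℝ → ℝ}
    (hσ' : ∀ q ∈ κ.source, HasDerivAt σ' (H (a q)) (a q)) :
    ∃ C, ∀ q ∈ κ.source, σ' (a q) = σ (a q) + C := by
  have hd (q) (hq : q ∈ κ.source) :
      HasFDerivAt (fun q => σ' (a q) - σ (a q)) (0 : ℝ × ℝ →L[ℝ] ℝ) q := by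
    have h := ((hσ' q hq).comp_hasFDerivAt q (ha q hq).hasFDerivAt).sub
      ((hσ q hq).comp_hasFDerivAt q (ha q hq).hasFDerivAt)
    rwa [sub_self] at h
  obtain ⟨C, hC⟩ := κ.open_source.exists_is_const_of_fderiv_eq_zero hκ.isPreconnected_source
    (fun q hq => (hd q hq).differentiableAt.differentiableWithinAt) fun q hq => (hd q hq).fderiv
  exact ⟨C, fun q hq => sub_eq_iff_eq_add'.1 (hC q hq)⟩

end IsFirstIntegralChart

end Quadrature

section TwoIntegrals

theorem isOpenMap_base : IsOpenMap base :=
  IsOpenMap.id.prodMap isOpenMap_fst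

namespace IsCurveIn

variable {U : Set (ℝ × ℝ × ℝ)} {I : Set ℝ} {y y₁ y₂ : ℝ → ℝ} {x : ℝ}

theorem hasDerivAt_comp (hy : IsCurveIn U I y y₁ y₂) (hx : x ∈ I) {F : ℝ × ℝ × ℝ → ℝ}
    (hF : DifferentiableAt ℝ F (x, y x, y₁ x)) :
    HasDerivAt (fun x => F (x, y x, y₁ x)) (totalDeriv₁ F (x, y x, y₁ x) (y₂ x)) x :=
  hF.hasFDerivAt.comp_hasDerivAt x
    ((hasDerivAt_id x).prodMk ((hy.deriv_fst x hx).prodMk (hy.deriv_snd x hx)))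

theorem hasDerivAt_comp_base (hy : IsCurveIn U I y y₁ y₂) (hx : x ∈ I) {F : ℝ × ℝ → ℝ}
    (hF : DifferentiableAt ℝ F (x, y x)) :
    HasDerivAt (fun x => F (x, y x)) (totalDeriv₀ F (x, y x, y₁ x)) x :=
  hF.hasFDerivAt.comp_hasDerivAt x ((hasDerivAt_id x).prodMk (hy.deriv_fst x hx))

end IsCurveIn

namespace ReducesToFirstOrder

variable {n : ℕ∞} {f : ℝ × ℝ × ℝ → ℝ} {V₁ V₂ : ℝ × ℝ → ℝ × ℝ} {U : Set (ℝ × ℝ × ℝ)}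
  {v : ℝ × ℝ → ℝ} {w : ℝ × ℝ × ℝ → ℝ} {Z : ℝ × ℝ → ℝ} {h : ℝ → ℝ} {g : ℝ × ℝ → ℝ}
  {P : ℝ × ℝ × ℝ}

theorem mono (hred : ReducesToFirstOrder n f V₁ V₂ U v w Z h g) {U' : Set (ℝ × ℝ × ℝ)}
    (hU' : U' ⊆ U) (hopen : IsOpen (reduced v w '' U')) :
    ReducesToFirstOrder n f V₁ V₂ U' v w Z h g where
  smooth_v := hred.smooth_v.mono (image_mono hU')
  smooth_w := hred.smooth_w.mono hU'
  invariant_v P hP := hred.invariant_v P (hU' hP)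
  invariant_w P hP := hred.invariant_w P (hU' hP)
  depends_w P hP := hred.depends_w P (hU' hP)
  deriv_v_ne_zero P hP := hred.deriv_v_ne_zero P (hU' hP)
  isOpen_image := hopen
  smooth_Z := hred.smooth_Z.mono (image_mono hU')
  smooth_h := hred.smooth_h.mono (image_mono (image_mono hU'))
  smooth_g := hred.smooth_g.mono (image_mono hU')
  equation_iff P hP := hred.equation_iff P (hU' hP)
  second_v P hP := hred.second_v P (hU' hP)
  second_w P hP := hred.second_w P (hU' hP)
  admits_second q hq := hred.admits_second q (image_mono hU' hq)

theorem contDiffAt_v (hred : ReducesToFirstOrder n f V₁ V₂ U v w Z h g) (hU : IsOpen U)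
    (hP : P ∈ U) : ContDiffAt ℝ ∞ v (base P) :=
  hred.smooth_v.contDiffAt ((isOpenMap_base U hU).mem_nhds (mem_image_of_mem _ hP))

theorem contDiffAt_reduced (hred : ReducesToFirstOrder n f V₁ V₂ U v w Z h g) (hU : IsOpen U)
    (hP : P ∈ U) : ContDiffAt ℝ ∞ (reduced v w) P :=
  ((hred.contDiffAt_v hU hP).comp P contDiff_base.contDiffAt).prodMk
    (hred.smooth_w.contDiffAt (hU.mem_nhds hP))

theorem fderiv_reduced_apply (hred : ReducesToFirstOrder n f V₁ V₂ U v w Z h g) (hU : IsOpen U)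
    (hP : P ∈ U) (u : ℝ × ℝ × ℝ) :
    fderiv ℝ (reduced v w) P u = (fderiv ℝ v (base P) (base u), fderiv ℝ w P u) := by
  have hv := (hred.contDiffAt_v hU hP).differentiableAt (by simp)
  have hvb : DifferentiableAt ℝ (fun Q => v (base Q)) P :=
    hv.comp P (contDiff_base.differentiable one_ne_zero P)
  have hw := (hred.smooth_w.contDiffAt (hU.mem_nhds hP)).differentiableAt (by simp)
  rw [← fderiv_comp_base hv]
  exact congrArg (fun L : ℝ × ℝ × ℝ →L[ℝ] ℝ × ℝ => L u) (hvb.fderiv_prodMk hw)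

theorem fderiv_reduced_eq_smul (hred : ReducesToFirstOrder n f V₁ V₂ U v w Z h g) (hU : IsOpen U)
    (hP : P ∈ U) (y₂ : ℝ) : fderiv ℝ (reduced v w) P (1, P.2.2, y₂) =
      totalDeriv₀ v P • (1, totalDeriv₁ w P y₂ / totalDeriv₀ v P) := by
  rw [hred.fderiv_reduced_apply hU hP, Prod.smul_mk, smul_eq_mul, smul_eq_mul, mul_one,
    mul_div_cancel₀ _ (hred.deriv_v_ne_zero P hP)]
  rfl

theorem totalDeriv₁_comp_reduced (hred : ReducesToFirstOrder n f V₁ V₂ U v w Z h g)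
    (hU : IsOpen U) (hP : P ∈ U) {a : ℝ × ℝ → ℝ} (ha : DifferentiableAt ℝ a (reduced v w P))
    (y₂ : ℝ) : totalDeriv₁ (fun Q => a (reduced v w Q)) P y₂ =
      totalDeriv₀ v P * fderiv ℝ a (reduced v w P) (1, totalDeriv₁ w P y₂ / totalDeriv₀ v P) := by
  rw [← smul_eq_mul, ← map_smul, ← hred.fderiv_reduced_eq_smul hU hP]
  exact congrArg (fun L : ℝ × ℝ × ℝ →L[ℝ] ℝ => L (1, P.2.2, y₂))
    (fderiv_comp P ha ((hred.contDiffAt_reduced hU hP).differentiableAt (by simp)))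

section Separated

variable {a b s : ℝ × ℝ → ℝ} {H σ : ℝ → ℝ} {q₀ : ℝ × ℝ}
  {κ : OpenPartialHomeomorph (ℝ × ℝ) (ℝ × ℝ)}

theorem totalDeriv₁_eq_mul_iff (hred : ReducesToFirstOrder n f V₁ V₂ U v w Z h g) (hU : IsOpen U)
    (hsep : Separates n Z a b H (reduced v w '' U)) (hP : P ∈ U) (y₂ : ℝ) :
    y₂ = f P ↔ totalDeriv₁ (fun Q => b (reduced v w Q)) P y₂ =
      H (a (reduced v w P)) * totalDeriv₁ (fun Q => a (reduced v w Q)) P y₂ := by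
  have hq := mem_image_of_mem (reduced v w) hP
  rw [hred.totalDeriv₁_comp_reduced hU hP
      ((hsep.contDiffAt_snd hred.isOpen_image hq).differentiableAt (by simp)),
    hred.totalDeriv₁_comp_reduced hU hP
      ((hsep.contDiffAt_fst hred.isOpen_image hq).differentiableAt (by simp)),
    mul_left_comm, mul_right_inj' (hred.deriv_v_ne_zero P hP), hsep.deriv_snd_eq_mul_iff hq]
  exact hred.equation_iff P hP y₂

theorem totalDeriv₁_fst_ne_zero (hred : ReducesToFirstOrder n f V₁ V₂ U v w Z h g)
    (hU : IsOpen U) (hsep : Separates n Z a b H (reduced v w '' U)) (hP : P ∈ U) :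
    totalDeriv₁ (fun Q => a (reduced v w Q)) P (f P) ≠ 0 := by
  have hq := mem_image_of_mem (reduced v w) hP
  rw [hred.totalDeriv₁_comp_reduced hU hP
      ((hsep.contDiffAt_fst hred.isOpen_image hq).differentiableAt (by simp)),
    (hred.equation_iff P hP _).1 rfl]
  exact mul_ne_zero (hred.deriv_v_ne_zero P hP) (hsep.deriv_ne_zero _ hq)

theorem curve_iff (hred : ReducesToFirstOrder n f V₁ V₂ U v w Z h g) (hU : IsOpen U)
    (hsep : Separates n Z a b H (reduced v w '' U))
    (hσ : ∀ t ∈ a '' (reduced v w '' U), HasDerivAt σ (H t) t) {I : Set ℝ} {y y₁ y₂ : ℝ → ℝ}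
    (hy : IsCurveIn U I y y₁ y₂) :
    (∀ x ∈ I, y₂ x = f (x, y x, y₁ x)) ↔
      ∃ σ : ℝ → ℝ, (∀ t ∈ a '' (reduced v w '' U), HasDerivAt σ (H t) t) ∧
        ∀ x ∈ I, b (reduced v w (x, y x, y₁ x)) = σ (a (reduced v w (x, y x, y₁ x))) := by
  have hmem (x) (hx : x ∈ I) := mem_image_of_mem (reduced v w) (hy.mem x hx)
  have hcomp {F : ℝ × ℝ → ℝ} (hF : ∀ q ∈ reduced v w '' U, ContDiffAt ℝ ∞ F q) (x) (hx : x ∈ I) :=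
    hy.hasDerivAt_comp hx <| ((hF _ (hmem x hx)).comp _
      (hred.contDiffAt_reduced hU (hy.mem x hx))).differentiableAt (by simp)
  have hquad {σ : ℝ → ℝ} (hσ : ∀ t ∈ a '' (reduced v w '' U), HasDerivAt σ (H t) t) :=
    forall_eq_mul_iff_exists_eq_add hy.isOpen hy.isPreconnected
      (hcomp fun q hq => hsep.contDiffAt_fst hred.isOpen_image hq)
      (hcomp fun q hq => hsep.contDiffAt_snd hred.isOpen_image hq)
      fun x hx => hσ _ (mem_image_of_mem a (hmem x hx))
  rw [forall₂_congr fun x hx => hred.totalDeriv₁_eq_mul_iff hU hsep (hy.mem x hx) (y₂ x)]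
  constructor
  · intro hsol
    obtain ⟨C, hC⟩ := (hquad hσ).1 hsol
    exact ⟨fun t => σ t + C, fun t ht => (hσ t ht).add_const C, hC⟩
  · rintro ⟨σ', hσ', heq⟩
    exact (hquad hσ').2 ⟨0, fun x hx => (heq x hx).trans (add_zero _).symm⟩

theorem exists_isSecondIntegral (hred : ReducesToFirstOrder n f V₁ V₂ U v w Z h g)
    (hU : IsOpen U) (hκU : reduced v w '' U = κ.source) (hκ : IsFirstIntegralChart n κ a b σ q₀)
    (hs : ∀ P ∈ U, DifferentiableAt ℝ s (base P))
    (hw : ∀ P ∈ U, w P = totalDeriv₀ s P / totalDeriv₀ v P)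
    {σ' : ℝ → ℝ} {C : ℝ} (hC : ∀ q ∈ κ.source, σ' (a q) = σ (a q) + C)
    (hP : P ∈ U) (hPσ' : b (reduced v w P) = σ' (a (reduced v w P))) :
    ∃ G : ℝ → ℝ, IsSecondIntegral n U v w a b v s σ' G := by
  have hmem {P} (hP : P ∈ U) : reduced v w P ∈ κ.source := hκU ▸ mem_image_of_mem _ hP
  obtain ⟨G, hG, hgraph, hlevel⟩ := hκ.exists_graph (hmem hP)
  have himage : v '' (base '' U) = Prod.fst '' κ.source := by
    rw [← hκU, image_image, image_image]
    rfl
  obtain ⟨Γ, hΓ⟩ : ∃ Γ : ℝ → ℝ, ∀ t ∈ v '' (base '' U), HasDerivAt Γ (G t) t := by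
    obtain ⟨δ, hδ⟩ := hκ.exists_image_fst_eq
    rw [himage, hδ]
    exact exists_hasDerivAt_of_continuousOn_ball (hδ ▸ hG.continuousOn)
  have hvalue {q} (hq : q ∈ κ.source) : b q = σ' (a q) ↔ q.2 = G q.1 := by
    rw [← hlevel q hq, hPσ', hC q hq, hC _ (hmem hP), add_sub_cancel_left, sub_eq_iff_eq_add']
  have hequation (P) (hP : P ∈ U) : b (reduced v w P) = σ' (a (reduced v w P)) ↔
      totalDeriv₀ s P / totalDeriv₀ v P = G (v (base P)) := by
    rw [hvalue (hmem hP), ← hw P hP]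
    rfl
  refine ⟨G,
    { smooth_G := himage ▸ hG
      determined := forall_mem_image.2 <| forall_mem_image.2 fun P hP => ?_
      equation_iff := hequation
      curve_iff := fun I y y₁ y₂ hy => ?_ }⟩
  · obtain ⟨Q, hQ, hQP⟩ := hκU ▸ hgraph _ (hmem hP)
    refine ⟨Q, hQ, congrArg Prod.fst hQP, (hvalue (hmem hQ)).2 ?_⟩
    rw [hQP]
  · rw [solvesIntegral_iff hy.isOpen hy.isPreconnected
      (fun x hx => hy.hasDerivAt_comp_base hx
        ((hred.contDiffAt_v hU (hy.mem x hx)).differentiableAt (by simp)))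
      (fun x hx => hy.hasDerivAt_comp_base hx (hs _ (hy.mem x hx)))
      fun x hx => hΓ _ (mem_image_of_mem v (mem_image_of_mem base (hy.mem x hx)))]
    exact forall₂_congr fun x hx => (hequation _ (hy.mem x hx)).trans
      (div_eq_iff (hred.deriv_v_ne_zero _ (hy.mem x hx)))

theorem reducesToTwoIntegrals (hred : ReducesToFirstOrder n f V₁ V₂ U v w Z h g) (hU : IsOpen U)
    (hκU : reduced v w '' U = κ.source) (hκ : IsFirstIntegralChart n κ a b σ q₀)
    (hsep : Separates n Z a b H (reduced v w '' U))
    (hσ : ∀ t ∈ a '' (reduced v w '' U), HasDerivAt σ (H t) t)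
    (hcan : IsCanonical V₁ v s (base '' U))
    (hw : ∀ P ∈ U, w P = totalDeriv₀ s P / totalDeriv₀ v P) :
    ReducesToTwoIntegrals n f V₁ U v w a b H v s where
  coord_tilde := hsep.coord
  smooth_H := forall_mem_image.2 fun q hq => (hsep.contDiffAt q hq).contDiffWithinAt
  deriv_rt_ne_zero P hP := hred.totalDeriv₁_fst_ne_zero hU hsep hP
  formula_H P hP := eq_div_of_mul_eq (hred.totalDeriv₁_fst_ne_zero hU hsep hP)
    ((hred.totalDeriv₁_eq_mul_iff hU hsep hP _).1 rfl).symm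
  equation_iff P hP y₂ := hred.totalDeriv₁_eq_mul_iff hU hsep hP y₂
  curve_iff I y y₁ y₂ hy := hred.curve_iff hU hsep hσ hy
  canonical := hcan
  deriv_r_ne_zero := hred.deriv_v_ne_zero
  second_integral σ' hσ' := by
    rintro ⟨P, hP, hPσ'⟩
    obtain ⟨C, hC⟩ := hκ.exists_eq_add
      (fun q hq => (hsep.contDiffAt_fst hred.isOpen_image (hκU ▸ hq)).differentiableAt (by simp))
      (fun q hq => hσ _ (mem_image_of_mem a (hκU ▸ hq)))
      fun q hq => hσ' _ (mem_image_of_mem a (hκU ▸ hq))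
    exact hred.exists_isSecondIntegral hU hκU hκ
      (fun P hP => (hcan.coord.smooth_snd.contDiffAt
        ((isOpenMap_base U hU).mem_nhds (mem_image_of_mem _ hP))).differentiableAt (by simp))
      hw hC hP hPσ'

end Separated

theorem exists_reducesToTwoIntegrals (hred : ReducesToFirstOrder n f V₁ V₂ U v w Z h g)
    (hU : IsOpen U) (hn : 1 ≤ n) {s a b : ℝ × ℝ → ℝ} {H : ℝ → ℝ} {B : Set (ℝ × ℝ)}
    (hcan : IsCanonical V₁ v s (base '' U))
    (hw : ∀ P ∈ U, w P = totalDeriv₀ s P / totalDeriv₀ v P)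
    (hB : IsOpen B) (hBU : B ⊆ reduced v w '' U) (hsep : Separates n Z a b H B)
    (hP : P ∈ U) (hPB : reduced v w P ∈ B) :
    ∃ U' ⊆ U, IsOpen U' ∧ P ∈ U' ∧ reduced v w '' U' ⊆ B ∧
      ReducesToTwoIntegrals n f V₁ U' v w a b H v s := by
  obtain ⟨σ, κ, hκ, hκB, hσ⟩ := hsep.exists_isFirstIntegralChart hn hB hPB
  have himage : reduced v w '' (U ∩ reduced v w ⁻¹' κ.source) = κ.source := by
    rw [image_inter_preimage, inter_eq_right.2 (hκB.trans hBU)]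
  have hopen : IsOpen (U ∩ reduced v w ⁻¹' κ.source) :=
    ContinuousOn.isOpen_inter_preimage (fun Q hQ =>
      (hred.contDiffAt_reduced hU hQ).continuousAt.continuousWithinAt) hU κ.open_source
  have hopen' : IsOpen (reduced v w '' (U ∩ reduced v w ⁻¹' κ.source)) := by
    rw [himage]
    exact κ.open_source
  refine ⟨_, inter_subset_left, hopen, ⟨hP, hκ.mem_source⟩, himage.trans_subset hκB,
    (hred.mono inter_subset_left hopen').reducesToTwoIntegrals hopen himage hκ
      (hsep.mono (himage.trans_subset hκB)) ?_ (hcan.mono (image_mono inter_subset_left))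
      fun Q hQ => hw Q hQ.1⟩
  rw [himage]
  exact forall_mem_image.2 hσ

end ReducesToFirstOrder

end TwoIntegrals

section SolvableCase

theorem IsBallChart.isCoordinateSystem {e : OpenPartialHomeomorph (ℝ × ℝ) (ℝ × ℝ)} {q : ℝ × ℝ}
    (he : IsBallChart ∞ e q) :
    IsCoordinateSystem (fun z => (e z).1) (fun z => (e z).2) e.source where
  smooth_fst z hz := (he.contDiffAt z hz).fst.contDiffWithinAt
  smooth_snd z hz := (he.contDiffAt z hz).snd.contDiffWithinAt
  injOn := e.injOn
  jacobian z hz := by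
    have hd := ((he.contDiffAt z hz).differentiableAt (by simp)).hasFDerivAt
    have hsurj : Function.Surjective (fderiv ℝ e z) :=
      LinearMap.injective_iff_surjective.1
        (show Function.Injective (fderiv ℝ e z).toLinearMap from he.injective_fderiv (by simp) hz)
    rw [hd.fst.fderiv, hd.snd.fderiv, LinearIndependent.pair_iff]
    intro s t hst
    obtain ⟨ξ, hξ⟩ := hsurj (1, 0)
    obtain ⟨ζ, hζ⟩ := hsurj (0, 1)
    exact ⟨by simpa [hξ] using congrArg (fun L : ℝ × ℝ →L[ℝ] ℝ => L ξ) hst,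
      by simpa [hζ] using congrArg (fun L : ℝ × ℝ →L[ℝ] ℝ => L ζ) hst⟩

theorem IsCoordinateSystem.swap {a b : ℝ × ℝ → ℝ} {B : Set (ℝ × ℝ)}
    (h : IsCoordinateSystem a b B) : IsCoordinateSystem b a B where
  smooth_fst := h.smooth_snd
  smooth_snd := h.smooth_fst
  injOn _ hz _ hz' heq := h.injOn hz hz' (Prod.swap_injective heq)
  jacobian z hz := LinearIndependent.pair_symm_iff.1 (h.jacobian z hz)

theorem IsFlowBox.isCanonical {Y : ℝ × ℝ → ℝ × ℝ} {q₀ : ℝ × ℝ}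
    {ε : OpenPartialHomeomorph (ℝ × ℝ) (ℝ × ℝ)} (hε : IsFlowBox ε Y q₀) :
    IsCanonical Y (fun q => (ε q).1) (fun q => (ε q).2) ε.source where
  coord := hε.isCoordinateSystem
  invariant q hq := by
    rw [((hε.contDiffAt q hq).differentiableAt (by simp)).hasFDerivAt.fst.fderiv]
    exact congrArg Prod.fst (hε.fderiv_apply q hq)
  translated q hq := by
    rw [((hε.contDiffAt q hq).differentiableAt (by simp)).hasFDerivAt.snd.fderiv]
    exact congrArg Prod.snd (hε.fderiv_apply q hq)

theorem lieBracket_one_prodMk {Y : ℝ × ℝ → ℝ × ℝ} {Z : ℝ × ℝ → ℝ} {q : ℝ × ℝ}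
    (hY : DifferentiableAt ℝ Y q) (hZ : DifferentiableAt ℝ Z q)
    (hadm : (prolong Y (q.1, q.2, Z q)).2.2 = fderiv ℝ Z q (Y q)) :
    VectorField.lieBracket ℝ Y (fun q => (1, Z q)) q =
      -(fderiv ℝ Y q (1, Z q)).1 • (1, Z q) := by
  have hfield : fderiv ℝ (fun q => ((1 : ℝ), Z q)) q (Y q) = (0, fderiv ℝ Z q (Y q)) := by
    rw [((hasFDerivAt_const 1 q).prodMk hZ.hasFDerivAt).fderiv]
    rfl
  have hbase : base (q.1, q.2, Z q) = q := rfl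
  rw [prolong, totalDeriv₀_fst hY, totalDeriv₀_snd hY, hbase] at hadm
  rw [VectorField.lieBracket, hfield, ← hadm]
  ext
  · simp
  · simp [mul_comm]

/-- The translations of the second coordinate permute the solutions, so the slope of the solutions
depends on the first coordinate only. -/
theorem IsFlowBox.exists_separates {n : ℕ∞} {Y : ℝ × ℝ → ℝ × ℝ} {Z : ℝ × ℝ → ℝ} {q₀ : ℝ × ℝ}
    {ε : OpenPartialHomeomorph (ℝ × ℝ) (ℝ × ℝ)} (hε : IsFlowBox ε Y q₀) (hn : 1 ≤ n)
    (hY : ∀ q ∈ ε.source, DifferentiableAt ℝ Y q) (hZ : ∀ q ∈ ε.source, ContDiffAt ℝ n Z q)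
    (hadm : ∀ q ∈ ε.source, (prolong Y (q.1, q.2, Z q)).2.2 = fderiv ℝ Z q (Y q))
    (hli : ∀ q ∈ ε.source, LinearIndependent ℝ ![(1, Z q), Y q]) :
    ∃ H, Separates n Z (fun q => (ε q).1) (fun q => (ε q).2) H ε.source := by
  have hn₀ : (n : WithTop ℕ∞) ≠ 0 := by exact_mod_cast (zero_lt_one.trans_le hn).ne'
  have hne (q) (hq : q ∈ ε.source) : (fderiv ℝ ε q (1, Z q)).1 ≠ 0 :=
    hε.fst_fderiv_ne_zero hq (hli q hq)
  have hd (q) (hq : q ∈ ε.source) : HasFDerivAt ε (fderiv ℝ ε q) q :=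
    ((hε.contDiffAt q hq).differentiableAt (by simp)).hasFDerivAt
  have hfield (q) (hq : q ∈ ε.source) : ContDiffAt ℝ n (fun q => ((1 : ℝ), Z q)) q :=
    contDiffAt_const.prodMk (hZ q hq)
  obtain ⟨H, hH, heq⟩ := hε.exists_eq_comp_fst hn (u := slopeAlong ε fun q => (1, Z q))
    (fun q hq => contDiffAt_slopeAlong (hε.contDiffAt q hq) (WithTop.coe_le_coe.2 le_top)
      (hfield q hq) (hne q hq)) fun q hq => by
    rw [fderiv_slopeAlong_of_lieBracket_eq_smul (contDiffAt_infty.1 (hε.contDiffAt q hq) 2)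
      ((hfield q hq).differentiableAt hn₀) (hY q hq) (hne q hq)
      (lieBracket_one_prodMk (hY q hq) ((hZ q hq).differentiableAt hn₀) (hadm q hq))
      ((ε.open_source.eventually_mem hq).mono hε.fderiv_apply)]
    simp
  refine ⟨H, hε.isCoordinateSystem, hH, fun q hq => ?_, fun q hq => ?_⟩
  · rw [(hd q hq).fst.fderiv]
    exact hne q hq
  · rw [(hd q hq).fst.fderiv, (hd q hq).snd.fderiv, ← heq q hq]
    exact (div_mul_cancel₀ _ (hne q hq)).symm

/-- If the symmetry is tangent to the solutions, these are its orbits. -/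
theorem IsFlowBox.separates_zero {n : ℕ∞} {Y : ℝ × ℝ → ℝ × ℝ} {Z k : ℝ × ℝ → ℝ} {q₀ : ℝ × ℝ}
    {ε : OpenPartialHomeomorph (ℝ × ℝ) (ℝ × ℝ)} (hε : IsFlowBox ε Y q₀)
    (hY : ∀ q ∈ ε.source, Y q = k q • (1, Z q)) :
    Separates n Z (fun q => (ε q).2) (fun q => (ε q).1) (fun _ => 0) ε.source := by
  have himage (q) (hq : q ∈ ε.source) : k q • fderiv ℝ ε q (1, Z q) = (0, 1) := by
    rw [← map_smul, ← hY q hq, hε.fderiv_apply q hq]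
  have hd (q) (hq : q ∈ ε.source) : HasFDerivAt ε (fderiv ℝ ε q) q :=
    ((hε.contDiffAt q hq).differentiableAt (by simp)).hasFDerivAt
  have hsnd (q) (hq : q ∈ ε.source) : k q * (fderiv ℝ ε q (1, Z q)).2 = 1 :=
    congrArg Prod.snd (himage q hq)
  refine ⟨hε.isCoordinateSystem.swap, fun q _ => contDiffAt_const, fun q hq => ?_, fun q hq => ?_⟩
  · rw [(hd q hq).snd.fderiv]
    exact right_ne_zero_of_mul_eq_one (hsnd q hq)
  · rw [(hd q hq).fst.fderiv, zero_mul]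
    exact (mul_eq_zero.1 (congrArg Prod.fst (himage q hq))).resolve_left
      (left_ne_zero_of_mul_eq_one (hsnd q hq))

theorem linearIndependent_triple_iff_of_ker_eq_span {K M N : Type*} [Field K] [AddCommGroup M]
    [Module K M] [AddCommGroup N] [Module K N] {L : M →ₗ[K] N} {a b c : M} (hb : b ≠ 0)
    (hker : LinearMap.ker L = K ∙ b) :
    LinearIndependent K ![a, b, c] ↔ LinearIndependent K ![L a, L c] := by
  have hLb : L b = 0 := LinearMap.mem_ker.1 (hker ▸ Submodule.mem_span_singleton_self b)
  constructor
  · refine fun h => LinearIndependent.pair_iff.2 fun s t hst => ?_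
    have hmem : s • a + t • c ∈ LinearMap.ker L := by
      rw [LinearMap.mem_ker, map_add, map_smul, map_smul, hst]
    obtain ⟨r, hr⟩ := Submodule.mem_span_singleton.1 (hker ▸ hmem)
    have hzero := Fintype.linearIndependent_iff.1 h ![s, -r, t] (by
      simp only [Fin.sum_univ_three, Matrix.cons_val, neg_smul, hr]
      abel)
    exact ⟨hzero 0, hzero 2⟩
  · refine fun h => Fintype.linearIndependent_iff.2 fun s hs => ?_
    rw [Fin.sum_univ_three] at hs
    simp only [Matrix.cons_val] at hs
    obtain ⟨h0, h2⟩ := LinearIndependent.pair_iff.1 h (s 0) (s 2) (by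
      simpa [hLb] using congrArg L hs)
    have h1 : s 1 = 0 := by simpa [h0, h2, hb] using hs
    exact Fin.forall_fin_succ.2 ⟨h0, Fin.forall_fin_two.2 ⟨h1, h2⟩⟩

namespace ReducesToFirstOrder

variable {n : ℕ∞} {f : ℝ × ℝ × ℝ → ℝ} {V₁ V₂ : ℝ × ℝ → ℝ × ℝ} {U : Set (ℝ × ℝ × ℝ)}
  {v : ℝ × ℝ → ℝ} {w : ℝ × ℝ × ℝ → ℝ} {Z : ℝ × ℝ → ℝ} {h : ℝ → ℝ} {g : ℝ × ℝ → ℝ} {P : ℝ × ℝ × ℝ}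

theorem fderiv_reduced_equationField (hred : ReducesToFirstOrder n f V₁ V₂ U v w Z h g)
    (hU : IsOpen U) (hP : P ∈ U) : fderiv ℝ (reduced v w) P (1, P.2.2, f P) =
      totalDeriv₀ v P • (1, Z (reduced v w P)) := by
  rw [hred.fderiv_reduced_eq_smul hU hP, (hred.equation_iff P hP _).1 rfl]

theorem fderiv_reduced_prolong (hred : ReducesToFirstOrder n f V₁ V₂ U v w Z h g)
    (hU : IsOpen U) (hP : P ∈ U) :
    fderiv ℝ (reduced v w) P (prolong V₂ P) = reducedField h g (reduced v w P) := by
  rw [hred.fderiv_reduced_apply hU hP, hred.second_w P hP]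
  exact congrArg (·, _) (hred.second_v P hP)

theorem contDiffAt_reducedField (hred : ReducesToFirstOrder n f V₁ V₂ U v w Z h g) {q : ℝ × ℝ}
    (hq : q ∈ reduced v w '' U) : ContDiffAt ℝ ∞ (reducedField h g) q := by
  have hU := hred.isOpen_image
  have hh : ContDiffAt ℝ ∞ h q.1 :=
    hred.smooth_h.contDiffAt ((isOpenMap_fst _ hU).mem_nhds (mem_image_of_mem _ hq))
  exact (hh.comp q contDiffAt_fst).prodMk (hred.smooth_g.contDiffAt (hU.mem_nhds hq))

end ReducesToFirstOrder

namespace IsJetFlowBox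

variable {D : Set (ℝ × ℝ)} {J : Set (ℝ × ℝ × ℝ)} {n : ℕ∞} {f : ℝ × ℝ × ℝ → ℝ}
  {V₁ V₂ : ℝ × ℝ → ℝ × ℝ} {e : OpenPartialHomeomorph (ℝ × ℝ) (ℝ × ℝ)}
  {ê : OpenPartialHomeomorph (ℝ × ℝ × ℝ) ((ℝ × ℝ) × ℝ)} {P P₀ : ℝ × ℝ × ℝ}
  {Z : ℝ × ℝ → ℝ} {h : ℝ → ℝ} {g : ℝ × ℝ → ℝ}

theorem prolong_ne_zero (hbox : IsJetFlowBox e ê V₁ P₀) (hP : P ∈ ê.source) :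
    prolong V₁ P ≠ 0 := fun h0 => by
  have h := hbox.isFlowBox_jet.fderiv_apply P hP
  rw [h0, map_zero] at h
  exact zero_ne_one (congrArg Prod.snd h)

theorem linearIndependent_iff (hbox : IsJetFlowBox e ê V₁ P₀)
    (hred : ReducesToFirstOrder n f V₁ V₂ ê.source (fun z => (e z).1) (slopeMap e) Z h g)
    (hP : P ∈ ê.source) :
    LinearIndependent ℝ ![((1 : ℝ), P.2.2, f P), prolong V₁ P, prolong V₂ P] ↔
      LinearIndependent ℝ ![(1, Z (invariants e P)), reducedField h g (invariants e P)] := by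
  rw [linearIndependent_triple_iff_of_ker_eq_span (hbox.prolong_ne_zero hP)
      (hbox.ker_fderiv_invariants hP),
    ContinuousLinearMap.coe_coe, hred.fderiv_reduced_equationField ê.open_source hP,
    hred.fderiv_reduced_prolong ê.open_source hP, linearIndependent_pair_iff_det_ne_zero,
    linearIndependent_pair_iff_det_ne_zero]
  simp only [Prod.smul_mk, smul_eq_mul, mul_assoc, ← mul_sub]
  exact mul_ne_zero_iff_left (hbox.totalDeriv_ne_zero P hP)

theorem reducedField_ne_zero (hbox : IsJetFlowBox e ê V₁ P₀)
    (hred : ReducesToFirstOrder n f V₁ V₂ ê.source (fun z => (e z).1) (slopeMap e) Z h g)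
    (hP : P ∈ ê.source) (hli : LinearIndependent ℝ ![prolong V₁ P, prolong V₂ P]) :
    reducedField h g (invariants e P) ≠ 0 := by
  rw [← hred.fderiv_reduced_prolong ê.open_source hP]
  intro h0
  have hmem : prolong V₂ P ∈ ℝ ∙ prolong V₁ P := hbox.ker_fderiv_invariants hP ▸ h0
  obtain ⟨r, hr⟩ := Submodule.mem_span_singleton.1 hmem
  exact (LinearIndependent.pair_iff' (hbox.prolong_ne_zero hP)).1 hli r hr

theorem mk_invariants_snd (hbox : IsJetFlowBox e ê V₁ P₀) (P : ℝ × ℝ × ℝ) :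
    (invariants e P, (ê P).2) = ê P :=
  Prod.ext (hbox.fst_apply P).symm rfl

theorem tendsto_mk_snd (hbox : IsJetFlowBox e ê V₁ P₀) :
    Filter.Tendsto (fun q => (q, (ê P₀).2)) (𝓝 (invariants e P₀)) (𝓝 (ê P₀)) :=
  Continuous.tendsto' (by fun_prop) _ _ (hbox.mk_invariants_snd P₀)

theorem tendsto_section (hbox : IsJetFlowBox e ê V₁ P₀) :
    Filter.Tendsto (fun q => ê.symm (q, (ê P₀).2)) (𝓝 (invariants e P₀)) (𝓝 P₀) :=
  (ê.tendsto_symm hbox.isFlowBox_jet.mem_source).comp hbox.tendsto_mk_snd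

theorem eventually_invariants_section (hbox : IsJetFlowBox e ê V₁ P₀) :
    ∀ᶠ q in 𝓝 (invariants e P₀), invariants e (ê.symm (q, (ê P₀).2)) = q := by
  filter_upwards [hbox.tendsto_mk_snd.eventually_mem
    (ê.open_target.mem_nhds (ê.map_source hbox.isFlowBox_jet.mem_source))] with q hq
  rw [← hbox.fst_apply, ê.right_inv hq]

theorem exists_isLocalFlowAt_reducedField (hbox : IsJetFlowBox e ê V₁ P₀)
    (hV₂ : IsPointSymmetry D J f V₂) (heD : e.source ⊆ D)
    (hred : ReducesToFirstOrder n f V₁ V₂ ê.source (fun z => (e z).1) (slopeMap e) Z h g) :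
    ∃ Φ, IsLocalFlowAt Φ (reducedField h g) (invariants e P₀) := by
  have hP₀ := hbox.isFlowBox_jet.mem_source
  have hsource := ê.open_source.eventually_mem hP₀
  obtain ⟨Φ, hΦ⟩ := hV₂.exists_flow (base P₀) (heD (hbox.base_mem P₀ hP₀))
  have hV₂d : ∀ᶠ z in 𝓝 (base P₀), DifferentiableAt ℝ V₂ z :=
    (e.open_source.eventually_mem (hbox.base_mem P₀ hP₀)).mono fun z hz =>
      (hV₂.contDiffAt z (heD hz)).differentiableAt (by simp)
  refine ⟨_, (hΦ.prolong hV₂d).semiconj (π := invariants e) (σ := fun q => ê.symm (q, (ê P₀).2))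
    (hsource.mono fun P hP => hbox.contDiffAt_invariants hP) ?_
    (by rw [hbox.mk_invariants_snd, ê.left_inv hP₀]) hbox.eventually_invariants_section
    (hsource.mono fun P hP => hred.fderiv_reduced_prolong ê.open_source hP)⟩
  filter_upwards [hbox.tendsto_mk_snd.eventually_mem
    (ê.open_target.mem_nhds (ê.map_source hP₀))] with q hq
  exact (hbox.isFlowBox_jet.contDiffAt_symm _ hq).comp q (f := fun q => (q, (ê P₀).2))
    (by fun_prop)

theorem exists_isFlowBox_reducedField (hbox : IsJetFlowBox e ê V₁ P₀)
    (hV₂ : IsPointSymmetry D J f V₂) (heD : e.source ⊆ D)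
    (hred : ReducesToFirstOrder n f V₁ V₂ ê.source (fun z => (e z).1) (slopeMap e) Z h g)
    (hne : reducedField h g (invariants e P₀) ≠ 0) {p : ℝ × ℝ → Prop}
    (hp : ∀ᶠ q in 𝓝 (invariants e P₀), p q) :
    ∃ ε : OpenPartialHomeomorph (ℝ × ℝ) (ℝ × ℝ),
      IsFlowBox ε (reducedField h g) (invariants e P₀) ∧
        ε.source ⊆ invariants e '' ê.source ∧ ∀ q ∈ ε.source, p q := by
  obtain ⟨Φ, hΦ⟩ := hbox.exists_isLocalFlowAt_reducedField hV₂ heD hred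
  obtain ⟨ε, hε, hsub⟩ := hΦ.exists_isFlowBox hne ((hred.isOpen_image.eventually_mem
    (mem_image_of_mem _ hbox.isFlowBox_jet.mem_source)).and hp)
  exact ⟨ε, hε, fun q hq => (hsub hq).1, fun q hq => (hsub hq).2⟩

theorem exists_reducesToTwoIntegrals (hbox : IsJetFlowBox e ê V₁ P₀) (hn : 1 ≤ n)
    (hred : ReducesToFirstOrder n f V₁ V₂ ê.source (fun z => (e z).1) (slopeMap e) Z h g)
    {B : Set (ℝ × ℝ)} (hB : IsOpen B) (hBU : B ⊆ invariants e '' ê.source)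
    {a b : ℝ × ℝ → ℝ} {H : ℝ → ℝ} (hsep : Separates n Z a b H B)
    (hP₀ : invariants e P₀ ∈ B) :
    ∃ U' r s, IsOpen U' ∧ P₀ ∈ U' ∧ U' ⊆ ê.source ∧ invariants e '' U' ⊆ B ∧
      ReducesToTwoIntegrals n f V₁ U' (fun z => (e z).1) (slopeMap e) a b H r s := by
  obtain ⟨U', hU', hopen, hmem, himage, htwo⟩ :=
    hred.exists_reducesToTwoIntegrals ê.open_source hn
      (hbox.isFlowBox.isCanonical.mono (image_subset_iff.2 hbox.base_mem)) (fun _ _ => rfl)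
      hB hBU hsep hbox.isFlowBox_jet.mem_source hP₀
  exact ⟨U', _, _, hopen, hmem, hU', himage, htwo⟩

theorem exists_reducesToTwoIntegrals_of_linearIndependent (hbox : IsJetFlowBox e ê V₁ P₀)
    (hn : 1 ≤ n) (hV₂ : IsPointSymmetry D J f V₂) (heD : e.source ⊆ D)
    (hred : ReducesToFirstOrder n f V₁ V₂ ê.source (fun z => (e z).1) (slopeMap e) Z h g)
    (hli : LinearIndependent ℝ ![((1 : ℝ), P₀.2.2, f P₀), prolong V₁ P₀, prolong V₂ P₀]) :
    ∃ U' rt st H r s, IsOpen U' ∧ P₀ ∈ U' ∧ U' ⊆ ê.source ∧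
      IsCanonical (reducedField h g) rt st (invariants e '' U') ∧
        ReducesToTwoIntegrals n f V₁ U' (fun z => (e z).1) (slopeMap e) rt st H r s := by
  have hmem := mem_image_of_mem (invariants e) hbox.isFlowBox_jet.mem_source
  have hli₀ := (hbox.linearIndependent_iff hred hbox.isFlowBox_jet.mem_source).1 hli
  have hZ {q} (hq : q ∈ invariants e '' ê.source) : ContDiffAt ℝ n Z q :=
    hred.smooth_Z.contDiffAt (hred.isOpen_image.mem_nhds hq)
  have hYc := (hred.contDiffAt_reducedField hmem).continuousAt
  have hdet : ∀ᶠ q in 𝓝 (invariants e P₀),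
      1 * (reducedField h g q).2 - Z q * (reducedField h g q).1 ≠ 0 :=
    ((hYc.snd.const_mul 1).sub ((hZ hmem).continuousAt.mul hYc.fst)).eventually_ne
      (linearIndependent_pair_iff_det_ne_zero.1 hli₀)
  obtain ⟨ε, hε, hsub, hdetε⟩ :=
    hbox.exists_isFlowBox_reducedField hV₂ heD hred (hli₀.ne_zero 1) hdet
  obtain ⟨H, hsep⟩ := hε.exists_separates hn
    (fun q hq => (hred.contDiffAt_reducedField (hsub hq)).differentiableAt (by simp))
    (fun q hq => hZ (hsub hq)) (fun q hq => hred.admits_second q (hsub hq))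
    fun q hq => linearIndependent_pair_iff_det_ne_zero.2 (hdetε q hq)
  obtain ⟨U', r, s, hU', hP₀, hsubU, himage, htwo⟩ :=
    hbox.exists_reducesToTwoIntegrals hn hred ε.open_source hsub hsep hε.mem_source
  exact ⟨U', _, _, H, r, s, hU', hP₀, hsubU, hε.isCanonical.mono himage, htwo⟩

theorem exists_reducesToTwoIntegrals_of_not_linearIndependent (hbox : IsJetFlowBox e ê V₁ P₀)
    (hn : 1 ≤ n) (hV₂ : IsPointSymmetry D J f V₂) (heD : e.source ⊆ D)
    (hred : ReducesToFirstOrder n f V₁ V₂ ê.source (fun z => (e z).1) (slopeMap e) Z h g)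
    (hli : LinearIndependent ℝ ![prolong V₁ P₀, prolong V₂ P₀])
    (hdep : ∀ᶠ P in 𝓝 P₀,
      ¬ LinearIndependent ℝ ![((1 : ℝ), P.2.2, f P), prolong V₁ P, prolong V₂ P]) :
    ∃ U' rt st r s, IsOpen U' ∧ P₀ ∈ U' ∧ U' ⊆ ê.source ∧
      IsCanonical (reducedField h g) st rt (invariants e '' U') ∧
        ReducesToTwoIntegrals n f V₁ U' (fun z => (e z).1) (slopeMap e) rt st (fun _ => 0) r s := by
  have hP₀ := hbox.isFlowBox_jet.mem_source
  have hparallel : ∀ᶠ q in 𝓝 (invariants e P₀), reducedField h g q = h q.1 • (1, Z q) := by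
    filter_upwards [hbox.tendsto_section.eventually (hdep.and (ê.open_source.eventually_mem hP₀)),
      hbox.eventually_invariants_section] with q hq hqP
    have hdet := mt linearIndependent_pair_iff_det_ne_zero.2
      (mt (hbox.linearIndependent_iff hred hq.2).2 hq.1)
    rw [not_not, hqP, one_mul, sub_eq_zero] at hdet
    exact Prod.ext (mul_one _).symm (hdet.trans (mul_comm _ _))
  obtain ⟨ε, hε, hsub, hparallelε⟩ := hbox.exists_isFlowBox_reducedField hV₂ heD hred
    (hbox.reducedField_ne_zero hred hP₀ hli) hparallel
  obtain ⟨U', r, s, hU', hP₀, hsubU, himage, htwo⟩ := hbox.exists_reducesToTwoIntegrals hn hred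
    ε.open_source hsub (hε.separates_zero hparallelε) hε.mem_source
  exact ⟨U', _, _, r, s, hU', hP₀, hsubU, hε.isCanonical.mono himage, htwo⟩

end IsJetFlowBox

end SolvableCase

theorem IsLocalTransformationGroup.isPointSymmetry {D S : Set (ℝ × ℝ)}
    {φ X : ℝ × ℝ → ℝ × ℝ → ℝ × ℝ} (hX : IsLocalTransformationGroup D S φ X)
    {J : Set (ℝ × ℝ × ℝ)} (hJ : IsOpen J) (hJD : ∀ P ∈ J, base P ∈ D) {f : ℝ × ℝ × ℝ → ℝ}
    (hf : ∀ P ∈ J, DifferentiableAt ℝ f P) (hadm : AdmitsGroup S X J f) (c : ℝ × ℝ) :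
    IsPointSymmetry D J f (generator X c) := by
  rw [generator_eq_infinitesimal]
  obtain ⟨γ, -, hγ⟩ := hX.exists_isLocalFlowAt c
  exact ⟨fun z hz => hX.contDiffAt_infinitesimal c hz, fun z hz => ⟨_, hγ z hz⟩,
    fun P hP => ⟨_, hX.lieBracket_prolong_equationField hJ hadm c hP (hJD P hP) (hf P hP)⟩⟩

theorem theorem3p2_general (D S : Set (ℝ × ℝ)) (φ X : ℝ × ℝ → ℝ × ℝ → ℝ × ℝ)
    (hX : IsLocalTransformationGroup D S φ X)
    (n : ℕ∞) (hn : 1 ≤ n)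
    (J : Set (ℝ × ℝ × ℝ)) (hJ : IsOpen J) (hJD : ∀ P ∈ J, base P ∈ D)
    (f : ℝ × ℝ × ℝ → ℝ) (hf : ContDiffOn ℝ n f J)
    (hadm : AdmitsGroup S X J f) :
    (∃ (c d : ℝ × ℝ) (k : ℝ), IsSolvableBasis D X c d k) ∧
    ∀ (c d : ℝ × ℝ) (k : ℝ), IsSolvableBasis D X c d k →
    ∀ P₀ ∈ J, LinearIndependent ℝ ![((1 : ℝ), P₀.2.2), generator X c (base P₀)] →
    ∃ (U : Set (ℝ × ℝ × ℝ)) (v : ℝ × ℝ → ℝ) (w : ℝ × ℝ × ℝ → ℝ)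
      (Z : ℝ × ℝ → ℝ) (h : ℝ → ℝ) (g : ℝ × ℝ → ℝ),
      IsOpen U ∧ P₀ ∈ U ∧ U ⊆ J ∧
      ReducesToFirstOrder n f (generator X c) (generator X d) U v w Z h g ∧
      (LinearIndependent ℝ ![((1 : ℝ), P₀.2.2, f P₀),
          prolong (generator X c) P₀, prolong (generator X d) P₀] →
        ∃ (U' : Set (ℝ × ℝ × ℝ)) (rt st : ℝ × ℝ → ℝ) (H : ℝ → ℝ) (r s : ℝ × ℝ → ℝ),
          IsOpen U' ∧ P₀ ∈ U' ∧ U' ⊆ U ∧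
          IsCanonical (reducedField h g) rt st (reduced v w '' U') ∧
          ReducesToTwoIntegrals n f (generator X c) U' v w rt st H r s) ∧
      (LinearIndependent ℝ ![prolong (generator X c) P₀, prolong (generator X d) P₀] →
        (∀ᶠ P in 𝓝 P₀, ¬ LinearIndependent ℝ ![((1 : ℝ), P.2.2, f P),
          prolong (generator X c) P, prolong (generator X d) P]) →
        ∃ (U' : Set (ℝ × ℝ × ℝ)) (rt st : ℝ × ℝ → ℝ) (r s : ℝ × ℝ → ℝ),
          IsOpen U' ∧ P₀ ∈ U' ∧ U' ⊆ U ∧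
          IsCanonical (reducedField h g) st rt (reduced v w '' U') ∧
          ReducesToTwoIntegrals n f (generator X c) U' v w rt st (fun _ => 0) r s) := by
  refine ⟨hX.exists_isSolvableBasis, fun c d k hcd P₀ hP₀ hli => ?_⟩
  have hn₀ : (n : WithTop ℕ∞) ≠ 0 := by exact_mod_cast (zero_lt_one.trans_le hn).ne'
  have hf' (P) (hP : P ∈ J) : ContDiffAt ℝ n f P := hf.contDiffAt (hJ.mem_nhds hP)
  have hfd (P) (hP : P ∈ J) : DifferentiableAt ℝ f P := (hf' P hP).differentiableAt hn₀
  have hV := hX.isPointSymmetry hJ hJD hfd hadm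
  obtain ⟨e, ê, hbox, heD, hêJ⟩ :=
    (hV c).exists_isJetFlowBox hX.isOpen_domain hJ hJD hfd hP₀ hli
  obtain ⟨Z, h, g, hred⟩ := hbox.exists_reducesToFirstOrder (hV c) (hV d) heD hêJ hn hf' hcd.2
  exact ⟨ê.source, _, _, Z, h, g, ê.open_source, hbox.isFlowBox_jet.mem_source, hêJ, hred,
    hbox.exists_reducesToTwoIntegrals_of_linearIndependent hn (hV d) heD hred,
    hbox.exists_reducesToTwoIntegrals_of_not_linearIndependent hn (hV d) heD hred⟩

theorem theorem3p2 (D S : Set (ℝ × ℝ)) (φ X : ℝ × ℝ → ℝ × ℝ → ℝ × ℝ)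
    (hX : IsTwoParameterLieGroup D S φ X)
    (n : ℕ∞) (hn : 1 ≤ n)
    (J : Set (ℝ × ℝ × ℝ)) (hJ : IsOpen J) (hJD : ∀ P ∈ J, base P ∈ D)
    (f : ℝ × ℝ × ℝ → ℝ) (hf : ContDiffOn ℝ n f J)
    (hadm : AdmitsGroup S X J f) :
    (∃ (c d : ℝ × ℝ) (k : ℝ), IsSolvableBasis D X c d k) ∧
    ∀ (c d : ℝ × ℝ) (k : ℝ), IsSolvableBasis D X c d k →
    ∀ P₀ ∈ J, LinearIndependent ℝ ![((1 : ℝ), P₀.2.2), generator X c (base P₀)] →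
    ∃ (U : Set (ℝ × ℝ × ℝ)) (v : ℝ × ℝ → ℝ) (w : ℝ × ℝ × ℝ → ℝ)
      (Z : ℝ × ℝ → ℝ) (h : ℝ → ℝ) (g : ℝ × ℝ → ℝ),
      IsOpen U ∧ P₀ ∈ U ∧ U ⊆ J ∧
      ReducesToFirstOrder n f (generator X c) (generator X d) U v w Z h g ∧
      (LinearIndependent ℝ ![((1 : ℝ), P₀.2.2, f P₀),
          prolong (generator X c) P₀, prolong (generator X d) P₀] →
        ∃ (U' : Set (ℝ × ℝ × ℝ)) (rt st : ℝ × ℝ → ℝ) (H : ℝ → ℝ) (r s : ℝ × ℝ → ℝ),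
          IsOpen U' ∧ P₀ ∈ U' ∧ U' ⊆ U ∧
          IsCanonical (reducedField h g) rt st (reduced v w '' U') ∧
          ReducesToTwoIntegrals n f (generator X c) U' v w rt st H r s) ∧
      (LinearIndependent ℝ ![prolong (generator X c) P₀, prolong (generator X d) P₀] →
        (∀ᶠ P in 𝓝 P₀, ¬ LinearIndependent ℝ ![((1 : ℝ), P.2.2, f P),
          prolong (generator X c) P, prolong (generator X d) P]) →
        ∃ (U' : Set (ℝ × ℝ × ℝ)) (rt st : ℝ × ℝ → ℝ) (r s : ℝ × ℝ → ℝ),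
          IsOpen U' ∧ P₀ ∈ U' ∧ U' ⊆ U ∧
          IsCanonical (reducedField h g) st rt (reduced v w '' U') ∧
          ReducesToTwoIntegrals n f (generator X c) U' v w rt st (fun _ => 0) r s) :=
  theorem3p2_general D S φ X hX.isLocalTransformationGroup n hn J hJ hJD f hf hadm
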